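/- Let $\mathbb T=\mathbb R/\mathbb Z$ and, for an integer $n\ge 0$, let $\mathcal A_n=\bigoplus_{\mathbb N}\mathbb Z/n\mathbb Z$ (so $\mathcal A_0=\bigoplus_{\mathbb N}\mathbb Z$) and let $\hat{\mathcal A}_n$ be its Pontryagin dual, identified with the closed subgroup $\{y\in\mathbb T^{\mathbb N}: ny=0\}$ of $\mathbb T^{\mathbb N}$ through the pairing $y(x)=\sum_i x_iy_i$; thus $\hat{\mathcal A}_0=\mathbb T^{\mathbb N}$ and $\hat{\mathcal A}_n=(\tfrac1n\mathbb Z/\mathbb Z)^{\mathbb N}$ for $n\ge1$. For an integer $m\ge0$ let $\mathrm{Ann}(m\mathcal A_n)\le\hat{\mathcal A}_n$ be the subgroup of characters that vanish on $m\mathcal A_n$. For a compact metrizable abelian group $G$, let $\mathrm{Sub}(G)$ be the space of closed subgroups of $G$ with the Chabauty topology, and let $\mathrm{CRS}(G)$ be the convex set of Borel probability measures on $\mathrm{Sub}(G)$ that are invariant under all automorphisms of the topological group $G$ (characteristic random subgroups). Let $\mathrm{CRS}^e(G)$ be the set of indecomposable elements of $\mathrm{CRS}(G)$: those $\lambda$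 that cannot be written as $t\mu_1+(1-t)\mu_2$ with $t\in(0,1)$ and $\mu_1\ne\mu_2$ in $\mathrm{CRS}(G)$. A finite abelian group $F$ is said to be over $m$ if every nontrivial direct summand $F_1$ of $F$ satisfies $mF_1\ne0$ (in particular $F=0$ is over every $m$, and only $F=0$ is over $0$). Let $[F]$ denote the isomorphism class of $F$. **Theorem.** Let $n\ge0$ be an integer and let $\lambda\in\mathrm{CRS}^e(\hat{\mathcal A}_n)$. Then there is a unique pair $(m,[F])$, where $m\ge0$ is an integer and $F$ is a finite abelian group over $m$, such that $m\mid n$ (every $m\ge 0$ divides $0$, and $0$ divides only $0$), $nF=0$, and the random closed subgroup $\mathrm{Ann}(m\mathcal A_n)+h(F)$ of $\hat{\mathcal A}_n$ has law $\lambda$, where $h$ is a random element of the compact group $\mathrm{Hom}(F,\hat{\mathcal A}_n)$ distributed according to the normalized Haar measure. -/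

import Mathlib

open MeasureTheory TopologicalSpace
open scoped Pointwise

namespace CharRandSub

noncomputable section

/-! ### Closed subgroups and characteristic random subgroups -/

/-- The Chabauty topology on the set of closed subgroups of `G`: it is generated by the sets
`{H | H ∩ U ≠ ∅}`, `U` open, and `{H | H ∩ K = ∅}`, `K` compact. -/
instance chabauty (G : Type*) [AddGroup G] [TopologicalSpace G] :
    TopologicalSpace (ClosedAddSubgroup G) :=
  generateFrom
    ({S | ∃ U : Set G, IsOpen U ∧
        S = {H : ClosedAddSubgroup G | ((H : Set G) ∩ U).Nonempty}} ∪
      {S | ∃ K : Set G, IsCompact K ∧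
        S = {H : ClosedAddSubgroup G | Disjoint (H : Set G) K}})

/-- The Borel sigma-algebra of the Chabauty topology. -/
instance chabautyMeasurableSpace (G : Type*) [AddGroup G] [TopologicalSpace G] :
    MeasurableSpace (ClosedAddSubgroup G) :=
  borel _

instance chabautyBorelSpace (G : Type*) [AddGroup G] [TopologicalSpace G] :
    BorelSpace (ClosedAddSubgroup G) :=
  ⟨rfl⟩

/-- The image of a closed subgroup under an automorphism of the topological group `G`. -/
def mapAut {G : Type*} [AddGroup G] [TopologicalSpace G] (φ : G ≃ₜ+ G)
    (H : ClosedAddSubgroup G) : ClosedAddSubgroup G where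
  toAddSubgroup := H.toAddSubgroup.map (φ : G →+ G)
  isClosed' := φ.toHomeomorph.isClosedMap _ H.isClosed'

lemma continuous_mapAut {G : Type*} [AddGroup G] [TopologicalSpace G] (φ : G ≃ₜ+ G) :
    Continuous (mapAut φ) := by
  have hc : ∀ H : ClosedAddSubgroup G, (mapAut φ H : Set G) = φ '' (H : Set G) := fun H => rfl
  refine continuous_generateFrom_iff.mpr ?_
  rintro _ (⟨U, hU, rfl⟩ | ⟨K, hK, rfl⟩)
  · refine isOpen_generateFrom_of_mem (Or.inl ⟨φ ⁻¹' U, hU.preimage φ.continuous, ?_⟩)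
    ext H
    simp only [Set.mem_preimage, Set.mem_ofPred_eq, hc, Set.image_inter_nonempty_iff]
  · refine isOpen_generateFrom_of_mem (Or.inr ⟨φ ⁻¹' K,
      φ.toHomeomorph.isCompact_preimage.mpr hK, ?_⟩)
    ext H
    simp only [Set.mem_preimage, Set.mem_ofPred_eq, hc, Set.disjoint_image_left]

/-- `CRS(G)` for an abelian topological group `G`: the Borel probability measures on the space of
closed subgroups that are invariant under all automorphisms of the topological group `G`. -/
def CRS (G : Type*) [AddCommGroup G] [TopologicalSpace G] :
    Set (Measure (ClosedAddSubgroup G)) :=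
  {μ | IsProbabilityMeasure μ ∧ ∀ φ : G ≃ₜ+ G, μ.map (mapAut φ) = μ}

/-- The indecomposable elements (extreme points) of `CRS(G)`. -/
def CRSe (G : Type*) [AddCommGroup G] [TopologicalSpace G] :
    Set (Measure (ClosedAddSubgroup G)) :=
  {μ | μ ∈ CRS G ∧ ¬ ∃ μ₁ ∈ CRS G, ∃ μ₂ ∈ CRS G, ∃ t ∈ Set.Ioo (0 : ℝ) 1,
    μ₁ ≠ μ₂ ∧ μ = ENNReal.ofReal t • μ₁ + ENNReal.ofReal (1 - t) • μ₂}

/-! ### The groups `𝒜`, `𝒜_n` and their duals -/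

/-- The free abelian group `𝒜` of countable rank. -/
abbrev FreeAb : Type := ℕ →₀ ℤ

/-- The torus `𝕋^ℕ`, which is the Pontryagin dual of `𝒜` through `pairing`. -/
abbrev Torus : Type := ℕ → UnitAddCircle

/-- The duality pairing `y(x) = ∑ xᵢ yᵢ` between `𝒜` and `𝕋^ℕ`. -/
def pairing (x : FreeAb) (y : Torus) : UnitAddCircle :=
  x.sum fun i k => k • y i

lemma pairing_zero (x : FreeAb) : pairing x 0 = 0 := by
  simp [pairing]

lemma pairing_add (x : FreeAb) (y z : Torus) :
    pairing x (y + z) = pairing x y + pairing x z := by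
  simp [pairing, Finsupp.sum_add]

lemma pairing_neg (x : FreeAb) (y : Torus) : pairing x (-y) = -pairing x y := by
  simp [pairing, Finsupp.sum_neg]

lemma continuous_pairing (x : FreeAb) : Continuous (pairing x) := by
  unfold pairing Finsupp.sum
  fun_prop

/-- The annihilator `Ann(H) ≤ 𝕋^ℕ` of a subgroup `H ≤ 𝒜`. -/
def ann (H : AddSubgroup FreeAb) : AddSubgroup Torus where
  carrier := {y | ∀ x ∈ H, pairing x y = 0}
  zero_mem' := fun x _ => pairing_zero x
  add_mem' := fun {y z} hy hz x hx => by simp [pairing_add, hy x hx, hz x hx]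
  neg_mem' := fun {y} hy x hx => by simp [pairing_neg, hy x hx]

lemma isClosed_ann (H : AddSubgroup FreeAb) : IsClosed (ann H : Set Torus) := by
  have h : (ann H : Set Torus) = ⋂ x ∈ H, {y | pairing x y = 0} := by
    ext y
    simp [ann]
  rw [h]
  exact isClosed_biInter fun x _ => isClosed_eq (continuous_pairing x) continuous_const

/-- The subgroup `n𝒜` of `𝒜`. -/
def mulSub (n : ℕ) : AddSubgroup FreeAb := (nsmulAddMonoidHom n : FreeAb →+ FreeAb).range

lemma mem_ann_mulSub {n : ℕ} {y : Torus} : y ∈ ann (mulSub n) ↔ ∀ i, n • y i = 0 := by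
  constructor
  · intro h i
    have := h (n • Finsupp.single i (1 : ℤ)) ⟨Finsupp.single i 1, rfl⟩
    simpa [pairing] using this
  · rintro h _ ⟨a, rfl⟩
    have key : ∀ i, ∀ k : ℤ, (n • k) • y i = 0 := fun i k => by
      rw [nsmul_eq_mul, mul_comm, mul_smul, natCast_zsmul, h i, smul_zero]
    change pairing (n • a) y = 0
    unfold pairing
    rw [Finsupp.sum_of_support_subset _ (Finsupp.support_smul) _ (by simp)]
    exact Finset.sum_eq_zero fun i _ => by simpa using key i (a i)

/-- The compact group `𝒜̂_n`, the dual of `𝒜_n = 𝒜 / n𝒜`, realised as the subgroup `Ann(n𝒜)` of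
`𝕋^ℕ`. By `mem_Ahat` it is `𝕋^ℕ` for `n = 0` and `((1/n)ℤ/ℤ)^ℕ` for `n ≥ 1`. -/
def Ahat (n : ℕ) : AddSubgroup Torus := ann (mulSub n)

lemma mem_Ahat {n : ℕ} {y : Torus} : y ∈ Ahat n ↔ ∀ i, n • y i = 0 :=
  mem_ann_mulSub

instance compactSpace_Ahat (n : ℕ) : CompactSpace (Ahat n) :=
  isCompact_iff_compactSpace.mp (isClosed_ann _).isCompact

/-- The annihilator of `m𝒜_n` in `𝒜̂_n`. An element `y` of `𝒜̂_n` takes on the class in `𝒜_n` of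
`x : 𝒜` the value `pairing x y`, and `m𝒜_n` consists of the classes of the elements of `m𝒜`. -/
def annMul (n m : ℕ) : AddSubgroup (Ahat n) := (ann (mulSub m)).addSubgroupOf (Ahat n)

lemma mem_annMul {n m : ℕ} {y : Ahat n} : y ∈ annMul n m ↔ ∀ i, m • (y : Torus) i = 0 :=
  AddSubgroup.mem_addSubgroupOf.trans mem_ann_mulSub

lemma isCompact_annMul (n m : ℕ) : IsCompact (annMul n m : Set (Ahat n)) :=
  ((isClosed_ann (mulSub m)).preimage continuous_subtype_val).isCompact

/-! ### The random subgroup `Ann(m𝒜_n) + h(F)` -/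

/-- `F` is over `m`: every nontrivial direct summand `F₁` of `F` satisfies `m F₁ ≠ 0`. -/
def IsOver (m : ℕ) (F : Type*) [AddCommGroup F] : Prop :=
  ∀ F₁ F₂ : AddSubgroup F, IsCompl F₁ F₂ → F₁ ≠ ⊥ → ∃ x ∈ F₁, m • x ≠ 0

/-- The Borel sigma-algebra of the (compact-open) topology on `Hom(F, G)`. -/
instance homMeasurableSpace (F G : Type*) [AddMonoid F] [TopologicalSpace F] [AddMonoid G]
    [TopologicalSpace G] : MeasurableSpace (F →ₜ+ G) :=
  borel _

instance homBorelSpace (F G : Type*) [AddMonoid F] [TopologicalSpace F] [AddMonoid G]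
    [TopologicalSpace G] : BorelSpace (F →ₜ+ G) :=
  ⟨rfl⟩

variable (n m : ℕ) (F : Type*) [AddCommGroup F] [Finite F] [TopologicalSpace F]
  [DiscreteTopology F]

/-- The normalized Haar measure on the compact group `Hom(F, 𝒜̂_n)`, for a finite discrete
abelian group `F`. -/
def haarHom : Measure (F →ₜ+ Ahat n) := Measure.addHaarMeasure ⊤

instance isProbabilityMeasure_haarHom : IsProbabilityMeasure (haarHom n F) :=
  ⟨Measure.addHaarMeasure_self (K₀ := (⊤ : PositiveCompacts (F →ₜ+ Ahat n)))⟩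

variable {F}

/-- The closed subgroup `Ann(m𝒜_n) + h(F)` of `𝒜̂_n`. -/
def sumSub (h : F →ₜ+ Ahat n) : ClosedAddSubgroup (Ahat n) where
  toAddSubgroup := annMul n m ⊔ (h : F →+ Ahat n).range
  isClosed' := by
    change IsClosed ((annMul n m ⊔ (h : F →+ Ahat n).range : AddSubgroup (Ahat n)) :
      Set (Ahat n))
    rw [AddSubgroup.add_normal]
    exact ((isCompact_annMul n m).add (Set.finite_range h).isCompact).isClosed

lemma continuous_sumSub : Continuous (sumSub n m : (F →ₜ+ Ahat n) → _) := by
  have hc : ∀ h : F →ₜ+ Ahat n, (sumSub n m h : Set (Ahat n)) =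
      (annMul n m : Set (Ahat n)) + Set.range h := fun h =>
    AddSubgroup.add_normal (annMul n m) (h : F →+ Ahat n).range
  have hm : ∀ (h : F →ₜ+ Ahat n) (S : Set (Ahat n)),
      ((sumSub n m h : Set (Ahat n)) ∩ S).Nonempty ↔
        ∃ f, h f ∈ S - (annMul n m : Set (Ahat n)) := by
    intro h S
    rw [hc]
    constructor
    · rintro ⟨_, ⟨a, ha, _, ⟨f, rfl⟩, rfl⟩, hS⟩
      exact ⟨f, _, hS, a, ha, by simp⟩
    · rintro ⟨f, s, hs, a, ha, e⟩
      refine ⟨s, ⟨a, ha, h f, ⟨f, rfl⟩, ?_⟩, hs⟩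
      rw [← e]
      simp
  refine continuous_generateFrom_iff.mpr ?_
  rintro _ (⟨U, hU, rfl⟩ | ⟨K, hK, rfl⟩)
  · simp only [Set.preimage_ofPred_eq, hm, Set.ofPred_exists]
    exact isOpen_iUnion fun f => hU.sub_right.preimage (continuous_eval_const f)
  · simp only [Set.preimage_ofPred_eq, Set.disjoint_iff_inter_eq_empty,
      ← Set.not_nonempty_iff_eq_empty, hm, not_exists, Set.ofPred_forall]
    have hcl : IsClosed (K - (annMul n m : Set (Ahat n))) := by
      rw [sub_eq_add_neg]
      exact (hK.add (isCompact_annMul n m).neg).isClosed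
    exact isOpen_iInter_of_finite fun f =>
      hcl.isOpen_compl.preimage (continuous_eval_const f)

variable (F)

/-- The pair `(m, [F])` is admissible for `n` (`F` is over `m`, `m ∣ n` and `n F = 0`) and the
random subgroup `Ann(m𝒜_n) + h(F)`, with `h` a Haar-random element of `Hom(F, 𝒜̂_n)`, has
law `μ`. -/
def Describes (μ : Measure (ClosedAddSubgroup (Ahat n))) : Prop :=
  IsOver m F ∧ m ∣ n ∧ (∀ x : F, n • x = 0) ∧ (haarHom n F).map (sumSub n m) = μ

end

end CharRandSub

open MeasureTheory TopologicalSpace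
open scoped Pointwise

namespace CharRandSub

noncomputable section

/-! ### Characters of `𝒜̂_n` -/

/-! Everything is read on the dual side. A closed subgroup K of `𝒜̂_n` is determined by H = `perp
K`, a subgroup of 𝒜 containing n𝒜, and the events x ∈ H generate the Borel structure
(`chabautyMeasurableSpace_eq`). By Smith normal form, an automorphism of 𝒜 that moves only finitely
many basis vectors reduces any finite subset of 𝒜 to multiples of distinct basis vectors. An
invariant law is therefore determined by the probabilities that d_i e_i ∈ H for all i in a finite
set (`FinInv.ext`).

Indecomposability enters only through independence. Restricting λ to the event d e_j ∈ H and letting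
j → ∞ gives an invariant part of λ, because a finitary automorphism fixes e_j for large j. This part
must be a multiple of λ, so d e_j ∈ H is independent of what happens on earlier basis vectors
(`independent_of_mem_CRSe`). The law is then determined by the single function P(d) = P(d e_0 ∈ H),
called `annProb`.

It remains to see that P(d) is 1/|dF| on the multiples of some m and 0 elsewhere. A change of basis
in two coordinates gives P(a)P(b) = P(gcd)P(lcm). Counting relations modulo p among the d e_i gives
P(pd) = p^r P(d) with r a natural number when P(d) > 0 (`exists_annProb_prime_mul`); r does not
increase from d to pd (`exponent_antitone`), and P reaches 1 at a positive integer unless it is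
supported at 0 (`exists_annProb_eq_one`). On the side of groups, passing from d to pd divides |dF|
by p to the number of cyclic p-summands not killed by d. So for each prime the exponents r form a
partition, whose conjugate prescribes the summands of F (`Independent.exists_group`).

Conversely the coordinates of a Haar-random h are independent uniform characters of F, whence the
product formula `measureReal_annEvents_sumSub`, and the two laws agree. For uniqueness, the support
of P gives m, and the values |dF| with m ∣ d count the cyclic summands not killed by m; a group over
m has no others. -/

lemma pairing_add_left (x x' : FreeAb) (y : Torus) :
    pairing (x + x') y = pairing x y + pairing x' y := by
  unfold pairing
  exact Finsupp.sum_add_index' (by simp) (by simp [add_smul])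

lemma pairing_zero_left (y : Torus) : pairing 0 y = 0 := by simp [pairing]

/-- The pairing as a homomorphism in its first argument. -/
def pairingHom (y : Torus) : FreeAb →+ UnitAddCircle where
  toFun x := pairing x y
  map_zero' := pairing_zero_left y
  map_add' x x' := pairing_add_left x x' y

@[simp] lemma pairingHom_apply (x : FreeAb) (y : Torus) : pairingHom y x = pairing x y := rfl

lemma pairing_neg_left (x : FreeAb) (y : Torus) : pairing (-x) y = -pairing x y :=
  map_neg (pairingHom y) x

lemma pairing_sub_left (x x' : FreeAb) (y : Torus) :
    pairing (x - x') y = pairing x y - pairing x' y :=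
  map_sub (pairingHom y) x x'

lemma pairing_single (i : ℕ) (k : ℤ) (y : Torus) : pairing (Finsupp.single i k) y = k • y i := by
  simp [pairing]

/-- The character of `𝒜̂_n` given by an element of `𝒜`, with values in `ℂ`. -/
def echar (n : ℕ) (x : FreeAb) : C(Ahat n, ℂ) where
  toFun y := AddCircle.toCircle (pairing x y)
  continuous_toFun := continuous_induced_dom.comp <| AddCircle.continuous_toCircle.comp <|
    (continuous_pairing x).comp continuous_subtype_val

lemma echar_apply (n : ℕ) (x : FreeAb) (y : Ahat n) :
    echar n x y = AddCircle.toCircle (pairing x y) := rfl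

/-- The star subalgebra generated by the characters coming from `𝒜`. -/
def echarSubalgebra (n : ℕ) : StarSubalgebra ℂ C(Ahat n, ℂ) where
  toSubalgebra := Algebra.adjoin ℂ (Set.range (echar n))
  star_mem' := by
    change Algebra.adjoin ℂ (Set.range (echar n)) ≤ star (Algebra.adjoin ℂ (Set.range (echar n)))
    refine Algebra.adjoin_le ?_
    rintro - ⟨x, rfl⟩
    refine Algebra.subset_adjoin ⟨-x, ContinuousMap.ext fun y => ?_⟩
    rw [echar_apply, pairing_neg_left, AddCircle.toCircle_neg, Circle.coe_inv_eq_conj]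
    rfl

lemma echarSubalgebra_coe (n : ℕ) :
    Subalgebra.toSubmodule (echarSubalgebra n).toSubalgebra =
      Submodule.span ℂ (Set.range (echar n)) := by
  apply Algebra.adjoin_eq_span_of_subset
  refine Set.Subset.trans ?_ Submodule.subset_span
  intro x hx
  refine Submonoid.closure_induction (fun _ => id) ⟨0, ?_⟩ ?_ hx
  · ext1 z
    simp [echar_apply, pairing_zero_left]
  · rintro - - - - ⟨m, rfl⟩ ⟨n, rfl⟩
    refine ⟨m + n, ?_⟩
    ext1 z
    simp [echar_apply, pairing_add_left, AddCircle.toCircle_add]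

/-- Stone–Weierstrass: characters multiply to characters, and the coordinates alone already separate
points. -/
lemma dense_span_echar (n : ℕ) :
    Dense (Submodule.span ℂ (Set.range (echar n)) : Set C(Ahat n, ℂ)) := by
  have hsep : (echarSubalgebra n).SeparatesPoints := by
    intro x y hxy
    have : ∃ i, (x : Torus) i ≠ (y : Torus) i := by
      by_contra! h
      exact hxy (Subtype.ext (funext h))
    obtain ⟨i, hi⟩ := this
    refine ⟨_, ⟨echar n (Finsupp.single i 1), Algebra.subset_adjoin ⟨_, rfl⟩, rfl⟩, ?_⟩
    dsimp only
    rw [echar_apply, echar_apply, pairing_single, pairing_single, one_smul, one_smul]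
    contrapose hi
    exact AddCircle.injective_toCircle one_ne_zero (Circle.ext hi)
  have htop := ContinuousMap.starSubalgebra_topologicalClosure_eq_top_of_separatesPoints
    (echarSubalgebra n) hsep
  rw [← echarSubalgebra_coe]
  intro f
  have : f ∈ (echarSubalgebra n).topologicalClosure := htop ▸ trivial
  exact this

/-! ### Integration against characters of compact groups -/

section Integration

variable {X : Type*} [TopologicalSpace X] [MeasurableSpace X] [BorelSpace X]

/-- The functional `f ↦ ∫ f(g(x)) w(x) dν(x)`. -/
def integralFunctional [CompactSpace X] (n : ℕ) (ν : Measure X)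
    [IsProbabilityMeasure ν] (g : C(X, Ahat n))
    (w : C(X, ℂ)) : C(Ahat n, ℂ) →L[ℂ] ℂ :=
  LinearMap.mkContinuous
    { toFun := fun f => ∫ x, f (g x) * w x ∂ν
      map_add' := fun f f' => by
        have h : ∀ f : C(Ahat n, ℂ), Integrable (fun x => f (g x) * w x) ν := fun f =>
          (Continuous.integrable_of_hasCompactSupport (by fun_prop)
            (HasCompactSupport.of_compactSpace _))
        rw [← integral_add (h f) (h f')]
        simp [add_mul]
      map_smul' := fun c f => by
        simp [mul_assoc, integral_const_mul] }
    ‖w‖ (fun f => by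
      refine (norm_integral_le_of_norm_le_const (C := ‖w‖ * ‖f‖) ?_).trans (by simp)
      filter_upwards with x
      rw [norm_mul, mul_comm]
      gcongr
      · exact w.norm_coe_le_norm x
      · exact f.norm_coe_le_norm _)

lemma integralFunctional_apply [CompactSpace X] (n : ℕ) (ν : Measure X)
    [IsProbabilityMeasure ν] (g : C(X, Ahat n))
    (w : C(X, ℂ)) (f : C(Ahat n, ℂ)) :
    integralFunctional n ν g w f = ∫ x, f (g x) * w x ∂ν := rfl

/-- Both duality statements below rest on this: two functionals are compared on characters, then
evaluated at one function where they would have to differ. -/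
lemma functional_ext {n : ℕ} {L L' : C(Ahat n, ℂ) →L[ℂ] ℂ}
    (h : ∀ x, L (echar n x) = L' (echar n x)) : L = L' := by
  refine ContinuousLinearMap.ext_on (dense_span_echar n) ?_
  rintro _ ⟨x, rfl⟩
  exact h x

/-- A nontrivial character of a compact group has integral zero. -/
lemma integral_toCircle_eq_zero [AddGroup X] [IsTopologicalAddGroup X] (ν : Measure X)
    [ν.IsAddLeftInvariant] (χ : X →+ UnitAddCircle) (hχ : χ ≠ 0) :
    ∫ x, (AddCircle.toCircle (χ x) : ℂ) ∂ν = 0 := by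
  obtain ⟨x₀, hx₀⟩ : ∃ x, χ x ≠ 0 := by
    by_contra! h
    exact hχ (AddMonoidHom.ext h)
  -- Translation by `x₀` multiplies the integral by the value of the character at `x₀`, which is not
  -- 1.
  have h1 : ∫ x, (AddCircle.toCircle (χ (x₀ + x)) : ℂ) ∂ν =
      ∫ x, (AddCircle.toCircle (χ x) : ℂ) ∂ν :=
    integral_add_left_eq_self (fun x => (AddCircle.toCircle (χ x) : ℂ)) x₀
  simp only [map_add, AddCircle.toCircle_add, Circle.coe_mul, integral_const_mul] at h1
  have h2 : (AddCircle.toCircle (χ x₀) : ℂ) ≠ 1 := by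
    intro h
    apply hx₀
    apply AddCircle.injective_toCircle one_ne_zero
    rw [AddCircle.toCircle_zero]
    exact Circle.ext h
  have h3 : ((AddCircle.toCircle (χ x₀) : ℂ) - 1) * ∫ x, (AddCircle.toCircle (χ x) : ℂ) ∂ν = 0 := by
    rw [sub_mul, h1, one_mul, sub_self]
  exact (mul_eq_zero.mp h3).resolve_left (sub_ne_zero.mpr h2)

end Integration

/-! ### Pontryagin duality between 𝒜 and `𝒜̂_n` -/

/-- Every continuous character of `𝒜̂_n` comes from `𝒜`. -/
lemma exists_eq_pairing {n : ℕ} (χ : Ahat n →ₜ+ UnitAddCircle) :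
    ∃ x : FreeAb, ∀ y : Ahat n, χ y = pairing x y := by
  by_contra! hne
  borelize ↥(Ahat n)
  let ν : Measure (Ahat n) := Measure.addHaarMeasure ⊤
  have : IsProbabilityMeasure ν := ⟨Measure.addHaarMeasure_self⟩
  let e : C(Ahat n, ℂ) := ⟨fun y => AddCircle.toCircle (χ y),
    continuous_induced_dom.comp <| AddCircle.continuous_toCircle.comp χ.continuous⟩
  let w : C(Ahat n, ℂ) := ⟨fun y => AddCircle.toCircle (-χ y),
    continuous_induced_dom.comp <| AddCircle.continuous_toCircle.comp χ.continuous.neg⟩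
  -- If χ is none of the pairings, it is orthogonal to all of them, so integration against its
  -- conjugate is the zero functional; at χ itself that functional takes the value 1.
  have h0 : integralFunctional n ν (.id _) w = 0 := by
    refine functional_ext fun x => ?_
    rw [integralFunctional_apply]
    let χ' : Ahat n →+ UnitAddCircle :=
      { toFun := fun y => pairing x y - χ y
        map_zero' := by simp [pairing_zero]
        map_add' := fun y y' => by
          simp only [AddSubgroup.coe_add, pairing_add, map_add]; abel }
    have hχ' : χ' ≠ 0 := by
      obtain ⟨y, hy⟩ := hne x
      intro h
      have := DFunLike.congr_fun h y
      exact hy (sub_eq_zero.mp this).symm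
    change _ = (0 : ℂ)
    rw [← integral_toCircle_eq_zero ν χ' hχ']
    congr 1 with y
    simp [echar_apply, w, χ', sub_eq_add_neg, AddCircle.toCircle_add]
  have h1 : integralFunctional n ν (.id _) w e = 1 := by
    rw [integralFunctional_apply]
    simp [e, w, AddCircle.toCircle_neg]
  rw [h0] at h1
  simp at h1

/-- The annihilator in `𝒜` of a closed subgroup of `𝒜̂_n`. -/
def perp {n : ℕ} (K : ClosedAddSubgroup (Ahat n)) : AddSubgroup FreeAb where
  carrier := {x | ∀ y ∈ K, pairing x (y : Torus) = 0}
  zero_mem' := fun _ _ => pairing_zero_left _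
  add_mem' := fun {x x'} hx hx' y hy => by rw [pairing_add_left, hx y hy, hx' y hy, add_zero]
  neg_mem' := fun {x} hx y hy => by rw [pairing_neg_left, hx y hy, neg_zero]

lemma mem_perp {n : ℕ} {K : ClosedAddSubgroup (Ahat n)} {x : FreeAb} :
    x ∈ perp K ↔ ∀ y ∈ K, pairing x (y : Torus) = 0 := Iff.rfl

lemma nsmul_mem_perp {n : ℕ} (K : ClosedAddSubgroup (Ahat n)) (x : FreeAb) : n • x ∈ perp K :=
  fun y _ => y.2 _ ⟨x, rfl⟩

/-- A closed subgroup of `𝒜̂_n` is determined by its annihilator. -/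
lemma exists_mem_perp_pairing_ne_zero {n : ℕ} (K : ClosedAddSubgroup (Ahat n)) {y : Ahat n}
    (hy : y ∉ K) : ∃ x ∈ perp K, pairing x (y : Torus) ≠ 0 := by
  by_contra! hne
  let H : AddSubgroup (Ahat n) := K.toAddSubgroup
  have : CompactSpace H := isCompact_iff_compactSpace.mp K.isClosed'.isCompact
  borelize ↥H
  let ν : Measure H := Measure.addHaarMeasure ⊤
  have : IsProbabilityMeasure ν := ⟨Measure.addHaarMeasure_self⟩
  let g₀ : C(H, Ahat n) := ⟨fun k => k, continuous_subtype_val⟩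
  let g₁ : C(H, Ahat n) := ⟨fun k => y + k, by fun_prop⟩
  -- The Haar measures of K and of the coset y + K integrate every character alike: if x annihilates
  -- K, it also annihilates y by assumption; otherwise both integrals vanish.
  have hL : integralFunctional n ν g₀ 1 = integralFunctional n ν g₁ 1 := by
    refine functional_ext fun x => ?_
    rw [integralFunctional_apply, integralFunctional_apply]
    simp only [ContinuousMap.one_apply, mul_one, g₀, g₁, ContinuousMap.coe_mk, echar_apply,
      AddSubgroup.coe_add, pairing_add, AddCircle.toCircle_add, Circle.coe_mul,
      integral_const_mul]
    by_cases hx : x ∈ perp K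
    · simp [hne x hx]
    · let χ : H →+ UnitAddCircle :=
        { toFun := fun k => pairing x ((k : Ahat n) : Torus)
          map_zero' := pairing_zero x
          map_add' := fun k k' => pairing_add x _ _ }
      have hχ : χ ≠ 0 := by
        intro h
        exact hx fun k hk => DFunLike.congr_fun h ⟨k, hk⟩
      rw [show ∫ k : H, (AddCircle.toCircle (pairing x ((k : Ahat n) : Torus)) : ℂ) ∂ν = 0 from
        integral_toCircle_eq_zero ν χ hχ, mul_zero]
  -- As y ∉ K, the coset y + K is disjoint from K, and a Urysohn function tells the two measures
  -- apart.
  obtain ⟨f, hf0, hf1, -⟩ := exists_continuous_zero_one_of_isClosed (X := Ahat n) K.isClosed'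
    (K.isClosed'.preimage (continuous_sub_right y)) (by
      rw [Set.disjoint_left]
      intro z hz hz'
      apply hy
      have hz1 : z ∈ K := hz
      have hz2 : z - y ∈ K := hz'
      simpa using sub_mem hz1 hz2)
  let F : C(Ahat n, ℂ) := ⟨fun z => (f z : ℂ), by fun_prop⟩
  have := DFunLike.congr_fun hL F
  rw [integralFunctional_apply, integralFunctional_apply] at this
  have e0 : ∀ k : H, F (g₀ k) = 0 := fun k => by
    have : f k = 0 := hf0 k.2
    simp [F, g₀, this]
  have e1 : ∀ k : H, F (g₁ k) = 1 := fun k => by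
    have : f (y + k) = 1 := hf1 (by
      change (y + k) - y ∈ K
      simp)
    simp [F, g₁, this]
  simp [e0, e1] at this

end

noncomputable section

/-! ### The Borel sigma-algebra of the space of closed subgroups -/

/-- The event that `x` annihilates the random subgroup. -/
def annEvent (n : ℕ) (x : FreeAb) : Set (ClosedAddSubgroup (Ahat n)) := {K | x ∈ perp K}

lemma mem_annEvent {n : ℕ} {x : FreeAb} {K : ClosedAddSubgroup (Ahat n)} :
    K ∈ annEvent n x ↔ x ∈ perp K := Iff.rfl

lemma isOpen_meets {n : ℕ} {U : Set (Ahat n)} (hU : IsOpen U) :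
    IsOpen {H : ClosedAddSubgroup (Ahat n) | ((H : Set (Ahat n)) ∩ U).Nonempty} :=
  isOpen_generateFrom_of_mem (Or.inl ⟨U, hU, rfl⟩)

lemma isOpen_avoids {n : ℕ} {C : Set (Ahat n)} (hC : IsClosed C) :
    IsOpen {H : ClosedAddSubgroup (Ahat n) | Disjoint (H : Set (Ahat n)) C} :=
  isOpen_generateFrom_of_mem (Or.inr ⟨C, hC.isCompact, rfl⟩)

lemma continuous_pairing_Ahat (n : ℕ) (x : FreeAb) :
    Continuous fun y : Ahat n => pairing x (y : Torus) :=
  (continuous_pairing x).comp continuous_subtype_val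

@[measurability]
lemma measurableSet_annEvent (n : ℕ) (x : FreeAb) : MeasurableSet (annEvent n x) := by
  have h : annEvent n x = {H : ClosedAddSubgroup (Ahat n) |
      ((H : Set (Ahat n)) ∩ {y | pairing x (y : Torus) ≠ 0}).Nonempty}ᶜ := by
    ext H
    simp only [mem_annEvent, mem_perp, Set.mem_compl_iff, Set.mem_ofPred_eq,
      Set.not_nonempty_iff_eq_empty, Set.eq_empty_iff_forall_notMem, Set.mem_inter_iff, not_and,
      not_not]
    rfl
  rw [h]
  exact (isOpen_meets (isOpen_ne_fun (continuous_pairing_Ahat n x)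
    continuous_const)).measurableSet.compl

/-- By compactness, missing a closed set is witnessed by finitely many elements of the annihilator.
Since 𝒜 has only countably many finite subsets, this puts the Chabauty events into the sigma-algebra
generated by the `annEvent`s. -/
lemma disjoint_iff_exists_finset {n : ℕ} {C : Set (Ahat n)} (hC : IsClosed C)
    (H : ClosedAddSubgroup (Ahat n)) :
    Disjoint (H : Set (Ahat n)) C ↔ ∃ s : Finset FreeAb,
      (∀ y ∈ C, ∃ x ∈ s, pairing x (y : Torus) ≠ 0) ∧ ∀ x ∈ s, x ∈ perp H := by
  classical
  constructor
  · intro hd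
    obtain ⟨t, ht⟩ := hC.isCompact.elim_finite_subcover
      (fun x : perp H => {y : Ahat n | pairing (x : FreeAb) (y : Torus) ≠ 0})
      (fun x => isOpen_ne_fun (continuous_pairing_Ahat n x) continuous_const) (by
        intro y hy
        obtain ⟨x, hx, hxy⟩ := exists_mem_perp_pairing_ne_zero H (y := y)
          (fun h => Set.disjoint_left.mp hd h hy)
        exact Set.mem_iUnion.mpr ⟨⟨x, hx⟩, hxy⟩)
    refine ⟨t.image (↑), fun y hy => ?_, ?_⟩
    · obtain ⟨x, hx, hxy⟩ := Set.mem_iUnion₂.mp (ht hy)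
      exact ⟨x, Finset.mem_image_of_mem _ hx, hxy⟩
    · intro x hx
      obtain ⟨z, -, rfl⟩ := Finset.mem_image.mp hx
      exact z.2
  · rintro ⟨s, hs, hs'⟩
    rw [Set.disjoint_left]
    intro y hyH hyC
    obtain ⟨x, hx, hxy⟩ := hs y hyC
    exact hxy (hs' x hx y hyH)

lemma measurableSet_avoids {n : ℕ} {C : Set (Ahat n)} (hC : IsClosed C) :
    MeasurableSet[MeasurableSpace.generateFrom (Set.range (annEvent n))]
      {H : ClosedAddSubgroup (Ahat n) | Disjoint (H : Set (Ahat n)) C} := by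
  have h : {H : ClosedAddSubgroup (Ahat n) | Disjoint (H : Set (Ahat n)) C} =
      ⋃ s ∈ {s : Finset FreeAb | ∀ y ∈ C, ∃ x ∈ s, pairing x (y : Torus) ≠ 0},
        ⋂ x ∈ s, annEvent n x := by
    ext H
    simp only [Set.mem_ofPred_eq, disjoint_iff_exists_finset hC, Set.mem_iUnion, Set.mem_iInter,
      exists_prop, mem_annEvent]
  rw [h]
  refine MeasurableSet.biUnion (Set.to_countable _) fun s _ => ?_
  exact Finset.measurableSet_biInter s fun x _ =>
    MeasurableSpace.measurableSet_generateFrom ⟨x, rfl⟩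

instance secondCountable_unitAddCircle : SecondCountableTopology UnitAddCircle :=
  secondCountable_of_proper

instance secondCountable_Ahat (n : ℕ) : SecondCountableTopology (Ahat n) :=
  Topology.IsEmbedding.subtypeVal.secondCountableTopology

lemma measurableSet_meets {n : ℕ} {U : Set (Ahat n)} (hU : IsOpen U) :
    MeasurableSet[MeasurableSpace.generateFrom (Set.range (annEvent n))]
      {H : ClosedAddSubgroup (Ahat n) | ((H : Set (Ahat n)) ∩ U).Nonempty} := by
  have h : {H : ClosedAddSubgroup (Ahat n) | ((H : Set (Ahat n)) ∩ U).Nonempty} =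
      ⋃ V ∈ {V ∈ countableBasis (Ahat n) | closure V ⊆ U},
        {H : ClosedAddSubgroup (Ahat n) | Disjoint (H : Set (Ahat n)) (closure V)}ᶜ := by
    ext H
    simp only [Set.mem_ofPred_eq, Set.mem_iUnion, Set.mem_compl_iff, exists_prop,
      Set.not_disjoint_iff]
    constructor
    · rintro ⟨y, hyH, hyU⟩
      obtain ⟨V, hV, hyV, hVU⟩ := (isBasis_countableBasis (Ahat n)).exists_closure_subset
        (hU.mem_nhds hyU)
      exact ⟨V, ⟨hV, hVU⟩, y, hyH, subset_closure hyV⟩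
    · rintro ⟨V, ⟨-, hVU⟩, y, hyH, hyV⟩
      exact ⟨y, hyH, hVU hyV⟩
  rw [h]
  refine MeasurableSet.biUnion ((countable_countableBasis _).mono fun V hV => hV.1) fun V _ => ?_
  exact (measurableSet_avoids isClosed_closure).compl

/-- Second countability is what lets the Borel sigma-algebra be generated by the defining subbasis
of the topology. -/
instance secondCountable_chabauty (n : ℕ) :
    SecondCountableTopology (ClosedAddSubgroup (Ahat n)) := by
  let b := countableBasis (Ahat n)
  let t₁ : Set (Set (ClosedAddSubgroup (Ahat n))) :=
    (fun V => {H : ClosedAddSubgroup (Ahat n) | ((H : Set (Ahat n)) ∩ V).Nonempty}) '' b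
  let t₂ : Set (Set (ClosedAddSubgroup (Ahat n))) :=
    (fun V => {H : ClosedAddSubgroup (Ahat n) | Disjoint (H : Set (Ahat n)) (closure V)}) '' b
  have hb : b.Countable := countable_countableBasis _
  have hbasis : IsTopologicalBasis b := isBasis_countableBasis _
  refine ⟨t₁ ∪ t₂, (hb.image _).union (hb.image _), le_antisymm ?_ ?_⟩
  · refine le_generateFrom ?_
    rintro _ (⟨V, hV, rfl⟩ | ⟨V, hV, rfl⟩)
    · exact isOpen_meets (hbasis.isOpen hV)
    · exact isOpen_avoids isClosed_closure
  · refine le_generateFrom ?_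
    let τ := generateFrom (t₁ ∪ t₂)
    rintro _ (⟨U, hU, rfl⟩ | ⟨C, hC, rfl⟩)
    · have h : {H : ClosedAddSubgroup (Ahat n) | ((H : Set (Ahat n)) ∩ U).Nonempty} =
          ⋃ V ∈ {V ∈ b | V ⊆ U},
            {H : ClosedAddSubgroup (Ahat n) | ((H : Set (Ahat n)) ∩ V).Nonempty} := by
        ext H
        simp only [Set.mem_ofPred_eq, Set.mem_iUnion, exists_prop]
        constructor
        · rintro ⟨y, hyH, hyU⟩
          obtain ⟨V, hV, hyV, hVU⟩ := hbasis.exists_subset_of_mem_open hyU hU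
          exact ⟨V, ⟨hV, hVU⟩, y, hyH, hyV⟩
        · rintro ⟨V, ⟨-, hVU⟩, y, hyH, hyV⟩
          exact ⟨y, hyH, hVU hyV⟩
      rw [h]
      exact @isOpen_biUnion _ _ τ _ _ fun V hV =>
        isOpen_generateFrom_of_mem (Or.inl ⟨V, hV.1, rfl⟩)
    · have h : {H : ClosedAddSubgroup (Ahat n) | Disjoint (H : Set (Ahat n)) C} =
          ⋃ s ∈ {s : Set (Set (Ahat n)) | s ⊆ b ∧ s.Finite ∧ C ⊆ ⋃₀ s},
            ⋂ V ∈ s, {H : ClosedAddSubgroup (Ahat n) |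
              Disjoint (H : Set (Ahat n)) (closure V)} := by
        ext H
        simp only [Set.mem_ofPred_eq, Set.mem_iUnion, Set.mem_iInter, exists_prop]
        constructor
        · intro hd
          obtain ⟨s, hs, hsf, hCs⟩ := hC.elim_finite_subcover_image
            (b := {V ∈ b | Disjoint (H : Set (Ahat n)) (closure V)}) (c := id)
            (fun V hV => hbasis.isOpen hV.1) (by
              intro y hy
              have hyH : y ∉ (H : Set (Ahat n)) := fun h => Set.disjoint_left.mp hd h hy
              obtain ⟨V, hV, hyV, hVU⟩ := hbasis.exists_closure_subset
                (H.isClosed'.isOpen_compl.mem_nhds hyH)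
              exact Set.mem_biUnion (⟨hV, (Set.disjoint_left.mpr fun z hz hz' => hVU hz' hz)⟩ :
                V ∈ {V ∈ b | Disjoint (H : Set (Ahat n)) (closure V)}) hyV)
          refine ⟨s, ⟨fun V hV => (hs hV).1, hsf, ?_⟩, fun V hV => (hs hV).2⟩
          rwa [Set.sUnion_eq_biUnion]
        · rintro ⟨s, ⟨-, -, hCs⟩, hs⟩
          rw [Set.disjoint_left]
          intro y hyH hyC
          obtain ⟨V, hV, hyV⟩ := hCs hyC
          exact Set.disjoint_left.mp (hs V hV) hyH (subset_closure hyV)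
      rw [h]
      refine @isOpen_biUnion _ _ τ _ _ fun s hs => ?_
      exact @Set.Finite.isOpen_biInter _ _ τ _ _ hs.2.1 fun V hV =>
        isOpen_generateFrom_of_mem (Or.inr ⟨V, hs.1 hV, rfl⟩)

lemma chabautyMeasurableSpace_eq (n : ℕ) :
    chabautyMeasurableSpace (Ahat n) = MeasurableSpace.generateFrom (Set.range (annEvent n)) := by
  apply le_antisymm
  · rw [chabautyMeasurableSpace, borel_eq_generateFrom_of_subbasis (rfl :
      chabauty (Ahat n) = generateFrom _)]
    refine MeasurableSpace.generateFrom_le ?_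
    rintro _ (⟨U, hU, rfl⟩ | ⟨C, hC, rfl⟩)
    · exact measurableSet_meets hU
    · exact measurableSet_avoids hC.isClosed
  · refine MeasurableSpace.generateFrom_le ?_
    rintro _ ⟨x, rfl⟩
    exact measurableSet_annEvent n x

/-- The event that all elements of `B` annihilate the random subgroup. -/
def annEvents (n : ℕ) (B : Set FreeAb) : Set (ClosedAddSubgroup (Ahat n)) :=
  {K | ∀ x ∈ B, x ∈ perp K}

lemma mem_annEvents {n : ℕ} {B : Set FreeAb} {K : ClosedAddSubgroup (Ahat n)} :
    K ∈ annEvents n B ↔ ∀ x ∈ B, x ∈ perp K := Iff.rfl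

lemma annEvents_eq_iInter (n : ℕ) (B : Set FreeAb) :
    annEvents n B = ⋂ x ∈ B, annEvent n x := by
  ext K
  simp [mem_annEvents, mem_annEvent]

lemma measurableSet_annEvents (n : ℕ) (B : Set FreeAb) : MeasurableSet (annEvents n B) := by
  rw [annEvents_eq_iInter]
  exact MeasurableSet.biInter (Set.to_countable _) fun x _ => measurableSet_annEvent n x

/-- A random closed subgroup is determined by the probabilities that it is annihilated by
finite subsets of `𝒜`. -/
lemma measure_ext {n : ℕ} {μ ν : Measure (ClosedAddSubgroup (Ahat n))} [IsProbabilityMeasure μ]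
    [IsProbabilityMeasure ν] (h : ∀ B : Finset FreeAb, μ (annEvents n B) = ν (annEvents n B)) :
    μ = ν := by
  classical
  refine ext_of_generate_finite (Set.range fun B : Finset FreeAb => annEvents n (B : Set FreeAb))
    ?_ ?_ ?_ (by simp)
  · rw [chabautyMeasurableSpace_eq]
    apply le_antisymm
    · refine MeasurableSpace.generateFrom_le ?_
      rintro _ ⟨x, rfl⟩
      refine MeasurableSpace.measurableSet_generateFrom ⟨{x}, ?_⟩
      ext K
      simp [mem_annEvents, mem_annEvent]
    · refine MeasurableSpace.generateFrom_le ?_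
      rintro _ ⟨B, rfl⟩
      dsimp only
      rw [← chabautyMeasurableSpace_eq]
      exact measurableSet_annEvents n _
  · rintro _ ⟨B, rfl⟩ _ ⟨B', rfl⟩ -
    refine ⟨B ∪ B', ?_⟩
    ext K
    simp only [mem_annEvents, Set.mem_inter_iff, Finset.coe_union, Set.mem_union, or_imp,
      forall_and]
  · rintro _ ⟨B, rfl⟩
    exact h B

end

noncomputable section

/-! ### Automorphisms of `𝒜` and of `𝒜̂_n` -/

/-- The standard basis of `𝒜`. -/
abbrev e (i : ℕ) : FreeAb := Finsupp.single i 1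

lemma pairing_e (i : ℕ) (y : Torus) : pairing (e i) y = y i := by simp [pairing_single]

lemma torus_ext {y z : Torus} (h : ∀ x, pairing x y = pairing x z) : y = z := by
  funext i
  simpa [pairing_e] using h (e i)

/-- The dual of an endomorphism of `𝒜`. -/
def dualTorus (ψ : FreeAb →ₗ[ℤ] FreeAb) (y : Torus) : Torus := fun i => pairing (ψ (e i)) y

lemma pairing_dualTorus (ψ : FreeAb →ₗ[ℤ] FreeAb) (x : FreeAb) (y : Torus) :
    pairing x (dualTorus ψ y) = pairing (ψ x) y := by
  have h : pairingHom (dualTorus ψ y) = (pairingHom y).comp ψ.toAddMonoidHom := by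
    refine Finsupp.addHom_ext' fun i => AddMonoidHom.ext_int ?_
    simp [pairing_single, dualTorus]
  exact DFunLike.congr_fun h x

lemma dualTorus_mem_Ahat {n : ℕ} (ψ : FreeAb →ₗ[ℤ] FreeAb) {y : Torus} (hy : y ∈ Ahat n) :
    dualTorus ψ y ∈ Ahat n := by
  rintro _ ⟨x, rfl⟩
  rw [pairing_dualTorus]
  exact hy _ ⟨ψ x, by simp⟩

/-- The automorphism of `𝒜̂_n` dual to an automorphism of `𝒜`. -/
def dualAut (n : ℕ) (γ : FreeAb ≃ₗ[ℤ] FreeAb) : Ahat n ≃ₜ+ Ahat n where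
  toFun y := ⟨dualTorus γ.toLinearMap y, dualTorus_mem_Ahat _ y.2⟩
  invFun y := ⟨dualTorus γ.symm.toLinearMap y, dualTorus_mem_Ahat _ y.2⟩
  left_inv y := Subtype.ext <| torus_ext fun x => by simp [pairing_dualTorus]
  right_inv y := Subtype.ext <| torus_ext fun x => by simp [pairing_dualTorus]
  map_add' y z := Subtype.ext <| torus_ext fun x => by simp [pairing_dualTorus, pairing_add]
  continuous_toFun := Continuous.subtype_mk (continuous_pi fun _ => continuous_pairing_Ahat n _) _
  continuous_invFun := Continuous.subtype_mk (continuous_pi fun _ => continuous_pairing_Ahat n _) _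

lemma pairing_dualAut (n : ℕ) (γ : FreeAb ≃ₗ[ℤ] FreeAb) (x : FreeAb) (y : Ahat n) :
    pairing x (dualAut n γ y : Torus) = pairing (γ x) (y : Torus) :=
  pairing_dualTorus _ _ _

lemma mem_mapAut {G : Type*} [AddGroup G] [TopologicalSpace G] {φ : G ≃ₜ+ G}
    {H : ClosedAddSubgroup G} {y : G} : y ∈ mapAut φ H ↔ ∃ z ∈ H, φ z = y := Iff.rfl

lemma mem_perp_mapAut {n : ℕ} {φ : Ahat n ≃ₜ+ Ahat n} {x x' : FreeAb}
    (h : ∀ y : Ahat n, pairing x (φ y : Torus) = pairing x' (y : Torus))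
    (K : ClosedAddSubgroup (Ahat n)) : x ∈ perp (mapAut φ K) ↔ x' ∈ perp K := by
  simp only [mem_perp, mem_mapAut]
  constructor
  · intro hx y hy
    rw [← h]
    exact hx _ ⟨y, hy, rfl⟩
  · rintro hx _ ⟨z, hz, rfl⟩
    rw [h]
    exact hx z hz

lemma mem_perp_mapAut_dualAut {n : ℕ} (γ : FreeAb ≃ₗ[ℤ] FreeAb) (x : FreeAb)
    (K : ClosedAddSubgroup (Ahat n)) : x ∈ perp (mapAut (dualAut n γ) K) ↔ γ x ∈ perp K :=
  mem_perp_mapAut (pairing_dualAut n γ x) K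

/-- Test against points concentrated in one coordinate i: an element of order n there if n > 0, and
one of order |x i| + 1 if n = 0, which forces x i = 0. -/
lemma dvd_of_forall_pairing_eq_zero {n : ℕ} {x : FreeAb}
    (h : ∀ y : Ahat n, pairing x (y : Torus) = 0) : ∃ w : FreeAb, x = n • w := by
  have key : ∀ (i : ℕ) (t : UnitAddCircle), n • t = 0 → x i • t = 0 := by
    intro i t ht
    have hy : Pi.single i t ∈ Ahat n := by
      rw [mem_Ahat]
      intro j
      rcases eq_or_ne j i with rfl | hj
      · simpa using ht
      · simp [hj]
    have := h ⟨_, hy⟩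
    rw [pairing, Finsupp.sum, Finset.sum_eq_single i] at this
    · simpa using this
    · intro j _ hj
      simp [hj]
    · intro hi
      simp [Finsupp.notMem_support_iff.mp hi]
  have hord : ∀ N : ℕ, 0 < N → addOrderOf (((1 / N : ℝ)) : UnitAddCircle) = N := fun N hN =>
    AddCircle.addOrderOf_period_div hN
  have hdvd : ∀ i, (n : ℤ) ∣ x i := by
    intro i
    rcases Nat.eq_zero_or_pos n with rfl | hn
    · have h1 := key i (((1 / ((x i).natAbs + 1 : ℕ) : ℝ)) : UnitAddCircle) (by simp)
      rw [← addOrderOf_dvd_iff_zsmul_eq_zero, hord _ (Nat.succ_pos _)] at h1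
      have : x i = 0 := Int.eq_zero_of_dvd_of_natAbs_lt_natAbs h1 (by
        rw [Int.natAbs_natCast]
        exact Nat.lt_succ_self _)
      simp [this]
    · have h1 := key i (((1 / n : ℝ)) : UnitAddCircle) (by
        rw [← addOrderOf_dvd_iff_nsmul_eq_zero, hord n hn])
      rwa [← addOrderOf_dvd_iff_zsmul_eq_zero, hord n hn] at h1
  refine ⟨x.mapRange (fun k => k / n) (by simp), ?_⟩
  ext i
  simp [Int.mul_ediv_cancel' (hdvd i)]

/-! ### Finitary automorphisms -/

/-- An automorphism of `𝒜` is finitary if it fixes all but finitely many basis vectors. -/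
def Finitary (γ : FreeAb ≃ₗ[ℤ] FreeAb) : Prop := ∃ N, ∀ j, N ≤ j → γ (e j) = e j

lemma Finitary.trans {γ γ' : FreeAb ≃ₗ[ℤ] FreeAb} (h : Finitary γ) (h' : Finitary γ') :
    Finitary (γ.trans γ') := by
  obtain ⟨N, hN⟩ := h
  obtain ⟨N', hN'⟩ := h'
  refine ⟨max N N', fun j hj => ?_⟩
  rw [LinearEquiv.trans_apply, hN j (le_of_max_le_left hj), hN' j (le_of_max_le_right hj)]

/-- The automorphism of `𝒜` that maps the standard basis to the family `f`, given the preimages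
`g` of the standard basis. -/
def autOfFamilies (f g : ℕ → FreeAb) (hfg : ∀ i, Finsupp.linearCombination ℤ f (g i) = e i)
    (hgf : ∀ i, Finsupp.linearCombination ℤ g (f i) = e i) : FreeAb ≃ₗ[ℤ] FreeAb :=
  LinearEquiv.ofLinearMap (Finsupp.linearCombination ℤ f) (Finsupp.linearCombination ℤ g)
    (by
      refine Finsupp.lhom_ext' fun i => LinearMap.ext_ring ?_
      simpa using hfg i)
    (by
      refine Finsupp.lhom_ext' fun i => LinearMap.ext_ring ?_
      simpa using hgf i)

@[simp] lemma autOfFamilies_e (f g : ℕ → FreeAb)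
    (hfg : ∀ i, Finsupp.linearCombination ℤ f (g i) = e i)
    (hgf : ∀ i, Finsupp.linearCombination ℤ g (f i) = e i) (i : ℕ) :
    autOfFamilies f g hfg hgf (e i) = f i := by
  change Finsupp.linearCombination ℤ f (e i) = f i
  simp

/-- Permutation of the basis vectors. -/
def permAut (σ : Equiv.Perm ℕ) : FreeAb ≃ₗ[ℤ] FreeAb := Finsupp.domLCongr σ

@[simp] lemma permAut_e (σ : Equiv.Perm ℕ) (i : ℕ) : permAut σ (e i) = e (σ i) := by
  simp [permAut]

lemma finitary_permAut {σ : Equiv.Perm ℕ} (h : ∃ N, ∀ j, N ≤ j → σ j = j) :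
    Finitary (permAut σ) := by
  obtain ⟨N, hN⟩ := h
  exact ⟨N, fun j hj => by rw [permAut_e, hN j hj]⟩

lemma finitary_swap (a b : ℕ) : Finitary (permAut (Equiv.swap a b)) :=
  finitary_permAut ⟨max a b + 1, fun j hj => Equiv.swap_apply_of_ne_of_ne (by omega) (by omega)⟩

lemma linearCombination_eq_self {f : ℕ → FreeAb} {v : FreeAb} (h : ∀ i, v i ≠ 0 → f i = e i) :
    Finsupp.linearCombination ℤ f v = v := by
  rw [Finsupp.linearCombination_apply]
  conv_rhs => rw [← Finsupp.sum_single v]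
  refine Finsupp.sum_congr fun i hi => ?_
  rw [h i (Finsupp.mem_support_iff.mp hi)]
  simp

lemma aut_eq_self {γ : FreeAb ≃ₗ[ℤ] FreeAb} {v : FreeAb} (h : ∀ i, v i ≠ 0 → γ (e i) = e i) :
    γ v = v := by
  have h1 : γ v = Finsupp.linearCombination ℤ (fun i => γ (e i)) v := by
    conv_lhs => rw [← Finsupp.sum_single v, map_finsuppSum]
    rw [Finsupp.linearCombination_apply]
    refine Finsupp.sum_congr fun i _ => ?_
    rw [← map_smul]
    simp
  rw [h1]
  exact linearCombination_eq_self h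

/-- The transvection `e_k ↦ e_k + v`, where `v` has no component along `e_k`. -/
def transvection (k : ℕ) (v : FreeAb) (hv : v k = 0) : FreeAb ≃ₗ[ℤ] FreeAb :=
  autOfFamilies (fun i => if i = k then e k + v else e i) (fun i => if i = k then e k - v else e i)
    (by
      intro i
      by_cases hi : i = k
      · subst hi
        simp only [if_true, map_sub, Finsupp.linearCombination_single, one_smul]
        rw [linearCombination_eq_self]
        · abel
        · intro j hj
          rw [if_neg]
          rintro rfl
          exact hj hv
      · simp [hi])
    (by
      intro i
      by_cases hi : i = k
      · subst hi
        simp only [if_true, map_add, Finsupp.linearCombination_single, one_smul]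
        rw [linearCombination_eq_self]
        · abel
        · intro j hj
          rw [if_neg]
          rintro rfl
          exact hj hv
      · simp [hi])

lemma transvection_self (k : ℕ) (v : FreeAb) (hv : v k = 0) :
    transvection k v hv (e k) = e k + v := by
  simp [transvection]

lemma transvection_of_ne {k i : ℕ} (v : FreeAb) (hv : v k = 0) (hi : i ≠ k) :
    transvection k v hv (e i) = e i := by
  simp [transvection, hi]

lemma finitary_transvection (k : ℕ) (v : FreeAb) (hv : v k = 0) :
    Finitary (transvection k v hv) :=
  ⟨k + 1, fun _ hj => transvection_of_ne v hv (by omega)⟩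

/-! ### Automorphisms supported on part of the basis -/

section Extend

variable (s : Set ℕ)

/-- The inclusion of the span of a part of the basis. -/
def incl : (s →₀ ℤ) →ₗ[ℤ] FreeAb := Finsupp.lmapDomain ℤ ℤ Subtype.val

@[simp] lemma incl_single (i : s) (k : ℤ) :
    incl s (Finsupp.single i k) = Finsupp.single (i : ℕ) k := by
  simp [incl, Finsupp.mapDomain_single]

lemma exists_incl_eq {v : FreeAb} (hv : ∀ i, v i ≠ 0 → i ∈ s) : ∃ w, incl s w = v := by
  classical
  refine ⟨v.subtypeDomain (· ∈ s), ?_⟩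
  ext i
  by_cases hi : i ∈ s
  · have := Finsupp.mapDomain_apply Subtype.val_injective (v.subtypeDomain (· ∈ s)) (⟨i, hi⟩ : s)
    exact this
  · have h0 : v i = 0 := by
      by_contra h
      exact hi (hv i h)
    rw [h0]
    exact Finsupp.mapDomain_of_notMem_range _ _ (by simpa using hi)

open Classical in
/-- The values on the basis vectors of the extension by the identity of an endomorphism of the
span of a part of the basis. -/
def extendFamily (θ : (s →₀ ℤ) →ₗ[ℤ] (s →₀ ℤ)) (i : ℕ) : FreeAb :=
  if h : i ∈ s then incl s (θ (Finsupp.single ⟨i, h⟩ 1)) else e i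

lemma linearCombination_extendFamily_incl (θ : (s →₀ ℤ) →ₗ[ℤ] (s →₀ ℤ)) (v : s →₀ ℤ) :
    Finsupp.linearCombination ℤ (extendFamily s θ) (incl s v) = incl s (θ v) := by
  have : (Finsupp.linearCombination ℤ (extendFamily s θ)).comp (incl s) = (incl s).comp θ := by
    refine Finsupp.lhom_ext' fun i => LinearMap.ext_ring ?_
    simp [extendFamily]
  exact DFunLike.congr_fun this v

lemma linearCombination_extendFamily (θ θ' : (s →₀ ℤ) →ₗ[ℤ] (s →₀ ℤ)) (h : ∀ v, θ (θ' v) = v)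
    (i : ℕ) : Finsupp.linearCombination ℤ (extendFamily s θ) (extendFamily s θ' i) = e i := by
  by_cases hi : i ∈ s
  · have : extendFamily s θ' i = incl s (θ' (Finsupp.single ⟨i, hi⟩ 1)) := by
      simp [extendFamily, hi]
    rw [this, linearCombination_extendFamily_incl, h]
    simp
  · simp [extendFamily, hi]

/-- The extension by the identity of an automorphism of the span of a part of the basis. -/
def extendAut (θ : (s →₀ ℤ) ≃ₗ[ℤ] (s →₀ ℤ)) : FreeAb ≃ₗ[ℤ] FreeAb :=
  autOfFamilies (extendFamily s θ.toLinearMap) (extendFamily s θ.symm.toLinearMap)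
    (linearCombination_extendFamily s _ _ θ.apply_symm_apply)
    (linearCombination_extendFamily s _ _ θ.symm_apply_apply)

lemma extendAut_incl (θ : (s →₀ ℤ) ≃ₗ[ℤ] (s →₀ ℤ)) (v : s →₀ ℤ) :
    extendAut s θ (incl s v) = incl s (θ v) :=
  linearCombination_extendFamily_incl s θ.toLinearMap v

lemma extendAut_e {θ : (s →₀ ℤ) ≃ₗ[ℤ] (s →₀ ℤ)} {i : ℕ} (hi : i ∉ s) :
    extendAut s θ (e i) = e i := by
  simp [extendAut, extendFamily, hi]

lemma finitary_extendAut {s : Set ℕ} (hs : s.Finite) (θ : (s →₀ ℤ) ≃ₗ[ℤ] (s →₀ ℤ)) :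
    Finitary (extendAut s θ) := by
  obtain ⟨N, hN⟩ := hs.bddAbove
  exact ⟨N + 1, fun j hj => extendAut_e s fun h => by have := hN h; omega⟩

end Extend

/-- Smith normal form: up to a finitary automorphism, a finitely generated subgroup of `𝒜` is
spanned by multiples of distinct basis vectors. -/
lemma exists_smith (B : Finset FreeAb) : ∃ γ : FreeAb ≃ₗ[ℤ] FreeAb, Finitary γ ∧
    ∃ (k : ℕ) (f : Fin k ↪ ℕ) (a : Fin k → ℤ), ∀ P : AddSubgroup FreeAb,
      (∀ x ∈ B, x ∈ P) ↔ ∀ i, γ (a i • e (f i)) ∈ P := by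
  classical
  let s : Set ℕ := ↑(B.biUnion fun x => x.support)
  have hs : s.Finite := Finset.finite_toSet _
  have : Finite s := hs
  have hB : ∀ x ∈ B, ∃ w, incl s w = x := fun x hx => exists_incl_eq s fun i hi =>
    Finset.mem_coe.mpr (Finset.mem_biUnion (s := B) (t := fun x : FreeAb => x.support)
      |>.mpr ⟨x, hx, Finsupp.mem_support_iff.mpr hi⟩)
  -- Only the finitely many basis vectors occurring in `B` matter. The adapted basis of their span
  -- is turned into an automorphism and extended by the identity.
  let N : Submodule ℤ (s →₀ ℤ) := (Submodule.span ℤ (B : Set FreeAb)).comap (incl s)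
  obtain ⟨k, snf⟩ := Submodule.smithNormalForm (Finsupp.basisSingleOne (ι := s) (R := ℤ)) N
  refine ⟨extendAut s snf.bM.repr.symm, finitary_extendAut hs _, k,
    snf.f.trans (Function.Embedding.subtype _), snf.a, fun P => ?_⟩
  have hval : ∀ i, extendAut s snf.bM.repr.symm (snf.a i •
      e ((snf.f.trans (Function.Embedding.subtype _)) i)) = incl s (snf.bN i : s →₀ ℤ) := by
    intro i
    have h1 : (e ((snf.f.trans (Function.Embedding.subtype _)) i) : FreeAb) =
      incl s (Finsupp.single (snf.f i) 1) := by simp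
    rw [h1, map_smul, extendAut_incl, Module.Basis.repr_symm_single_one, ← map_smul, snf.snf]
  simp only [hval]
  constructor
  · intro h i
    have h1 : Submodule.span ℤ (B : Set FreeAb) ≤ AddSubgroup.toIntSubmodule P :=
      Submodule.span_le.mpr h
    exact h1 (snf.bN i).2
  · intro h x hx
    obtain ⟨w, rfl⟩ := hB x hx
    have hw : w ∈ N := Submodule.subset_span hx
    have h1 : w = ∑ i, snf.bN.repr ⟨w, hw⟩ i • (snf.bN i : s →₀ ℤ) := by
      have := congrArg (Subtype.val) (snf.bN.sum_repr ⟨w, hw⟩)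
      rw [AddSubmonoidClass.coe_finsetSum] at this
      exact this.symm
    rw [h1, map_sum]
    refine sum_mem fun i _ => ?_
    rw [map_smul]
    exact zsmul_mem (h i) _

/-- A primitive vector can be moved to a basis vector. -/
lemma exists_aut_of_primitive {s : Set ℕ} (hs : s.Finite) {k : ℕ} (hk : k ∈ s) {v : FreeAb}
    (hv : ∀ i, v i ≠ 0 → i ∈ s) (hprim : ∀ p : ℕ, p.Prime → ∃ i, ¬ (p : ℤ) ∣ v i) :
    ∃ γ : FreeAb ≃ₗ[ℤ] FreeAb, Finitary γ ∧ (∀ i, i ∉ s → γ (e i) = e i) ∧ γ v = e k := by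
  classical
  have : Finite s := hs
  obtain ⟨w, rfl⟩ := exists_incl_eq s hv
  have hw : w ≠ 0 := by
    rintro rfl
    obtain ⟨i, hi⟩ := hprim 2 Nat.prime_two
    simp at hi
  -- Applied to the line ℤw, Smith normal form gives w = c b_j with b_j in a basis, and primitivity
  -- makes c a unit.
  obtain ⟨r, snf⟩ := Submodule.smithNormalForm (Finsupp.basisSingleOne (ι := s) (R := ℤ))
    (Submodule.span ℤ {w})
  have hr : r = 1 := by
    have h1 := Module.finrank_eq_card_basis snf.bN
    have h2 := (LinearEquiv.toSpanNonzeroSingleton ℤ (s →₀ ℤ) w hw).finrank_eq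
    rw [← h2] at h1
    simpa using h1.symm
  subst hr
  have hmem : w ∈ Submodule.span ℤ {w} := Submodule.mem_span_singleton_self w
  obtain ⟨c, j, hcj⟩ : ∃ (c : ℤ) (j : s), w = c • snf.bM j := by
    have := congrArg Subtype.val (snf.bN.sum_repr ⟨w, hmem⟩)
    refine ⟨snf.bN.repr ⟨w, hmem⟩ 0 * snf.a 0, snf.f 0, ?_⟩
    simpa [snf.snf, mul_smul] using this.symm
  have hc : IsUnit c := by
    rw [Int.isUnit_iff_natAbs_eq]
    by_contra hc
    obtain ⟨p, hp, hpc⟩ := Nat.exists_prime_and_dvd hc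
    obtain ⟨i, hi⟩ := hprim p hp
    apply hi
    rw [hcj, map_smul]
    exact Dvd.dvd.mul_right (Int.natCast_dvd.mpr hpc) _
  -- The unit c is absorbed into the basis and the index j is exchanged with k.
  let b : Module.Basis s ℤ (s →₀ ℤ) := (snf.bM.isUnitSMul (w := fun _ => c) fun _ => hc).reindex
    (Equiv.swap j ⟨k, hk⟩)
  have hb : b ⟨k, hk⟩ = w := by
    simp [b, Module.Basis.isUnitSMul_apply, hcj]
  refine ⟨extendAut s b.repr, finitary_extendAut hs _, fun i hi => extendAut_e s hi, ?_⟩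
  rw [extendAut_incl, ← hb, Module.Basis.repr_self, incl_single]

/-- An automorphism of `𝒜 / n𝒜` agrees on finitely many basis vectors with the reduction of a
finitary automorphism of `𝒜`. -/
lemma exists_finitary_approx {n : ℕ} {ψ ψ' : FreeAb →ₗ[ℤ] FreeAb}
    (h : ∀ x, ∃ w, ψ' (ψ x) - x = n • w) (k : ℕ) :
    ∃ γ : FreeAb ≃ₗ[ℤ] FreeAb, Finitary γ ∧ ∀ i < k, ∃ w, γ (ψ (e i)) - e i = n • w := by
  classical
  induction k with
  | zero => exact ⟨LinearEquiv.refl ℤ _, ⟨0, fun _ _ => rfl⟩, by simp⟩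
  | succ k ih =>
    obtain ⟨γ, hγ, hγψ⟩ := ih
    set u := γ (ψ (e k)) with hu
    obtain ⟨M, hkM, hM⟩ : ∃ M, k < M ∧ ∀ i, M ≤ i → u i = 0 := by
      refine ⟨max (k + 1) (u.support.sup id + 1), by omega, fun i hi => ?_⟩
      by_contra h0
      have := Finset.le_sup (f := id) (Finsupp.mem_support_iff.mpr h0)
      simp only [id] at this
      omega
    let a : FreeAb := u.filter (· < k)
    let b : FreeAb := u.filter fun i => ¬ i < k
    have hab : a + b = u := Finsupp.filter_add_filter_not u _
    -- The part `b` of u beyond the first k coordinates need not be primitive. Adding n times the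
    -- fresh vector e_M does not change it modulo n and makes it primitive, so it can be moved to
    -- e_k without touching e_0, …, e_{k-1}; a transvection then removes `a`.
    let v : FreeAb := b + n • e M
    have ha : ∀ i, a i ≠ 0 → i < k := by
      intro i hi
      by_contra hik
      exact hi (by simp [a, hik])
    have hv : ∀ i, v i ≠ 0 → i ∈ Set.Icc k M := by
      intro i hi
      by_contra hik
      apply hi
      rw [Set.mem_Icc, not_and_or] at hik
      rcases hik with hik | hik
      · have : M ≠ i := by omega
        simp [v, b, not_le.mp hik, this]
      · have h1 : M ≠ i := by omega
        have h2 : u i = 0 := hM i (by omega)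
        simp [v, b, h1, h2, Finsupp.filter_apply]
    have hprim : ∀ p : ℕ, p.Prime → ∃ i, ¬ (p : ℤ) ∣ v i := by
      intro p hp
      by_contra! hdvd
      have hpn : (p : ℤ) ∣ n := by
        have := hdvd M
        simpa [v, b, Finsupp.filter_apply, hM M le_rfl] using this
      have hpb : ∀ i, (p : ℤ) ∣ b i := by
        intro i
        have h1 := hdvd i
        have h2 : v i = b i + n * (e M) i := by
          simp [v, Finsupp.single_apply]
        rw [h2] at h1
        exact (Int.dvd_add_left (hpn.mul_right _)).mp h1
      have : Fact p.Prime := ⟨hp⟩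
      -- The k-th coordinate of ψ'γ⁻¹ modulo p. It kills n𝒜 and e_i for i < k, hence `a`, and it
      -- kills `b` because p divides it; yet its value at u = a + b is 1.
      let φ : FreeAb →+ ZMod p := (Int.castAddHom (ZMod p)).comp
        ((Finsupp.applyAddHom k).comp (ψ'.comp γ.symm.toLinearMap).toAddMonoidHom)
      have hφ : ∀ x, φ x = ((ψ' (γ.symm x)) k : ZMod p) := fun _ => rfl
      have hn0 : ((n : ℤ) : ZMod p) = 0 := (ZMod.intCast_zmod_eq_zero_iff_dvd _ _).mpr hpn
      have hφn : ∀ w, φ (n • w) = 0 := fun w => by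
        rw [map_nsmul, nsmul_eq_mul]
        rw [show ((n : ℕ) : ZMod p) = ((n : ℤ) : ZMod p) by simp, hn0, zero_mul]
      have hφψ : ∀ i, φ (γ (ψ (e i))) = if i = k then 1 else 0 := by
        intro i
        rw [hφ, LinearEquiv.symm_apply_apply]
        obtain ⟨w, hw⟩ := h (e i)
        rw [sub_eq_iff_eq_add.mp hw]
        simp only [Finsupp.add_apply, Int.cast_add, Finsupp.smul_apply, nsmul_eq_mul, Int.cast_mul,
          Finsupp.single_apply]
        simp only [Int.cast_natCast] at hn0 ⊢
        rw [hn0, zero_mul, zero_add]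
        split_ifs <;> simp
      have hφa : φ a = 0 := by
        rw [← Finsupp.sum_single a, map_finsuppSum]
        refine Finset.sum_eq_zero fun i hi => ?_
        have hik := ha i (Finsupp.mem_support_iff.mp hi)
        have h1 : φ (e i) = 0 := by
          obtain ⟨w, hw⟩ := hγψ i hik
          have h2 : e i = γ (ψ (e i)) - n • w := by rw [← hw]; abel
          rw [h2, map_sub, hφψ, hφn, if_neg (by omega), sub_zero]
        have h3 : Finsupp.single i (a i) = a i • e i := by simp
        change φ (Finsupp.single i (a i)) = 0
        rw [h3, map_zsmul, h1, smul_zero]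
      have hφb : φ b = 0 := by
        rw [← Finsupp.sum_single b, map_finsuppSum]
        refine Finset.sum_eq_zero fun i hi => ?_
        have h3 : Finsupp.single i (b i) = b i • e i := by simp
        change φ (Finsupp.single i (b i)) = 0
        rw [h3, map_zsmul, zsmul_eq_mul, (ZMod.intCast_zmod_eq_zero_iff_dvd _ _).mpr (hpb i),
          zero_mul]
      have h1 := hφψ k
      rw [if_pos rfl, ← hu, ← hab, map_add, hφa, hφb, add_zero] at h1
      exact zero_ne_one h1
    obtain ⟨γ₂, hγ₂, hγ₂s, hγ₂v⟩ := exists_aut_of_primitive (Set.finite_Icc k M)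
      (Set.left_mem_Icc.mpr hkM.le) hv hprim
    have hak : (-a) k = 0 := by
      by_contra h0
      exact absurd (ha k (by simpa using h0)) (lt_irrefl k)
    let γ₃ := transvection k (-a) hak
    have hfix₂ : ∀ i < k, γ₂ (e i) = e i := fun i hi => hγ₂s i (by simp [hi])
    have hfix₃ : ∀ i < k, γ₃ (e i) = e i := fun i hi => transvection_of_ne _ _ hi.ne
    refine ⟨(γ.trans γ₂).trans γ₃, (hγ.trans hγ₂).trans (finitary_transvection _ _ _),
      fun i hi => ?_⟩
    simp only [LinearEquiv.trans_apply]
    rcases Nat.lt_succ_iff_lt_or_eq.mp hi with hik | rfl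
    · obtain ⟨w, hw⟩ := hγψ i hik
      refine ⟨γ₃ (γ₂ w), ?_⟩
      rw [sub_eq_iff_eq_add.mp hw, map_add, map_add, map_nsmul, map_nsmul, hfix₂ i hik,
        hfix₃ i hik, add_sub_cancel_right]
    · refine ⟨-γ₃ (γ₂ (e M)), ?_⟩
      have h1 : u = a + v - n • e M := by simp only [v]; rw [← hab]; abel
      have h2 : γ₂ a = a := aut_eq_self fun j hj => hfix₂ j (ha j hj)
      have h3 : γ₃ a = a := aut_eq_self fun j hj => hfix₃ j (ha j hj)
      rw [← hu, h1, map_sub, map_add, hγ₂v, h2, map_sub, map_add, h3, map_nsmul, map_nsmul,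
        transvection_self, smul_neg]
      abel

/-! ### Invariance -/

/-- Invariance under the automorphisms of `𝒜̂_n` that are dual to finitary automorphisms of `𝒜`. -/
def FinInv {n : ℕ} (μ : Measure (ClosedAddSubgroup (Ahat n))) : Prop :=
  ∀ γ, Finitary γ → μ.map (mapAut (dualAut n γ)) = μ

lemma measurable_mapAut {n : ℕ} (φ : Ahat n ≃ₜ+ Ahat n) : Measurable (mapAut φ) :=
  (continuous_mapAut φ).borel_measurable

lemma FinInv.measure_preimage {n : ℕ} {μ : Measure (ClosedAddSubgroup (Ahat n))} (hμ : FinInv μ)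
    {γ : FreeAb ≃ₗ[ℤ] FreeAb} (hγ : Finitary γ) {S : Set (ClosedAddSubgroup (Ahat n))}
    (hS : MeasurableSet S) : μ (mapAut (dualAut n γ) ⁻¹' S) = μ S := by
  conv_rhs => rw [← hμ γ hγ]
  rw [Measure.map_apply (measurable_mapAut _) hS]

lemma FinInv.measure_annEvents {n : ℕ} {μ : Measure (ClosedAddSubgroup (Ahat n))} (hμ : FinInv μ)
    {γ : FreeAb ≃ₗ[ℤ] FreeAb} (hγ : Finitary γ) (B : Set FreeAb) :
    μ (annEvents n (γ '' B)) = μ (annEvents n B) := by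
  rw [← hμ.measure_preimage hγ (measurableSet_annEvents n B)]
  congr 1
  ext K
  simp [mem_annEvents, mem_perp_mapAut_dualAut]

lemma finInv_of_mem_CRS {n : ℕ} {μ : Measure (ClosedAddSubgroup (Ahat n))}
    (hμ : μ ∈ CRS (Ahat n)) : FinInv μ := fun γ _ => hμ.2 (dualAut n γ)

/-- Each coordinate of φ is a continuous character, hence a pairing with an element of 𝒜. -/
lemma exists_dual_endomorphism {n : ℕ} (φ : Ahat n ≃ₜ+ Ahat n) : ∃ ψ : FreeAb →ₗ[ℤ] FreeAb,
    ∀ (x : FreeAb) (y : Ahat n), pairing x (φ y : Torus) = pairing (ψ x) (y : Torus) := by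
  have h : ∀ i, ∃ x : FreeAb, ∀ y : Ahat n, (φ y : Torus) i = pairing x (y : Torus) := by
    intro i
    exact exists_eq_pairing (n := n)
      { toFun := fun y => (φ y : Torus) i
        map_zero' := by simp
        map_add' := fun y z => by simp
        continuous_toFun := (continuous_apply i).comp (continuous_subtype_val.comp φ.continuous) }
  choose f hf using h
  refine ⟨Finsupp.linearCombination ℤ f, fun x y => ?_⟩
  have h : pairingHom (φ y : Torus) =
      (pairingHom (y : Torus)).comp (Finsupp.linearCombination ℤ f).toAddMonoidHom := by
    refine Finsupp.addHom_ext' fun i => AddMonoidHom.ext_int ?_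
    simp [pairing_single, hf]
  exact DFunLike.congr_fun h x

/-- An automorphism of `𝒜̂_n` is dual to an endomorphism ψ of 𝒜 invertible only modulo n𝒜. Since n𝒜
lies in every `perp K`, it is enough that a finitary automorphism undoes ψ modulo n𝒜 on the basis
vectors occurring in `B`. -/
lemma FinInv.mem_CRS {n : ℕ} {μ : Measure (ClosedAddSubgroup (Ahat n))}
    [hp : IsProbabilityMeasure μ] (hμ : FinInv μ) : μ ∈ CRS (Ahat n) := by
  classical
  refine ⟨hp, fun φ => ?_⟩
  have : IsProbabilityMeasure (μ.map (mapAut φ)) :=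
    Measure.isProbabilityMeasure_map (measurable_mapAut φ).aemeasurable
  obtain ⟨ψ, hψ⟩ := exists_dual_endomorphism φ
  obtain ⟨ψ', hψ'⟩ := exists_dual_endomorphism φ.symm
  have hinv : ∀ x, ∃ w, ψ' (ψ x) - x = n • w := fun x =>
    dvd_of_forall_pairing_eq_zero fun y => by
      rw [pairing_sub_left, ← hψ', ← hψ, ContinuousAddEquiv.apply_symm_apply, sub_self]
  refine measure_ext fun B => ?_
  rw [Measure.map_apply (measurable_mapAut φ) (measurableSet_annEvents n _)]
  obtain ⟨k, hk⟩ : ∃ k, ∀ x ∈ B, ∀ i, x i ≠ 0 → i < k := by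
    refine ⟨(B.biUnion fun x => x.support).sup id + 1, fun x hx i hi => ?_⟩
    have := Finset.le_sup (f := id) (Finset.mem_biUnion (s := B) (t := fun x : FreeAb => x.support)
      |>.mpr ⟨x, hx, Finsupp.mem_support_iff.mpr hi⟩)
    simp only [id] at this
    omega
  obtain ⟨γ, hγ, hγψ⟩ := exists_finitary_approx hinv k
  have hB : ∀ x ∈ B, ∀ K : ClosedAddSubgroup (Ahat n), γ (ψ x) ∈ perp K ↔ x ∈ perp K := by
    intro x hx K
    have h1 : γ (ψ x) - x ∈ perp K := by
      have h2 : γ (ψ x) - x = x.sum fun i c => c • (γ (ψ (e i)) - e i) := by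
        simp only [smul_sub, Finsupp.sum_sub, ← map_smul]
        conv_lhs => rw [← Finsupp.sum_single x, map_finsuppSum, map_finsuppSum]
        simp
      rw [h2]
      refine sum_mem fun i hi => zsmul_mem ?_ _
      obtain ⟨w, hw⟩ := hγψ i (hk x hx i (Finsupp.mem_support_iff.mp hi))
      rw [hw]
      exact nsmul_mem_perp K w
    constructor
    · intro h
      simpa using sub_mem h h1
    · intro h
      simpa using add_mem h1 h
  have h1 : mapAut φ ⁻¹' annEvents n (B : Set FreeAb) = annEvents n (ψ '' B) := by
    ext K
    simp only [Set.mem_preimage, mem_annEvents, Set.forall_mem_image]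
    exact forall₂_congr fun x _ => mem_perp_mapAut (hψ x) K
  rw [h1, ← hμ.measure_annEvents hγ]
  congr 1
  ext K
  simp only [mem_annEvents, Set.forall_mem_image]
  exact forall₂_congr fun x hx => hB x hx K

/-- A finitarily invariant random closed subgroup is determined by the probabilities that it is
annihilated by multiples of distinct basis vectors. -/
lemma FinInv.ext {n : ℕ} {μ ν : Measure (ClosedAddSubgroup (Ahat n))} [IsProbabilityMeasure μ]
    [IsProbabilityMeasure ν] (hμ : FinInv μ) (hν : FinInv ν)
    (h : ∀ (s : Finset ℕ) (d : ℕ → ℕ), μ (annEvents n ((fun i => d i • e i) '' s)) =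
      ν (annEvents n ((fun i => d i • e i) '' s))) : μ = ν := by
  classical
  refine measure_ext fun B => ?_
  obtain ⟨γ, hγ, k, f, a, hB⟩ := exists_smith B
  -- The value 0 off the range of `f` plays no role, and signs do not affect membership in a
  -- subgroup.
  let d : ℕ → ℕ := fun j => if h : ∃ i, f i = j then (a h.choose).natAbs else 0
  have hd : ∀ i, d (f i) = (a i).natAbs := by
    intro i
    have hex : ∃ i', f i' = f i := ⟨i, rfl⟩
    simp only [d, dif_pos hex]
    rw [f.injective hex.choose_spec]
  have key : annEvents n (B : Set FreeAb) =
      annEvents n (γ '' ((fun i => d i • e i) '' (Finset.univ.map f : Finset ℕ))) := by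
    ext K
    simp only [mem_annEvents, Finset.mem_coe, Set.forall_mem_image, Finset.mem_map,
      Finset.mem_univ, true_and, forall_exists_index, forall_apply_eq_imp_iff]
    rw [hB]
    refine forall_congr' fun i => ?_
    rw [hd, ← natCast_zsmul, map_smul, map_smul]
    rcases Int.natAbs_eq (a i) with h | h
    · rw [← h]
    · conv_lhs => rw [h]
      rw [neg_smul, neg_mem_iff]
  rw [key, hμ.measure_annEvents hγ, hν.measure_annEvents hγ, h]

end

noncomputable section

/-! ### Extremality and independence -/

/-- The ultrafilter limit of the restrictions of a finite measure to a sequence of sets is a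
measure. -/
lemma exists_measure_tendsto {Ω : Type*} [MeasurableSpace Ω] (μ : Measure Ω) [IsFiniteMeasure μ]
    (E : ℕ → Set Ω) (U : Ultrafilter ℕ) : ∃ ν : Measure Ω, IsFiniteMeasure ν ∧
      ∀ S, MeasurableSet S → Filter.Tendsto (fun j => μ.real (S ∩ E j)) U (nhds (ν.real S)) := by
  have h : ∀ S, ∃ l, 0 ≤ l ∧ l ≤ μ.real S ∧
      Filter.Tendsto (fun j => μ.real (S ∩ E j)) U (nhds l) := by
    intro S
    obtain ⟨l, hl, hl'⟩ := (isCompact_Icc (a := (0 : ℝ)) (b := μ.real S)).ultrafilter_le_nhds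
      (U.map fun j => μ.real (S ∩ E j)) (by
        simp only [Ultrafilter.coe_map, Filter.le_principal_iff, Filter.mem_map]
        exact Filter.univ_mem' fun j =>
          ⟨measureReal_nonneg, measureReal_mono Set.inter_subset_left⟩)
    exact ⟨l, hl.1, hl.2, hl'⟩
  choose L hL0 hL1 hL using h
  have hunion : ∀ f : ℕ → Set Ω, (∀ i, MeasurableSet (f i)) → Pairwise (Function.onFun Disjoint f) →
      ENNReal.ofReal (L (⋃ i, f i)) = ∑' i, ENNReal.ofReal (L (f i)) := by
    intro f hf hd
    have hsum : Summable fun i => μ.real (f i) := by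
      apply ENNReal.summable_toReal
      rw [← measure_iUnion hd hf]
      exact measure_ne_top _ _
    have hsumL : Summable fun i => L (f i) := hsum.of_nonneg_of_le (fun i => hL0 _) fun i => hL1 _
    rw [← ENNReal.ofReal_tsum_of_nonneg (fun i => hL0 _) hsumL]
    congr 1
    refine tendsto_nhds_unique (hL (⋃ i, f i)) ?_
    have hn : ∀ j, μ.restrict (E j) (⋃ i, f i) = ∑' i, μ.restrict (E j) (f i) := fun j =>
      measure_iUnion hd hf
    have heq : ∀ j, μ.real ((⋃ i, f i) ∩ E j) = ∑' i, μ.real (f i ∩ E j) := by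
      intro j
      simp only [measureReal_def]
      rw [← ENNReal.tsum_toReal_eq fun i => measure_ne_top _ _]
      have := hn j
      rw [Measure.restrict_apply (MeasurableSet.iUnion hf)] at this
      rw [this]
      congr 1
      exact tsum_congr fun i => Measure.restrict_apply (hf i)
    simp only [heq]
    -- Countable additivity survives the limit because μ(f i ∩ E j) ≤ μ(f i), a summable bound
    -- uniform in j.
    refine tendsto_tsum_of_dominated_convergence hsum (fun i => hL (f i)) ?_
    refine Filter.Eventually.of_forall fun j i => ?_
    rw [Real.norm_of_nonneg measureReal_nonneg]
    exact measureReal_mono Set.inter_subset_left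
  have hempty : ENNReal.ofReal (L ∅) = 0 := by
    rw [ENNReal.ofReal_eq_zero]
    simpa using hL1 ∅
  let ν : Measure Ω := Measure.ofMeasurable (fun S _ => ENNReal.ofReal (L S)) hempty
    fun f hf hd => hunion f hf hd
  have hν : ∀ S, MeasurableSet S → ν S = ENNReal.ofReal (L S) := fun S hS =>
    Measure.ofMeasurable_apply S hS
  refine ⟨ν, ⟨?_⟩, fun S hS => ?_⟩
  · rw [hν _ MeasurableSet.univ]
    exact ENNReal.ofReal_lt_top
  · rw [measureReal_def, hν S hS, ENNReal.toReal_ofReal (hL0 S)]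
    exact hL S

variable {n : ℕ}

lemma measure_eq_of_measureReal {Ω : Type*} [MeasurableSpace Ω] {μ ν : Measure Ω}
    [IsFiniteMeasure μ] [IsFiniteMeasure ν] (h : ∀ S, MeasurableSet S → μ.real S = ν.real S) :
    μ = ν :=
  Measure.ext fun S hS => (measureReal_eq_measureReal_iff).mp (h S hS)

lemma FinInv.smul {μ : Measure (ClosedAddSubgroup (Ahat n))} (hμ : FinInv μ) (c : ENNReal) :
    FinInv (c • μ) := fun γ hγ => by rw [Measure.map_smul, hμ γ hγ]

/-- A finitarily invariant part of an indecomposable characteristic random subgroup is a multiple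
of it. -/
lemma measureReal_eq_mul_of_mem_CRSe {μ ν ν' : Measure (ClosedAddSubgroup (Ahat n))}
    (hμ : μ ∈ CRSe (Ahat n)) [IsFiniteMeasure ν] [IsFiniteMeasure ν'] (hν : FinInv ν)
    (hν' : FinInv ν') (hsum : ν + ν' = μ) (S : Set (ClosedAddSubgroup (Ahat n))) :
    ν.real S = ν.real Set.univ * μ.real S := by
  have hp : IsProbabilityMeasure μ := hμ.1.1
  set c := ν.real Set.univ with hc
  set c' := ν'.real Set.univ with hc'
  have hadd : ∀ S, ν.real S + ν'.real S = μ.real S := fun S => by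
    rw [← hsum, measureReal_add_apply]
  have hcc : c + c' = 1 := by rw [hadd]; simp
  have hc0 : 0 ≤ c := measureReal_nonneg
  have hc0' : 0 ≤ c' := measureReal_nonneg
  have hle : ν.real S ≤ c := measureReal_mono (Set.subset_univ _)
  have hle' : ν'.real S ≤ c' := measureReal_mono (Set.subset_univ _)
  have h0 : 0 ≤ ν.real S := measureReal_nonneg
  have h0' : 0 ≤ ν'.real S := measureReal_nonneg
  rcases hc0.eq_or_lt with hcz | hcpos
  · rw [← hcz] at hle ⊢
    linarith
  rcases hc0'.eq_or_lt with hcz' | hcpos'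
  · have := hadd S
    rw [show c = 1 by linarith]
    linarith
  have hprob : ∀ (ρ : Measure (ClosedAddSubgroup (Ahat n))) [IsFiniteMeasure ρ],
      0 < ρ.real Set.univ → IsProbabilityMeasure (ENNReal.ofReal (ρ.real Set.univ)⁻¹ • ρ) := by
    intro ρ _ hρ
    refine ⟨?_⟩
    rw [Measure.smul_apply, smul_eq_mul, ← ofReal_measureReal, ← ENNReal.ofReal_mul (by positivity),
      inv_mul_cancel₀ hρ.ne', ENNReal.ofReal_one]
  have hp1 := hprob ν hcpos
  have hp2 := hprob ν' hcpos'
  -- With both masses positive, the normalized parts form a convex decomposition of μ, so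
  -- indecomposability makes them equal.
  have heq : ENNReal.ofReal c⁻¹ • ν = ENNReal.ofReal c'⁻¹ • ν' := by
    by_contra hne
    refine hμ.2 ⟨_, (hν.smul _).mem_CRS, _, (hν'.smul _).mem_CRS, c, ⟨hcpos, by linarith⟩, hne, ?_⟩
    rw [show 1 - c = c' by linarith, smul_smul, smul_smul, ← ENNReal.ofReal_mul hc0,
      ← ENNReal.ofReal_mul hc0', mul_inv_cancel₀ hcpos.ne', mul_inv_cancel₀ hcpos'.ne',
      ENNReal.ofReal_one, one_smul, one_smul, hsum]
  have h1 := congrArg (fun ρ : Measure (ClosedAddSubgroup (Ahat n)) => ρ.real S) heq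
  simp only [measureReal_ennreal_smul_apply, ENNReal.toReal_ofReal (inv_nonneg.mpr hc0),
    ENNReal.toReal_ofReal (inv_nonneg.mpr hc0')] at h1
  rw [inv_mul_eq_div, inv_mul_eq_div, div_eq_div_iff hcpos.ne' hcpos'.ne'] at h1
  rw [← hadd]
  linear_combination h1 - ν.real S * hcc

/-- The event `S` is measurable and only concerns the elements of `𝒜` supported below `N`. -/
def Below (N : ℕ) (S : Set (ClosedAddSubgroup (Ahat n))) : Prop :=
  MeasurableSet S ∧ ∀ γ : FreeAb ≃ₗ[ℤ] FreeAb, (∀ i < N, γ (e i) = e i) →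
    mapAut (dualAut n γ) ⁻¹' S = S

lemma preimage_annEvent (γ : FreeAb ≃ₗ[ℤ] FreeAb) (x : FreeAb) :
    mapAut (dualAut n γ) ⁻¹' annEvent n x = annEvent n (γ x) :=
  Set.ext fun K => mem_perp_mapAut_dualAut γ x K

lemma Below.univ (N : ℕ) : Below N (Set.univ : Set (ClosedAddSubgroup (Ahat n))) :=
  ⟨MeasurableSet.univ, fun _ _ => rfl⟩

lemma Below.mono {N N' : ℕ} (h : N ≤ N') {S : Set (ClosedAddSubgroup (Ahat n))} (hS : Below N S) :
    Below N' S := ⟨hS.1, fun γ hγ => hS.2 γ fun i hi => hγ i (hi.trans_le h)⟩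

lemma Below.inter {N : ℕ} {S T : Set (ClosedAddSubgroup (Ahat n))} (hS : Below N S)
    (hT : Below N T) : Below N (S ∩ T) :=
  ⟨hS.1.inter hT.1, fun γ hγ => by rw [Set.preimage_inter, hS.2 γ hγ, hT.2 γ hγ]⟩

lemma Below.compl {N : ℕ} {S : Set (ClosedAddSubgroup (Ahat n))} (hS : Below N S) :
    Below N Sᶜ := ⟨hS.1.compl, fun γ hγ => by rw [Set.preimage_compl, hS.2 γ hγ]⟩

lemma Below.iInter {N : ℕ} {ι : Sort*} [Countable ι] {S : ι → Set (ClosedAddSubgroup (Ahat n))}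
    (hS : ∀ i, Below N (S i)) : Below N (⋂ i, S i) :=
  ⟨MeasurableSet.iInter fun i => (hS i).1, fun γ hγ => by
    rw [Set.preimage_iInter]
    exact Set.iInter_congr fun i => (hS i).2 γ hγ⟩

lemma below_annEvent {N : ℕ} {x : FreeAb} (hx : ∀ i, x i ≠ 0 → i < N) : Below N (annEvent n x) :=
  ⟨measurableSet_annEvent n x, fun γ hγ => by
    rw [preimage_annEvent, aut_eq_self fun i hi => hγ i (hx i hi)]⟩

lemma below_annEvent_smul_e {N i : ℕ} (d : ℕ) (hi : i < N) : Below N (annEvent n (d • e i)) :=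
  below_annEvent fun j hj => by
    by_contra h
    have : i ≠ j := by omega
    simp [this] at hj

/-- The probability that `d e_0` annihilates the random subgroup. -/
def annProb (μ : Measure (ClosedAddSubgroup (Ahat n))) (d : ℕ) : ℝ := μ.real (annEvent n (d • e 0))

/-- A finitarily invariant random subgroup for which the events `d e_j ∈ H` are independent of what
happens below `j`. -/
structure Independent (μ : Measure (ClosedAddSubgroup (Ahat n))) : Prop where
  prob : IsProbabilityMeasure μ
  inv : FinInv μ
  indep : ∀ (d N : ℕ) (S : Set (ClosedAddSubgroup (Ahat n))), Below N S → ∀ j, N ≤ j →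
    μ.real (S ∩ annEvent n (d • e j)) = annProb μ d * μ.real S

lemma FinInv.measureReal_preimage {μ : Measure (ClosedAddSubgroup (Ahat n))} (hμ : FinInv μ)
    {γ : FreeAb ≃ₗ[ℤ] FreeAb} (hγ : Finitary γ) {S : Set (ClosedAddSubgroup (Ahat n))}
    (hS : MeasurableSet S) : μ.real (mapAut (dualAut n γ) ⁻¹' S) = μ.real S := by
  rw [measureReal_def, hμ.measure_preimage hγ hS, measureReal_def]

/-- It suffices that γ fixes `E j` for all large j, with a threshold depending on γ. This is why
only finitary automorphisms are used: each of them fixes e_j eventually. -/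
lemma finInv_of_tendsto {μ ν : Measure (ClosedAddSubgroup (Ahat n))} (hμ : FinInv μ)
    [IsFiniteMeasure ν] {E : ℕ → Set (ClosedAddSubgroup (Ahat n))} (hEm : ∀ j, MeasurableSet (E j))
    (hE : ∀ γ, Finitary γ → ∀ᶠ j in Filter.atTop, mapAut (dualAut n γ) ⁻¹' E j = E j)
    {U : Ultrafilter ℕ} (hU : (U : Filter ℕ) ≤ Filter.atTop)
    (hν : ∀ S, MeasurableSet S → Filter.Tendsto (fun j => μ.real (S ∩ E j)) U
      (nhds (ν.real S))) : FinInv ν := by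
  intro γ hγ
  refine measure_eq_of_measureReal fun S hS => ?_
  rw [map_measureReal_apply (measurable_mapAut _) hS]
  refine tendsto_nhds_unique (hν _ (measurable_mapAut _ hS)) ((hν S hS).congr' ?_)
  filter_upwards [hU (hE γ hγ)] with j hj
  conv_rhs => rw [← hj, ← Set.preimage_inter]
  rw [hμ.measureReal_preimage hγ (hS.inter (hEm j))]

/-- The limit of the restrictions of μ to d e_j ∈ H is an invariant part of μ, as is the limit for
the complements, so each is a multiple of μ. For an event below N, swapping two basis vectors beyond
N shows that the sequence is constant for j ≥ N, so the limit is attained. -/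
lemma independent_of_mem_CRSe {μ : Measure (ClosedAddSubgroup (Ahat n))}
    (hμ : μ ∈ CRSe (Ahat n)) : Independent μ := by
  have hp : IsProbabilityMeasure μ := hμ.1.1
  have hinv : FinInv μ := finInv_of_mem_CRS hμ.1
  have key : ∀ d : ℕ, ∃ ν : Measure (ClosedAddSubgroup (Ahat n)),
      (∀ S, ν.real S = ν.real Set.univ * μ.real S) ∧
      ∀ S N, Below N S → ∀ j, N ≤ j → μ.real (S ∩ annEvent n (d • e j)) = ν.real S := by
    intro d
    let E : ℕ → Set (ClosedAddSubgroup (Ahat n)) := fun j => annEvent n (d • e j)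
    have hEm : ∀ j, MeasurableSet (E j) := fun j => measurableSet_annEvent n _
    have hE : ∀ γ, Finitary γ → ∀ᶠ j in Filter.atTop, mapAut (dualAut n γ) ⁻¹' E j = E j := by
      rintro γ ⟨N, hN⟩
      filter_upwards [Filter.eventually_ge_atTop N] with j hj
      rw [preimage_annEvent, map_nsmul, hN j hj]
    let U : Ultrafilter ℕ := Filter.hyperfilter ℕ
    have hU : (U : Filter ℕ) ≤ Filter.atTop := by
      rw [← Nat.cofinite_eq_atTop]
      exact Filter.hyperfilter_le_cofinite
    obtain ⟨ν, hνf, hν⟩ := exists_measure_tendsto μ E U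
    obtain ⟨ν', hνf', hν'⟩ := exists_measure_tendsto μ (fun j => (E j)ᶜ) U
    have hsum : ν + ν' = μ := by
      refine measure_eq_of_measureReal fun S hS => ?_
      rw [measureReal_add_apply]
      refine tendsto_nhds_unique ((hν S hS).add (hν' S hS)) ?_
      refine tendsto_const_nhds.congr fun j => ?_
      rw [← Set.sdiff_eq, measureReal_inter_add_sdiff (hEm j)]
    refine ⟨ν, fun S => measureReal_eq_mul_of_mem_CRSe hμ (finInv_of_tendsto hinv hEm hE hU hν)
      (finInv_of_tendsto hinv (fun j => (hEm j).compl) (fun γ hγ => ?_) hU hν') hsum S, ?_⟩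
    · filter_upwards [hE γ hγ] with j hj
      rw [Set.preimage_compl, hj]
    · intro S N hS j hj
      have hconst : ∀ i, N ≤ i → μ.real (S ∩ E i) = μ.real (S ∩ E j) := by
        intro i hi
        have h1 : mapAut (dualAut n (permAut (Equiv.swap j i))) ⁻¹' (S ∩ E j) = S ∩ E i := by
          rw [Set.preimage_inter, preimage_annEvent, map_nsmul, permAut_e, Equiv.swap_apply_left,
            hS.2]
          intro l hl
          rw [permAut_e, Equiv.swap_apply_of_ne_of_ne (by omega) (by omega)]
        rw [← h1, hinv.measureReal_preimage (finitary_swap _ _) (hS.1.inter (hEm j))]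
      refine tendsto_nhds_unique (tendsto_const_nhds.congr' ?_) (hν S hS.1)
      filter_upwards [hU (Filter.eventually_ge_atTop N)] with i hi
      exact (hconst i hi).symm
  refine ⟨hp, hinv, fun d N S hS j hj => ?_⟩
  obtain ⟨ν, hν, hν'⟩ := key d
  -- The multiplier is the total mass of ν, identified with `annProb μ d` by taking the sure event
  -- and j = 0.
  rw [hν' S N hS j hj, hν S, ← hν' Set.univ 0 (Below.univ 0) 0 le_rfl, Set.univ_inter]
  rfl

end

noncomputable section

/-! ### The function `d ↦ P(d e_0 ∈ H)` -/

variable {n : ℕ} {μ : Measure (ClosedAddSubgroup (Ahat n))}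

lemma annEvent_subset_of_dvd {d d' : ℕ} (h : d ∣ d') (x : FreeAb) :
    annEvent n (d • x) ⊆ annEvent n (d' • x) := by
  obtain ⟨c, rfl⟩ := h
  intro K hK
  rw [mem_annEvent, mul_comm, mul_nsmul', ← mul_nsmul', mul_comm, mul_nsmul]
  exact nsmul_mem hK c

namespace Independent

lemma measureReal_annEvents (hμ : Independent μ) (s : Finset ℕ) (d : ℕ → ℕ) :
    μ.real (annEvents n ((fun i => d i • e i) '' s)) = ∏ i ∈ s, annProb μ (d i) := by
  classical
  have := hμ.prob
  induction s using Finset.induction_on_max with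
  | empty =>
    have : annEvents n ((fun i => d i • e i) '' ((∅ : Finset ℕ) : Set ℕ)) = Set.univ := by
      ext K
      simp [mem_annEvents]
    rw [this]
    simp
  | insert a s hs ih =>
    have ha : a ∉ s := fun h => lt_irrefl _ (hs a h)
    have h1 : annEvents n ((fun i => d i • e i) '' ((insert a s : Finset ℕ) : Set ℕ)) =
        annEvents n ((fun i => d i • e i) '' s) ∩ annEvent n (d a • e a) := by
      ext K
      simp only [Finset.coe_insert, Set.image_insert_eq, mem_annEvents, Set.mem_insert_iff,
        forall_eq_or_imp, Set.mem_inter_iff, mem_annEvent]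
      exact and_comm
    have h2 : Below a (annEvents n ((fun i => d i • e i) '' (s : Set ℕ))) := by
      rw [annEvents_eq_iInter]
      refine Below.iInter fun x => Below.iInter fun hx => ?_
      obtain ⟨i, hi, rfl⟩ := hx
      exact below_annEvent_smul_e _ (hs i hi)
    rw [h1, hμ.indep (d a) a _ h2 a le_rfl, ih, Finset.prod_insert ha]

lemma annProb_nonneg (d : ℕ) : 0 ≤ annProb μ d := measureReal_nonneg

lemma annProb_le_one (hμ : Independent μ) (d : ℕ) : annProb μ d ≤ 1 := by
  have := hμ.prob
  exact measureReal_le_one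

lemma annProb_zero (hμ : Independent μ) : annProb μ 0 = 1 := by
  have := hμ.prob
  have : annEvent n ((0 : ℕ) • e 0) = Set.univ := by
    ext K
    simp [mem_annEvent]
  rw [annProb, this]
  simp

lemma annProb_self (hμ : Independent μ) : annProb μ n = 1 := by
  have := hμ.prob
  have : annEvent n (n • e 0) = Set.univ := Set.eq_univ_of_forall fun K => nsmul_mem_perp K _
  rw [annProb, this]
  simp

lemma annProb_mono (hμ : Independent μ) {d d' : ℕ} (h : d ∣ d') : annProb μ d ≤ annProb μ d' := by
  have := hμ.prob
  exact measureReal_mono (annEvent_subset_of_dvd h _)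

/-- The automorphism of `𝒜` that acts on `e_0, e_1` by a matrix of determinant one. -/
def _root_.CharRandSub.sl2Aut (a b u v : ℤ) (h : u * a + v * b = 1) : FreeAb ≃ₗ[ℤ] FreeAb :=
  autOfFamilies
    (fun | 0 => a • e 0 + b • e 1 | 1 => -v • e 0 + u • e 1 | (i + 2) => e (i + 2))
    (fun | 0 => u • e 0 - b • e 1 | 1 => v • e 0 + a • e 1 | (i + 2) => e (i + 2))
    (by
      rintro (_ | _ | i)
      · simp only [map_sub, map_smul, Finsupp.linearCombination_single, one_smul]
        calc _ = (u * a + v * b) • e 0 := by module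
          _ = e 0 := by rw [h, one_smul]
      · simp only [map_add, map_smul, Finsupp.linearCombination_single, one_smul]
        calc _ = (u * a + v * b) • e 1 := by module
          _ = e 1 := by rw [h, one_smul]
      · simp)
    (by
      rintro (_ | _ | i)
      · simp only [map_add, map_smul, Finsupp.linearCombination_single, one_smul]
        calc _ = (u * a + v * b) • e 0 := by module
          _ = e 0 := by rw [h, one_smul]
      · simp only [map_add, map_smul, Finsupp.linearCombination_single, one_smul]
        calc _ = (u * a + v * b) • e 1 := by module
          _ = e 1 := by rw [h, one_smul]
      · simp)

lemma _root_.CharRandSub.finitary_sl2Aut (a b u v : ℤ) (h : u * a + v * b = 1) :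
    Finitary (sl2Aut a b u v h) := by
  refine ⟨2, fun j hj => ?_⟩
  obtain ⟨i, rfl⟩ := Nat.exists_eq_add_of_le' hj
  simp [sl2Aut]

/-- By independence both sides are probabilities that two elements lie in H. The sublattice spanned
by a e_0 and b e_1 is also spanned by gcd·f_0 and lcm·f_1 for a basis f_0, f_1 obtained by a matrix
of determinant one, whose entries come from Bézout. -/
lemma annProb_mul_eq_gcd_mul_lcm (hμ : Independent μ) {a b : ℕ} (ha : 0 < a) :
    annProb μ a * annProb μ b = annProb μ (a.gcd b) * annProb μ (a.lcm b) := by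
  have := hμ.prob
  have htwo : ∀ c d : ℕ, annProb μ c * annProb μ d =
      μ.real (annEvent n (c • e 0) ∩ annEvent n (d • e 1)) := by
    intro c d
    rw [hμ.indep d 1 _ (below_annEvent_smul_e c one_pos) 1 le_rfl, mul_comm]
    rfl
  rw [htwo, htwo]
  obtain ⟨g, a', b', hg, hco, rfl, rfl⟩ := Nat.exists_coprime' (Nat.gcd_pos_of_pos_left b ha)
  have hgcd : (a' * g).gcd (b' * g) = g := by
    rw [Nat.gcd_mul_right, hco, one_mul]
  have hlcm : (a' * g).lcm (b' * g) = a' * b' * g := by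
    rw [Nat.lcm_mul_right, hco.lcm_eq_mul]
  rw [hgcd, hlcm]
  have hbez : (a'.gcdA b' : ℤ) * a' + a'.gcdB b' * b' = 1 := by
    have := Nat.gcd_eq_gcd_ab a' b'
    rw [hco] at this
    push_cast at this
    linarith
  set u := a'.gcdA b'
  set v := a'.gcdB b'
  rw [← hμ.inv.measureReal_preimage (finitary_sl2Aut _ _ _ _ hbez)
    ((measurableSet_annEvent n (g • e 0)).inter (measurableSet_annEvent n ((a' * b' * g) • e 1))),
    Set.preimage_inter, preimage_annEvent, preimage_annEvent, map_nsmul, map_nsmul]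
  have h0 : sl2Aut a' b' u v hbez (e 0) = (a' : ℤ) • e 0 + (b' : ℤ) • e 1 := by simp [sl2Aut]
  have h1 : sl2Aut a' b' u v hbez (e 1) = -v • e 0 + u • e 1 := by simp [sl2Aut]
  rw [h0, h1]
  congr 1
  ext K
  simp only [Set.mem_inter_iff, mem_annEvent]
  simp only [← natCast_zsmul]
  push_cast
  set x := ((a' : ℤ) * g) • e 0 with hx
  set y := ((b' : ℤ) * g) • e 1 with hy
  have e1 : (g : ℤ) • ((a' : ℤ) • e 0 + (b' : ℤ) • e 1) = x + y := by
    rw [hx, hy]; module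
  have e2 : ((a' : ℤ) * b' * g) • (-v • e 0 + u • e 1) = (-(v * b')) • x + (u * a') • y := by
    rw [hx, hy]; module
  rw [e1, e2]
  constructor
  · rintro ⟨hx, hy⟩
    exact ⟨add_mem hx hy, add_mem (zsmul_mem hx _) (zsmul_mem hy _)⟩
  · rintro ⟨hz, hw⟩
    have ex : x = (u * a') • (x + y) - ((-(v * b')) • x + (u * a') • y) := by
      have : x = (u * a' + v * b') • x := by rw [hbez, one_smul]
      conv_lhs => rw [this]
      module
    have ey : y = (v * b') • (x + y) + ((-(v * b')) • x + (u * a') • y) := by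
      have : y = (u * a' + v * b') • y := by rw [hbez, one_smul]
      conv_lhs => rw [this]
      module
    refine ⟨?_, ?_⟩
    · rw [ex]
      exact sub_mem (zsmul_mem hz _) hw
    · rw [ey]
      exact add_mem (zsmul_mem hz _) hw

end Independent

/-! ### Multiplication by a prime -/

/-- Modulo `p d`, the subgroup `P` contains no nontrivial combination of `d e_0, …, d e_{k-1}`. -/
def PrimeFree (d p k : ℕ) (P : AddSubgroup FreeAb) : Prop :=
  ∀ x : FreeAb, (∀ i, x i ≠ 0 → i < k) → (d • x ∈ P ↔ ∀ i, (p : ℤ) ∣ x i)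

/-- The combination of the first `k` basis vectors with the given coefficients. -/
def combo {p k : ℕ} (v : Fin k → Fin p) : FreeAb := ∑ i, ((v i : ℕ) : ℤ) • e i

lemma combo_apply {p k : ℕ} (v : Fin k → Fin p) (i : ℕ) :
    combo v i = if h : i < k then ((v ⟨i, h⟩ : ℕ) : ℤ) else 0 := by
  rw [combo, Finsupp.finsetSum_apply]
  split_ifs with h
  · rw [Finset.sum_eq_single ⟨i, h⟩]
    · simp
    · intro j _ hj
      have : (j : ℕ) ≠ i := fun h' => hj (Fin.ext h')
      simp [this]
    · simp
  · refine Finset.sum_eq_zero fun j _ => ?_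
    have : (j : ℕ) ≠ i := by have := j.2; omega
    simp [this]

lemma combo_lt {p k : ℕ} (v : Fin k → Fin p) {i : ℕ} (h : combo v i ≠ 0) : i < k := by
  by_contra hi
  exact h (by simp [combo_apply, hi])

lemma combo_self {p k : ℕ} (v : Fin k → Fin p) : combo v k = 0 := by simp [combo_apply]

lemma mem_of_forall_basis {P : AddSubgroup FreeAb} {ψ : FreeAb →ₗ[ℤ] FreeAb} {x : FreeAb}
    (h : ∀ i, x i ≠ 0 → ψ (e i) ∈ P) : ψ x ∈ P := by
  rw [← Finsupp.sum_single x, map_finsuppSum]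
  refine sum_mem fun i hi => ?_
  have h1 : Finsupp.single i (x i) = x i • e i := by simp
  change ψ (Finsupp.single i (x i)) ∈ P
  rw [h1, map_smul]
  exact zsmul_mem (h i (Finsupp.mem_support_iff.mp hi)) _

section PrimeFree

variable {d p k : ℕ} {P : AddSubgroup FreeAb}

lemma PrimeFree.smul_e_mem (h : PrimeFree d p k P) {i : ℕ} (hi : i < k) : (p * d) • e i ∈ P := by
  have h1 := (h (p • e i) (fun j hj => by
    by_contra hjk
    have : i ≠ j := by omega
    simp [this] at hj)).mpr fun j => by
    rw [Finsupp.smul_apply, nsmul_eq_mul]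
    exact Dvd.intro _ rfl
  rwa [smul_smul, mul_comm] at h1

lemma PrimeFree.succ_left (h : PrimeFree d p (k + 1) P) : PrimeFree d p k P :=
  fun x hx => h x fun i hi => (hx i hi).trans (Nat.lt_succ_self k)

lemma PrimeFree.notMem (h : PrimeFree d p (k + 1) P) (hp : p.Prime) (v : Fin k → Fin p) :
    d • (e k + combo v) ∉ P := by
  intro hv
  have h1 := (h _ fun i hi => ?_).mp hv k
  · rw [Finsupp.add_apply, combo_self, add_zero, Finsupp.single_eq_same] at h1
    exact hp.one_lt.ne' (Nat.dvd_one.mp (by exact_mod_cast h1))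
  · by_contra hik
    apply hi
    have h2 : combo v i = 0 := by
      by_contra h3
      have := combo_lt v h3
      omega
    have : k ≠ i := by omega
    simp [h2, this]

lemma PrimeFree.smul_e_mem_of_mem (h : PrimeFree d p k P) {v : Fin k → Fin p}
    (hv : d • (e k + combo v) ∈ P) : (p * d) • e k ∈ P := by
  have h1 : d • (p • combo v) ∈ P := (h _ fun i hi => combo_lt v fun h0 => hi (by simp [h0])).mpr
    fun i => by simp
  have h2 : (p * d) • e k = p • (d • (e k + combo v)) - d • (p • combo v) := by
    simp only [smul_add, smul_smul, mul_comm d p]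
    abel
  rw [h2]
  exact sub_mem (nsmul_mem hv p) h1

/-- The difference of two such elements has coefficients smaller than p in absolute value, so
divisibility by p forces them to vanish. -/
lemma PrimeFree.eq_of_mem (h : PrimeFree d p k P) {v v' : Fin k → Fin p}
    (hv : d • (e k + combo v) ∈ P) (hv' : d • (e k + combo v') ∈ P) : v = v' := by
  have h1 : d • (combo v - combo v') ∈ P := by
    have := sub_mem hv hv'
    rwa [← smul_sub, add_sub_add_left_eq_sub] at this
  have h2 := (h _ fun i hi => ?_).mp h1
  · funext i
    have h3 := h2 i
    rw [Finsupp.sub_apply, combo_apply, combo_apply, dif_pos i.2, dif_pos i.2] at h3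
    have h4 := Int.eq_zero_of_abs_lt_dvd h3 (by
      rw [abs_lt]
      have := (v i).2
      have := (v' i).2
      constructor <;> simp only [Fin.eta] <;> omega)
    simp only [Fin.eta] at h4
    exact Fin.ext (by omega)
  · by_contra hik
    apply hi
    simp [combo_apply, hik]

/-- If a combination in P had a coefficient at e_k prime to p, multiplying by its inverse modulo p
and reducing the remaining coefficients would give one of the excluded elements e_k + `combo v`. -/
lemma PrimeFree.succ (h : PrimeFree d p k P) (hp : p.Prime) (hk : (p * d) • e k ∈ P)
    (hv : ∀ v : Fin k → Fin p, d • (e k + combo v) ∉ P) : PrimeFree d p (k + 1) P := by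
  intro x hx
  let y := x.erase k
  have hxy : x = y + x k • e k := by
    ext i
    by_cases hi : i = k
    · subst hi
      simp [y]
    · simp [y, hi]
  have hy : ∀ i, y i ≠ 0 → i < k := by
    intro i hi
    have h1 : i ≠ k := by
      rintro rfl
      simp [y] at hi
    have h2 : x i ≠ 0 := by simpa [y, h1] using hi
    have := hx i h2
    omega
  have hpk : ∀ c : ℤ, (p : ℤ) ∣ c → d • (c • e k) ∈ P := by
    rintro _ ⟨c, rfl⟩
    have : d • (((p : ℤ) * c) • e k) = c • ((p * d) • e k) := by
      simp only [← natCast_zsmul, smul_smul]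
      congr 1
      push_cast
      ring
    rw [this]
    exact zsmul_mem hk c
  constructor
  · intro hmem
    have hdvd : (p : ℤ) ∣ x k := by
      by_contra hndvd
      have hco : IsCoprime (x k) (p : ℤ) :=
        ((Nat.prime_iff_prime_int.mp hp).coprime_iff_not_dvd.mpr hndvd).symm
      obtain ⟨c, t, hct⟩ := hco
      have hp0 : (0 : ℤ) < p := by exact_mod_cast hp.pos
      let v : Fin k → Fin p := fun i => ⟨((c * y i) % p).toNat, by
        have := Int.emod_lt_of_pos (c * y i) hp0
        have := Int.emod_nonneg (c * y i) hp0.ne'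
        omega⟩
      apply hv v
      have h1 : d • (combo v - c • y) ∈ P := by
        refine (h _ fun i hi => ?_).mpr fun i => ?_
        · by_contra hik
          apply hi
          have : y i = 0 := by
            by_contra h0
            exact hik (hy i h0)
          simp [combo_apply, hik, this]
        · by_cases hik : i < k
          · rw [Finsupp.sub_apply, combo_apply, dif_pos hik]
            have h2 : (((v ⟨i, hik⟩ : Fin p) : ℕ) : ℤ) = (c * y i) % p :=
              Int.toNat_of_nonneg (Int.emod_nonneg _ hp0.ne')
            rw [h2, Finsupp.smul_apply, smul_eq_mul]
            exact (Int.mod_modEq _ _).symm.dvd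
          · have : y i = 0 := by
              by_contra h0
              exact hik (hy i h0)
            simp [combo_apply, hik, this]
      have h3 : d • (e k + combo v) =
          d • (combo v - c • y) + c • (d • x) + d • ((t * p) • e k) := by
        have h4 : (e k : FreeAb) = (c * x k + t * p) • e k := by rw [hct, one_smul]
        conv_lhs => rw [h4]
        conv_rhs => rw [hxy]
        have h5 : (y + x k • e k) k = x k := by rw [← hxy]
        simp only [← natCast_zsmul]
        module
      rw [h3]
      exact add_mem (add_mem h1 (zsmul_mem hmem c)) (hpk _ (Dvd.intro_left t rfl))
    have hdy : d • y ∈ P := by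
      have : d • y = d • x - d • (x k • e k) := by
        conv_rhs => enter [1]; rw [hxy]
        rw [smul_add, add_sub_cancel_right]
      rw [this]
      exact sub_mem hmem (hpk _ hdvd)
    have h1 := (h y hy).mp hdy
    intro i
    by_cases hi : i = k
    · exact hi ▸ hdvd
    · have := h1 i
      simpa [y, hi] using this
  · intro hdvd
    rw [hxy, smul_add]
    refine add_mem ((h y hy).mpr fun i => ?_) (hpk _ (hdvd k))
    by_cases hi : i = k
    · simp [y, hi]
    · simpa [y, hi] using hdvd i

end PrimeFree

/-- The event that the annihilator of the random subgroup satisfies `PrimeFree`. -/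
def primeFreeEvent (n d p k : ℕ) : Set (ClosedAddSubgroup (Ahat n)) :=
  {K | PrimeFree d p k (perp K)}

lemma below_primeFreeEvent (d p k : ℕ) : Below k (primeFreeEvent n d p k) := by
  -- The negative conditions are repeated inside the intersection over the positive ones; nothing is
  -- lost because x = 0 always belongs to its index set.
  have h : primeFreeEvent n d p k = ⋂ x : FreeAb, ⋂ _ : ∀ i, x i ≠ 0 → i < k,
      ⋂ _ : ∀ i, (p : ℤ) ∣ x i, annEvent n (d • x) ∩
      (⋂ x : FreeAb, ⋂ _ : ∀ i, x i ≠ 0 → i < k, ⋂ _ : ¬ ∀ i, (p : ℤ) ∣ x i,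
        (annEvent n (d • x))ᶜ) := by
    ext K
    simp only [primeFreeEvent, Set.mem_ofPred_eq, PrimeFree, Set.mem_iInter, Set.mem_inter_iff,
      mem_annEvent, Set.mem_compl_iff]
    constructor
    · intro h x hx hxp
      exact ⟨(h x hx).mpr hxp, fun x' hx' hxp' h' => hxp' ((h x' hx').mp h')⟩
    · intro h x hx
      refine ⟨fun h' => ?_, fun h' => (h x hx h').1⟩
      by_contra hxp
      exact (h 0 (by simp) (by simp)).2 x hx hxp h'
  have hb : ∀ x : FreeAb, (∀ i, x i ≠ 0 → i < k) → Below k (annEvent n (d • x)) := fun x hx =>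
    below_annEvent fun i hi => hx i fun h0 => hi (by simp [h0])
  rw [h]
  exact Below.iInter fun x => Below.iInter fun hx => Below.iInter fun _ =>
    (hb x hx).inter (Below.iInter fun x' => Below.iInter fun hx' => Below.iInter fun _ =>
      (hb x' hx').compl)

namespace Independent

lemma measureReal_primeFreeEvent_zero (hμ : Independent μ) (d p : ℕ) :
    μ.real (primeFreeEvent n d p 0) = 1 := by
  have := hμ.prob
  have : primeFreeEvent n d p 0 = Set.univ := by
    refine Set.eq_univ_of_forall fun K x hx => ?_
    have : x = 0 := by
      ext i
      by_contra h
      exact absurd (hx i h) (Nat.not_lt_zero i)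
    simp [this]
  rw [this]
  simp

/-- Given freeness at level k, the event p d e_k ∈ H splits into freeness at level k + 1 and the p^k
disjoint events d(e_k + `combo v`) ∈ H. A transvection carries each of these to d e_k ∈ H without
changing the condition below k, and independence evaluates them. -/
lemma measureReal_primeFreeEvent_succ (hμ : Independent μ) {p : ℕ} (hp : p.Prime) (d k : ℕ) :
    μ.real (primeFreeEvent n d p (k + 1)) =
      μ.real (primeFreeEvent n d p k) * (annProb μ (p * d) - p ^ k * annProb μ d) := by
  classical
  have := hμ.prob
  set Q := primeFreeEvent n d p k with hQ
  have hQb : Below k Q := below_primeFreeEvent d p k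
  let T : (Fin k → Fin p) → Set (ClosedAddSubgroup (Ahat n)) :=
    fun v => Q ∩ annEvent n (d • (e k + combo v))
  have hTm : ∀ v, MeasurableSet (T v) := fun v => hQb.1.inter (measurableSet_annEvent n _)
  have hT : ∀ v, μ.real (T v) = annProb μ d * μ.real Q := by
    intro v
    have h := hμ.inv.measureReal_preimage
      (finitary_transvection k (combo v) (combo_self v))
      (hQb.1.inter (measurableSet_annEvent n (d • e k)))
    rw [Set.preimage_inter, preimage_annEvent, map_nsmul, transvection_self,
      hQb.2 _ fun i hi => transvection_of_ne _ _ hi.ne, hμ.indep d k Q hQb k le_rfl] at h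
    exact h
  have hdisj : Set.PairwiseDisjoint ((Finset.univ : Finset (Fin k → Fin p)) : Set _) T := by
    intro v _ v' _ hne
    refine Set.disjoint_left.mpr fun K hK hK' => hne ?_
    exact PrimeFree.eq_of_mem hK.1 hK.2 hK'.2
  have hsplit : Q ∩ annEvent n ((p * d) • e k) =
      primeFreeEvent n d p (k + 1) ∪ ⋃ v ∈ (Finset.univ : Finset (Fin k → Fin p)), T v := by
    ext K
    simp only [Set.mem_union, Set.mem_iUnion, Finset.mem_univ, exists_prop, true_and]
    constructor
    · rintro ⟨hK, hKk⟩
      by_cases hv : ∃ v : Fin k → Fin p, d • (e k + combo v) ∈ perp K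
      · obtain ⟨v, hv⟩ := hv
        exact Or.inr ⟨v, hK, hv⟩
      · push Not at hv
        exact Or.inl (PrimeFree.succ hK hp hKk hv)
    · rintro (hK | ⟨v, hK, hv⟩)
      · exact ⟨PrimeFree.succ_left hK, PrimeFree.smul_e_mem hK (Nat.lt_succ_self k)⟩
      · exact ⟨hK, PrimeFree.smul_e_mem_of_mem hK hv⟩
  have hdisj' : Disjoint (primeFreeEvent n d p (k + 1))
      (⋃ v ∈ (Finset.univ : Finset (Fin k → Fin p)), T v) := by
    refine Set.disjoint_left.mpr fun K hK hK' => ?_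
    simp only [Set.mem_iUnion, Finset.mem_univ, exists_prop, true_and] at hK'
    obtain ⟨v, -, hv⟩ := hK'
    exact PrimeFree.notMem hK hp v hv
  have h1 := hμ.indep (p * d) k Q hQb k le_rfl
  rw [hsplit, measureReal_union hdisj' (Finset.measurableSet_biUnion _ fun v _ => hTm v)
    (measure_ne_top _ _) (measure_ne_top _ _),
    measureReal_biUnion_finset hdisj fun v _ => hTm v] at h1
  simp only [hT, Finset.sum_const, Finset.card_univ, Fintype.card_pi, Fintype.card_fin,
    Finset.prod_const, nsmul_eq_mul, Nat.cast_pow] at h1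
  linear_combination h1

/-- Passing from `d` to `p d` multiplies the probability by a power of `p`, whose exponent is
the largest `k` for which `PrimeFree d p k` has positive probability. -/
lemma exists_annProb_prime_mul (hμ : Independent μ) {p : ℕ} (hp : p.Prime) {d : ℕ}
    (hd : 0 < annProb μ d) : ∃ r : ℕ, annProb μ (p * d) = p ^ r * annProb μ d ∧
      (∀ k ≤ r, 0 < μ.real (primeFreeEvent n d p k)) ∧
      μ.real (primeFreeEvent n d p (r + 1)) = 0 := by
  classical
  have hrec := hμ.measureReal_primeFreeEvent_succ hp d
  have h0 := hμ.measureReal_primeFreeEvent_zero d p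
  have hpos : ∀ r, (∀ k < r, annProb μ (p * d) ≠ p ^ k * annProb μ d) →
      ∀ k ≤ r, 0 < μ.real (primeFreeEvent n d p k) := by
    intro r hr k hk
    induction k with
    | zero => rw [h0]; exact one_pos
    | succ k ih =>
      have h1 := ih (by omega)
      refine lt_of_le_of_ne measureReal_nonneg ?_
      rw [hrec]
      exact (mul_ne_zero h1.ne' (sub_ne_zero.mpr (hr k (by omega)))).symm
  have hex : ∃ r : ℕ, annProb μ (p * d) = p ^ r * annProb μ d := by
    -- Otherwise all levels have positive probability, but the factor P(pd) − p^k P(d) is negative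
    -- for large k.
    by_contra! hne
    obtain ⟨k, hk⟩ : ∃ k : ℕ, 1 / annProb μ d < (p : ℝ) ^ k :=
      pow_unbounded_of_one_lt _ (by exact_mod_cast hp.one_lt)
    have h1 := hpos (k + 1) (fun j _ => hne j) k (by omega)
    have h2 := hpos (k + 1) (fun j _ => hne j) (k + 1) le_rfl
    rw [hrec] at h2
    have h3 := pos_of_mul_pos_right h2 h1.le
    rw [div_lt_iff₀ hd] at hk
    have := hμ.annProb_le_one (p * d)
    linarith
  refine ⟨Nat.find hex, Nat.find_spec hex, hpos _ fun k hk => Nat.find_min hex hk, ?_⟩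
  rw [hrec, ← Nat.find_spec hex, sub_self, mul_zero]

lemma measureReal_inter_shifted (hμ : Independent μ) (d : ℕ) {k : ℕ}
    {S : Set (ClosedAddSubgroup (Ahat n))} (hS : Below k S) (j : ℕ) :
    ∃ T, Below (k + j) T ∧ (∀ K ∈ T, K ∈ S ∧ ∀ i < j, d • e (k + i) ∈ perp K) ∧
      μ.real T = annProb μ d ^ j * μ.real S := by
  induction j with
  | zero => exact ⟨S, hS, fun K hK => ⟨hK, by simp⟩, by simp⟩
  | succ j ih =>
    obtain ⟨T, hT, hTS, hTm⟩ := ih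
    refine ⟨T ∩ annEvent n (d • e (k + j)),
      (hT.mono (by omega)).inter (below_annEvent_smul_e d (by omega)), fun K hK => ?_, ?_⟩
    · refine ⟨(hTS K hK.1).1, fun i hi => ?_⟩
      rcases Nat.lt_succ_iff_lt_or_eq.mp hi with h | rfl
      · exact (hTS K hK.1).2 i h
      · exact hK.2
    · rw [hμ.indep d _ T hT _ le_rfl, hTm]
      ring

/-- The automorphism of `𝒜` with `e_i ↦ p e_i + e_{k+i}` for `i < k`. -/
def _root_.CharRandSub.spreadAut (p k : ℕ) : FreeAb ≃ₗ[ℤ] FreeAb :=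
  autOfFamilies
    (fun i => if i < k then p • e i + e (k + i) else if i < k + k then e (i - k) else e i)
    (fun i => if i < k then e (k + i) else if i < k + k then e (i - k) - p • e i else e i)
    (by
      intro i
      by_cases hi : i < k
      · simp [hi]
      by_cases hi' : i < k + k
      · have h1 : i - k < k := by omega
        have h2 : k + (i - k) = i := by omega
        simp only [hi, hi', h1, if_true, if_false, map_sub, map_nsmul,
          Finsupp.linearCombination_single, one_smul, h2]
        abel
      · simp [hi, hi'])
    (by
      intro i
      by_cases hi : i < k
      · have h1 : ¬ k + i < k := by omega
        have h2 : k + i < k + k := by omega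
        simp only [hi, h1, h2, if_true, if_false, map_add, map_nsmul,
          Finsupp.linearCombination_single, one_smul, Nat.add_sub_cancel_left]
        abel
      by_cases hi' : i < k + k
      · have h1 : i - k < k := by omega
        have h2 : k + (i - k) = i := by omega
        simp [hi, hi', h1, h2]
      · simp [hi, hi'])

lemma _root_.CharRandSub.spreadAut_e {p k i : ℕ} (hi : i < k) :
    spreadAut p k (e i) = p • e i + e (k + i) := by
  rw [spreadAut, autOfFamilies_e, if_pos hi]

lemma _root_.CharRandSub.finitary_spreadAut (p k : ℕ) : Finitary (spreadAut p k) := by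
  refine ⟨k + k, fun j hj => ?_⟩
  rw [spreadAut, autOfFamilies_e, if_neg (by omega), if_neg (by omega)]

/-- If s > r, then with positive probability `p * d` is free at level r + 1 and moreover d e_{r+1+i}
∈ H for i ≤ r. Replacing e_i by p e_i + e_{r+1+i} turns this into freeness of d at level r + 1,
since modulo H the image of d e_i is p d e_i. That event is null by the choice of r. -/
lemma exponent_antitone (hμ : Independent μ) {p : ℕ} (hp : p.Prime) {d r s : ℕ}
    (hd : 0 < annProb μ d) (hr : annProb μ (p * d) = p ^ r * annProb μ d)
    (hs : annProb μ (p * (p * d)) = p ^ s * annProb μ (p * d)) : s ≤ r := by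
  have := hμ.prob
  have hp1 : (1 : ℝ) < p := by exact_mod_cast hp.one_lt
  have hinj : ∀ {c : ℝ}, 0 < c → ∀ {a b : ℕ}, (p : ℝ) ^ a * c = p ^ b * c → a = b := by
    intro c hc a b h
    exact pow_right_injective₀ (by linarith) hp1.ne' (mul_right_cancel₀ hc.ne' h)
  have hpd : 0 < annProb μ (p * d) := hd.trans_le (hμ.annProb_mono (Dvd.intro_left p rfl))
  obtain ⟨r', hr', -, hr0⟩ := hμ.exists_annProb_prime_mul hp hd
  obtain ⟨s', hs', hspos, -⟩ := hμ.exists_annProb_prime_mul hp hpd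
  obtain rfl : r = r' := hinj hd (hr.symm.trans hr')
  obtain rfl : s = s' := hinj hpd (hs.symm.trans hs')
  by_contra hlt
  obtain ⟨T, -, hT, hTm⟩ := hμ.measureReal_inter_shifted d
    (below_primeFreeEvent (n := n) (p * d) p (r + 1)) (r + 1)
  have hTpos : 0 < μ.real T := by
    rw [hTm]
    exact mul_pos (pow_pos hd _) (hspos _ (by omega))
  have hsub : T ⊆ mapAut (dualAut n (spreadAut p (r + 1))) ⁻¹' primeFreeEvent n d p (r + 1) := by
    intro K hK x hx
    obtain ⟨hKf, hKd⟩ := hT K hK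
    rw [← hKf x hx, mem_perp_mapAut_dualAut]
    have h1 : (d • ((spreadAut p (r + 1)).toLinearMap - p • LinearMap.id) : FreeAb →ₗ[ℤ] FreeAb) x ∈
        perp K := by
      refine mem_of_forall_basis fun i hi => ?_
      have := hKd i (hx i hi)
      simpa [spreadAut_e (hx i hi)] using this
    have h2 : (d • ((spreadAut p (r + 1)).toLinearMap - p • LinearMap.id) : FreeAb →ₗ[ℤ] FreeAb) x =
        spreadAut p (r + 1) (d • x) - (p * d) • x := by
      simp only [LinearMap.smul_apply, LinearMap.sub_apply, LinearEquiv.coe_coe, LinearMap.id_apply,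
        smul_sub, smul_smul, map_nsmul, mul_comm p d]
    rw [h2] at h1
    constructor
    · intro h
      simpa using sub_mem h h1
    · intro h
      simpa using add_mem h1 h
  have h2 := measureReal_mono (μ := μ) hsub
  rw [hμ.inv.measureReal_preimage (finitary_spreadAut _ _) (below_primeFreeEvent _ _ _).1,
    hr0] at h2
  linarith

/-! ### Supremum and support of the probability -/

/-- Integrality of the ratios makes the values on positive multiples of d discrete, so their
supremum is attained. -/
lemma exists_nat_mul (hμ : Independent μ) (t : ℕ) (ht : 0 < t) :
    ∀ d, 0 < annProb μ d → ∃ j : ℕ, annProb μ (d * t) = j * annProb μ d := by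
  induction t using induction_on_primes with
  | zero => exact absurd ht (lt_irrefl 0)
  | one => exact fun d _ => ⟨1, by simp⟩
  | prime_mul p a hp ih =>
    intro d hd
    obtain ⟨j, hj⟩ := ih (Nat.pos_of_mul_pos_left ht) d hd
    have hda : 0 < annProb μ (d * a) := hd.trans_le (hμ.annProb_mono (Dvd.intro a rfl))
    obtain ⟨r, hr, -⟩ := hμ.exists_annProb_prime_mul hp hda
    refine ⟨p ^ r * j, ?_⟩
    rw [show d * (p * a) = p * (d * a) by ring, hr, hj]
    push_cast
    ring

/-- The probability attains its supremum over the positive integers. -/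
lemma exists_forall_annProb_le (hμ : Independent μ) {d : ℕ} (hd0 : 0 < d)
    (hd : 0 < annProb μ d) : ∃ D, 0 < D ∧ ∀ t, 0 < t → annProb μ t ≤ annProb μ D := by
  classical
  let J : Set ℕ := {j | ∃ t, 0 < t ∧ annProb μ (d * t) = j * annProb μ d}
  have hne : J.Nonempty := ⟨1, 1, one_pos, by simp⟩
  have hbdd : BddAbove J := by
    refine ⟨⌈1 / annProb μ d⌉₊, ?_⟩
    rintro j ⟨t, -, hj⟩
    have h1 := hμ.annProb_le_one (d * t)
    rw [hj, ← le_div_iff₀ hd] at h1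
    exact_mod_cast h1.trans (Nat.le_ceil _)
  obtain ⟨t, ht, hj⟩ := Nat.sSup_mem hne hbdd
  refine ⟨d * t, Nat.mul_pos hd0 ht, fun t' ht' => ?_⟩
  obtain ⟨j', hj'⟩ := hμ.exists_nat_mul (t * t') (Nat.mul_pos ht ht') d hd
  have hle : j' ≤ sSup J := le_csSup hbdd ⟨_, Nat.mul_pos ht ht', hj'⟩
  calc annProb μ t' ≤ annProb μ (d * (t * t')) :=
        hμ.annProb_mono ((Dvd.intro_left t rfl).trans (Dvd.intro_left d rfl))
    _ ≤ annProb μ (d * t) := by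
        rw [hj', hj]
        exact mul_le_mul_of_nonneg_right (by exact_mod_cast hle) hd.le

/-- Let D maximize P over the positive integers. Outside the event Z that no positive multiple of
e_0 lies in H, almost surely D e_0 ∈ H. On Z the infinitely many events D(e_1 + v e_0) ∈ H are
disjoint, since a difference would be a positive multiple of e_0, and they all have probability
P(D)·P(Z). Hence P(Z) = 0. -/
lemma exists_annProb_eq_one (hμ : Independent μ) {d : ℕ} (hd0 : 0 < d)
    (hd : 0 < annProb μ d) : ∃ D, 0 < D ∧ annProb μ D = 1 := by
  have := hμ.prob
  obtain ⟨D, hD0, hD⟩ := hμ.exists_forall_annProb_le hd0 hd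
  refine ⟨D, hD0, ?_⟩
  have hDpos : 0 < annProb μ D := hd.trans_le (hD d hd0)
  let Z : Set (ClosedAddSubgroup (Ahat n)) := ⋂ t : ℕ, ⋂ _ : 0 < t, (annEvent n (t • e 0))ᶜ
  have hZb : Below 1 Z := Below.iInter fun t => Below.iInter fun _ =>
    (below_annEvent_smul_e t one_pos).compl
  have hZ : μ.real Zᶜ ≤ annProb μ D := by
    have h1 : Zᶜ ⊆ annEvent n (D • e 0) ∪
        ⋃ t : ℕ, ⋃ _ : 0 < t, (annEvent n ((D * t) • e 0) \ annEvent n (D • e 0)) := by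
      intro K hK
      simp only [Z, Set.mem_compl_iff, Set.mem_iInter, not_forall, not_not] at hK
      obtain ⟨t, ht, hK⟩ := hK
      by_cases hKD : K ∈ annEvent n (D • e 0)
      · exact Or.inl hKD
      · refine Or.inr (Set.mem_iUnion₂.mpr ⟨t, ht, ?_, hKD⟩)
        exact annEvent_subset_of_dvd (Dvd.intro_left D rfl) _ hK
    have h2 : μ (⋃ t : ℕ, ⋃ _ : 0 < t,
        (annEvent n ((D * t) • e 0) \ annEvent n (D • e 0))) = 0 := by
      refine measure_iUnion_null fun t => measure_iUnion_null fun ht => ?_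
      rw [← measureReal_eq_zero_iff, measureReal_sdiff
        (annEvent_subset_of_dvd (Dvd.intro t rfl) _) (measurableSet_annEvent n _)]
      have h3 := hD (D * t) (Nat.mul_pos hD0 ht)
      have h4 := hμ.annProb_mono (Dvd.intro t rfl : D ∣ D * t)
      exact sub_eq_zero.mpr (le_antisymm h3 h4)
    calc μ.real Zᶜ ≤ _ := measureReal_mono h1
      _ ≤ _ := measureReal_union_le _ _
      _ = annProb μ D := by
        rw [measureReal_def μ (⋃ t : ℕ, _), h2]
        simp [annProb]
  let T : ℕ → Set (ClosedAddSubgroup (Ahat n)) := fun v => Z ∩ annEvent n (D • (e 1 + v • e 0))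
  have hTm : ∀ v, MeasurableSet (T v) := fun v => hZb.1.inter (measurableSet_annEvent n _)
  have hT : ∀ v, μ.real (T v) = annProb μ D * μ.real Z := by
    intro v
    have hv : (v • e 0 : FreeAb) 1 = 0 := by simp
    have h := hμ.inv.measureReal_preimage (finitary_transvection 1 (v • e 0) hv)
      (hZb.1.inter (measurableSet_annEvent n (D • e 1)))
    rw [Set.preimage_inter, preimage_annEvent, map_nsmul, transvection_self,
      hZb.2 _ fun i hi => transvection_of_ne _ _ hi.ne, hμ.indep D 1 Z hZb 1 le_rfl] at h
    exact h
  have hdisj : ∀ v v', v < v' → Disjoint (T v) (T v') := by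
    intro v v' hvv
    refine Set.disjoint_left.mpr fun K hK hK' => ?_
    have h1 : D • (e 1 + v' • e 0) - D • (e 1 + v • e 0) ∈ perp K := sub_mem hK'.2 hK.2
    obtain ⟨c, rfl⟩ := Nat.exists_eq_add_of_lt hvv
    have h2 : D • (e 1 + (v + c + 1) • e 0) - D • (e 1 + v • e 0) = (D * (c + 1)) • e 0 := by
      simp only [← natCast_zsmul]
      push_cast
      module
    rw [h2] at h1
    have h3 := Set.mem_iInter₂.mp hK.1 (D * (c + 1)) (Nat.mul_pos hD0 (Nat.succ_pos c))
    exact h3 h1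
  have hdisj' : Pairwise (Function.onFun Disjoint T) := by
    intro v v' hne
    rcases lt_or_gt_of_ne hne with h | h
    · exact hdisj v v' h
    · exact (hdisj v' v h).symm
  have hzero : annProb μ D * μ.real Z = 0 := by
    by_contra hne
    have h1 : μ (⋃ v, T v) = ⊤ := by
      rw [measure_iUnion hdisj' hTm]
      have h2 : ∀ v, μ (T v) = ENNReal.ofReal (annProb μ D * μ.real Z) := fun v => by
        rw [← hT v, ofReal_measureReal]
      simp only [h2]
      refine ENNReal.tsum_const_eq_top_of_ne_zero ?_
      rw [Ne, ENNReal.ofReal_eq_zero, not_le]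
      exact lt_of_le_of_ne (mul_nonneg (annProb_nonneg D) measureReal_nonneg) (Ne.symm hne)
    exact measure_ne_top μ _ h1
  have hZ0 : μ.real Z = 0 := (mul_eq_zero.mp hzero).resolve_left hDpos.ne'
  have h5 := probReal_compl_eq_one_sub (μ := μ) hZb.1
  rw [hZ0, sub_zero] at h5
  exact le_antisymm (hμ.annProb_le_one D) (h5 ▸ hZ)

/-- The support of the probability consists of the multiples of some `m`. -/
lemma exists_support (hμ : Independent μ) : ∃ m : ℕ, ∀ d, 0 < annProb μ d ↔ m ∣ d := by
  classical
  by_cases hex : ∃ d, 0 < d ∧ 0 < annProb μ d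
  · obtain ⟨hm0, hm⟩ := Nat.find_spec hex
    refine ⟨Nat.find hex, fun d => ⟨fun hd => ?_, fun hd => hm.trans_le (hμ.annProb_mono hd)⟩⟩
    -- The gcd–lcm identity closes the support under gcd, so its least positive element divides all
    -- others.
    have h1 : 0 < annProb μ ((Nat.find hex).gcd d) := by
      have h2 := hμ.annProb_mul_eq_gcd_mul_lcm (b := d) hm0
      exact pos_of_mul_pos_left (h2 ▸ mul_pos hm hd) (annProb_nonneg _)
    have h3 := Nat.find_min' hex ⟨Nat.gcd_pos_of_pos_left d hm0, h1⟩
    have h4 : (Nat.find hex).gcd d = Nat.find hex :=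
      le_antisymm (Nat.le_of_dvd hm0 (Nat.gcd_dvd_left _ _)) h3
    exact h4 ▸ Nat.gcd_dvd_right _ _
  · refine ⟨0, fun d => ?_⟩
    rw [Nat.zero_dvd]
    constructor
    · intro hd
      by_contra h0
      exact hex ⟨d, Nat.pos_of_ne_zero h0, hd⟩
    · rintro rfl
      rw [hμ.annProb_zero]
      exact one_pos

end Independent

end

noncomputable section

/-! ### Finite abelian groups -/

/-- The order of `d F`. -/
def mulCard (d : ℕ) (F : Type*) [AddCommGroup F] : ℕ :=
  Nat.card (nsmulAddMonoidHom d : F →+ F).range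

lemma mulCard_congr {F F' : Type*} [AddCommGroup F] [AddCommGroup F'] (φ : F ≃+ F') (d : ℕ) :
    mulCard d F = mulCard d F' := by
  have h : (nsmulAddMonoidHom d : F →+ F).range.map (φ : F →+ F') =
      (nsmulAddMonoidHom d : F' →+ F').range := by
    ext y
    simp only [AddSubgroup.mem_map, AddMonoidHom.mem_range, nsmulAddMonoidHom_apply]
    constructor
    · rintro ⟨_, ⟨x, rfl⟩, rfl⟩
      exact ⟨φ x, by simp⟩
    · rintro ⟨x, rfl⟩
      exact ⟨d • φ.symm x, ⟨_, rfl⟩, by simp⟩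
  rw [mulCard, mulCard, ← h]
  exact Nat.card_congr ((nsmulAddMonoidHom d : F →+ F).range.equivMapOfInjective _
    φ.injective).toEquiv

lemma mulCard_pi {ι : Type*} [Fintype ι] (G : ι → Type*) [∀ i, AddCommGroup (G i)] (d : ℕ) :
    mulCard d (∀ i, G i) = ∏ i, mulCard d (G i) := by
  have h : (nsmulAddMonoidHom d : (∀ i, G i) →+ (∀ i, G i)).range =
      AddSubgroup.pi Set.univ fun i => (nsmulAddMonoidHom d : G i →+ G i).range := by
    ext y
    simp only [AddMonoidHom.mem_range, nsmulAddMonoidHom_apply, AddSubgroup.mem_pi, Set.mem_univ,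
      forall_true_left]
    constructor
    · rintro ⟨x, rfl⟩ i
      exact ⟨x i, rfl⟩
    · intro hy
      choose x hx using hy
      exact ⟨x, funext hx⟩
  rw [mulCard, h]
  unfold mulCard
  rw [← Nat.card_pi]
  exact Nat.card_congr
    { toFun := fun y i => ⟨y.1 i, y.2 i trivial⟩
      invFun := fun y => ⟨fun i => (y i).1, fun i _ => (y i).2⟩
      left_inv := fun _ => rfl
      right_inv := fun _ => rfl }

lemma mulCard_zmod (q d : ℕ) (hq : q ≠ 0) : mulCard d (ZMod q) = q / q.gcd d := by
  have h : (nsmulAddMonoidHom d : ZMod q →+ ZMod q).range =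
      AddSubgroup.zmultiples (d : ZMod q) := by
    ext y
    simp only [AddMonoidHom.mem_range, nsmulAddMonoidHom_apply, AddSubgroup.mem_zmultiples_iff]
    constructor
    · rintro ⟨x, rfl⟩
      obtain ⟨k, rfl⟩ := ZMod.intCast_surjective x
      exact ⟨k, by simp [mul_comm]⟩
    · rintro ⟨k, rfl⟩
      exact ⟨k, by simp [mul_comm]⟩
  rw [mulCard, h, Nat.card_zmultiples, ZMod.addOrderOf_coe d hq]

lemma mulCard_pos (d : ℕ) (F : Type*) [AddCommGroup F] [Finite F] : 0 < mulCard d F :=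
  Nat.card_pos

lemma mulCard_eq_one_iff {d : ℕ} {F : Type*} [AddCommGroup F] [Finite F] :
    mulCard d F = 1 ↔ ∀ x : F, d • x = 0 := by
  rw [mulCard, AddSubgroup.card_eq_one, AddMonoidHom.range_eq_bot_iff]
  exact ⟨fun h x => DFunLike.congr_fun h x, fun h => AddMonoidHom.ext h⟩

/-- On a cyclic p-group multiplication by p shrinks d·ℤ/p^a by the factor p as long as it is
nonzero; on a cyclic q-group with q ≠ p it is bijective. -/
lemma mulCard_zmod_prime_mul {p q : ℕ} (hp : p.Prime) (hq : q.Prime) (a d : ℕ) :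
    mulCard d (ZMod (q ^ a)) =
      mulCard (p * d) (ZMod (q ^ a)) * if q = p ∧ ¬ q ^ a ∣ d then p else 1 := by
  have h0 : q ^ a ≠ 0 := (pow_pos hq.pos a).ne'
  rw [mulCard_zmod _ _ h0, mulCard_zmod _ _ h0]
  by_cases hqp : q = p
  · subst hqp
    by_cases hd : q ^ a ∣ d
    · rw [if_neg (by simp [hd]), mul_one, Nat.gcd_eq_left hd, Nat.gcd_eq_left (hd.mul_left q)]
    · rw [if_pos ⟨rfl, hd⟩]
      obtain ⟨b, hb, hgcd⟩ := (Nat.dvd_prime_pow hq).mp (Nat.gcd_dvd_left (q ^ a) d)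
      have hba : b < a := by
        refine lt_of_le_of_ne hb ?_
        rintro rfl
        exact hd (Nat.gcd_eq_left_iff_dvd.mp hgcd)
      have hgcd' : (q ^ a).gcd (q * d) = q ^ (b + 1) := by
        obtain ⟨c, rfl⟩ := Nat.exists_eq_add_of_lt hba
        have h1 : q ^ (b + c + 1) = q * q ^ (b + c) := by ring
        have h2 : (q ^ (b + c)).gcd d = q ^ b := by
          apply Nat.dvd_antisymm
          · rw [← hgcd]
            exact Nat.gcd_dvd_gcd_of_dvd_left _ (pow_dvd_pow q (Nat.le_succ _))
          · exact Nat.dvd_gcd (pow_dvd_pow q (Nat.le_add_right _ _))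
              (hgcd ▸ Nat.gcd_dvd_right _ _)
        rw [h1, Nat.gcd_mul_left, h2, pow_succ, mul_comm]
      rw [hgcd, hgcd', Nat.pow_div hba.le hq.pos, Nat.pow_div hba hq.pos, ← pow_succ]
      congr 1
      omega
  · rw [if_neg (fun h => hqp h.1), mul_one]
    have hco : (q ^ a).Coprime p := Nat.Coprime.pow_left a ((Nat.coprime_primes hq hp).mpr hqp)
    rw [Nat.Coprime.gcd_mul_left_cancel_right d hco.symm]

/-! ### Sums of cyclic groups of prime power order -/

section PrimePowers

variable {ι : Type*} {p a : ι → ℕ} {F : Type*} [AddCommGroup F]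

-- The number of cyclic q-summands not killed by d is the group-side counterpart of the exponent in
-- `exists_annProb_prime_mul`.
open Classical in
lemma mulCard_prime_mul [Fintype ι] (hp : ∀ i, (p i).Prime) (φ : F ≃+ ∀ i, ZMod (p i ^ a i)) {q : ℕ}
    (hq : q.Prime) (d : ℕ) : mulCard d F = mulCard (q * d) F *
      q ^ (Finset.univ.filter fun i => p i = q ∧ ¬ p i ^ a i ∣ d).card := by
  rw [mulCard_congr φ, mulCard_congr φ, mulCard_pi, mulCard_pi, ← Finset.prod_const,
    Finset.prod_filter, ← Finset.prod_mul_distrib]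
  exact Finset.prod_congr rfl fun i _ => mulCard_zmod_prime_mul hq (hp i) _ _

lemma not_dvd_of_isOver {m : ℕ} (hp : ∀ i, (p i).Prime) (φ : F ≃+ ∀ i, ZMod (p i ^ a i))
    (hF : IsOver m F) {i : ι} (hi : a i ≠ 0) : ¬ p i ^ a i ∣ m := by
  classical
  intro hdvd
  let A₁ : AddSubgroup (∀ i, ZMod (p i ^ a i)) :=
    (AddMonoidHom.single (fun i => ZMod (p i ^ a i)) i).range
  let A₂ : AddSubgroup (∀ i, ZMod (p i ^ a i)) :=
    (Pi.evalAddMonoidHom (fun i => ZMod (p i ^ a i)) i).ker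
  have hcompl : IsCompl A₁ A₂ := by
    refine ⟨AddSubgroup.disjoint_def.mpr ?_, codisjoint_iff.mpr ?_⟩
    · rintro _ ⟨x, rfl⟩ hx
      have : x = 0 := by simpa [A₂] using hx
      simp [this]
    · rw [eq_top_iff]
      intro x _
      refine AddSubgroup.mem_sup.mpr ⟨Pi.single i (x i), ⟨x i, rfl⟩, x - Pi.single i (x i), ?_, ?_⟩
      · simp [A₂]
      · abel
  have hcompl' := (φ.symm.mapAddSubgroup).isCompl hcompl
  have hne : φ.symm.mapAddSubgroup A₁ ≠ ⊥ := by
    intro h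
    have h1 : A₁ = ⊥ := by
      rw [← φ.symm.mapAddSubgroup.map_bot] at h
      exact φ.symm.mapAddSubgroup.injective h
    have h2 : (Pi.single i 1 : ∀ i, ZMod (p i ^ a i)) ∈ A₁ := ⟨1, rfl⟩
    rw [h1, AddSubgroup.mem_bot, Pi.single_eq_zero_iff] at h2
    have : Fact (1 < p i ^ a i) := ⟨Nat.one_lt_pow hi (hp i).one_lt⟩
    exact one_ne_zero h2
  obtain ⟨x, hx, hmx⟩ := hF _ _ hcompl' hne
  apply hmx
  obtain ⟨_, ⟨z, rfl⟩, rfl⟩ := hx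
  have hz : m • z = 0 := by
    rw [nsmul_eq_mul, (ZMod.natCast_eq_zero_iff _ _).mpr hdvd, zero_mul]
  change m • φ.symm _ = 0
  rw [← map_nsmul, ← map_nsmul, hz, map_zero, map_zero]

/-- Suppose m = q^v m' with q ∤ m' kills a summand F₁ containing an element x of prime order q.
Every cyclic q-summand has order exceeding q^v, so x = q^v z, and z may be projected into F₁. Then
m' x = m z = 0, which contradicts q ∤ m'. -/
lemma isOver_of_not_dvd [Finite ι] {m : ℕ} (hm : m ≠ 0) (hp : ∀ i, (p i).Prime)
    (φ : F ≃+ ∀ i, ZMod (p i ^ a i)) (h : ∀ i, ¬ p i ^ a i ∣ m) : IsOver m F := by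
  intro F₁ F₂ hcompl hne
  by_contra! hkill
  have hne0 : ∀ i, NeZero (p i ^ a i) := fun i => ⟨(pow_pos (hp i).pos _).ne'⟩
  have hfin : Finite F := Finite.of_equiv _ φ.symm.toEquiv
  obtain ⟨⟨y, hy⟩, hy'⟩ := AddSubgroup.ne_bot_iff_exists_ne_zero.mp hne
  have hy0 : y ≠ 0 := fun h => hy' (Subtype.ext h)
  obtain ⟨q, hq, hqy⟩ := Nat.exists_prime_and_dvd (n := addOrderOf y)
    fun h => hy0 (AddMonoid.addOrderOf_eq_one_iff.mp h)
  obtain ⟨t, ht⟩ := hqy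
  set x : F := t • y with hx
  have hxF : x ∈ F₁ := nsmul_mem hy t
  have hqx : q • x = 0 := by
    rw [hx, smul_smul, ← ht, addOrderOf_nsmul_eq_zero]
  have hx0 : x ≠ 0 := by
    intro h0
    have h1 := addOrderOf_dvd_of_nsmul_eq_zero h0
    have h2 : 0 < t := Nat.pos_of_ne_zero fun h => by
      rw [h, mul_zero] at ht
      exact (addOrderOf_pos y).ne' ht
    have h3 := Nat.le_of_dvd h2 h1
    rw [ht] at h3
    have := hq.two_le
    nlinarith
  clear_value x
  obtain ⟨v, m', hm', rfl⟩ := Nat.exists_eq_pow_mul_and_not_dvd hm q hq.ne_one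
  have hcoord : ∀ i, ∃ z : ZMod (p i ^ a i), φ x i = q ^ v • z := by
    intro i
    have h1 : q • φ x i = 0 := by
      have := congrArg (fun w => φ w i) hqx
      simpa using this
    by_cases hqi : p i = q
    · have hav : v < a i := by
        by_contra hle
        apply h i
        rw [hqi]
        exact (pow_dvd_pow q (not_lt.mp hle)).mul_right m'
      obtain ⟨c, hc⟩ := ZMod.natCast_zmod_surjective (n := p i ^ a i) (φ x i)
      obtain ⟨b, hb⟩ := Nat.exists_eq_add_of_lt hav
      rw [← hc, nsmul_eq_mul, ← Nat.cast_mul, ZMod.natCast_eq_zero_iff, hqi, hb, pow_succ',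
        Nat.mul_dvd_mul_iff_left hq.pos] at h1
      obtain ⟨c', rfl⟩ := (pow_dvd_pow q (Nat.le_add_right v b)).trans h1
      exact ⟨c', by rw [← hc, nsmul_eq_mul, Nat.cast_mul]⟩
    · refine ⟨0, ?_⟩
      have hco : (q : ℕ).Coprime (p i ^ a i) :=
        Nat.Coprime.pow_right _ ((Nat.coprime_primes hq (hp i)).mpr (Ne.symm hqi))
      rw [nsmul_eq_mul] at h1
      rw [smul_zero]
      exact (((ZMod.isUnit_iff_coprime q _).mpr hco).mul_right_eq_zero).mp h1
  choose z hz using hcoord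
  have hxz : x = q ^ v • φ.symm z := by
    apply φ.injective
    rw [map_nsmul, AddEquiv.apply_symm_apply]
    exact funext hz
  obtain ⟨z₁, hz₁, z₂, hz₂, hzz⟩ := AddSubgroup.mem_sup.mp
    (hcompl.sup_eq_top ▸ AddSubgroup.mem_top (φ.symm z))
  have hx1 : x = q ^ v • z₁ := by
    rw [← hzz, smul_add] at hxz
    have h1 : q ^ v • z₂ ∈ F₁ := by
      have : q ^ v • z₂ = x - q ^ v • z₁ := by rw [hxz]; abel
      rw [this]
      exact sub_mem hxF (nsmul_mem hz₁ _)
    have h2 := AddSubgroup.disjoint_def.mp hcompl.disjoint h1 (nsmul_mem hz₂ _)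
    rw [hxz, h2, add_zero]
  have hm'x : m' • x = 0 := by
    rw [hx1, smul_smul, mul_comm]
    exact hkill z₁ hz₁
  apply hx0
  have h1 := Nat.dvd_gcd (addOrderOf_dvd_of_nsmul_eq_zero hqx)
      (addOrderOf_dvd_of_nsmul_eq_zero hm'x)
  rw [(hq.coprime_iff_not_dvd.mpr hm').gcd_eq_one] at h1
  exact AddMonoid.addOrderOf_eq_one_iff.mp (Nat.dvd_one.mp h1)

end PrimePowers

lemma exists_equiv_pi_zmod (F : Type*) [AddCommGroup F] [Finite F] :
    ∃ (ι : Type) (_ : Fintype ι) (p a : ι → ℕ), (∀ i, (p i).Prime) ∧ (∀ i, a i ≠ 0) ∧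
      Nonempty (F ≃+ ∀ i, ZMod (p i ^ a i)) := by
  classical
  obtain ⟨ι, _, p, hp, a, ⟨φ⟩⟩ := AddCommGroup.equiv_directSum_zmod_of_finite F
  refine ⟨{i // a i ≠ 0}, inferInstance, fun i => p i, fun i => a i, fun i => hp i, fun i => i.2,
    ⟨(φ.trans (DirectSum.addEquivProd fun i => ZMod (p i ^ a i))).trans
      (AddEquiv.ofBijective
        ({ toFun := fun x i => x i
           map_zero' := rfl
           map_add' := fun _ _ => rfl } :
          (∀ i, ZMod (p i ^ a i)) →+ ∀ i : {i // a i ≠ 0}, ZMod (p i ^ a i)) ⟨?_, ?_⟩)⟩⟩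
  · intro x y hxy
    funext i
    by_cases hi : a i = 0
    · have : Subsingleton (ZMod (p i ^ a i)) := by
        rw [hi, pow_zero]
        infer_instance
      exact Subsingleton.elim _ _
    · exact congrFun hxy ⟨i, hi⟩
  · intro y
    refine ⟨fun i => if hi : a i ≠ 0 then y ⟨i, hi⟩ else 0, ?_⟩
    funext i
    exact dif_pos i.2

lemma subsingleton_of_isOver_zero {F : Type*} [AddCommGroup F] (h : IsOver 0 F) :
    Subsingleton F := by
  by_contra hF
  rw [not_subsingleton_iff_nontrivial] at hF
  obtain ⟨x, -, hx⟩ := h ⊤ ⊥ isCompl_top_bot top_ne_bot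
  exact hx (zero_smul _ x)

lemma isOver_zero_of_subsingleton (F : Type*) [AddCommGroup F] [Subsingleton F] (m : ℕ) :
    IsOver m F := fun F₁ _ _ hne => absurd (Subsingleton.elim F₁ ⊥) hne

/-- A finite abelian group `F` over `m` is determined by the orders of the groups `d F`,
for `d` a multiple of `m`. -/
lemma nonempty_addEquiv_of_mulCard_eq {F F' : Type*} [AddCommGroup F] [Finite F]
    [AddCommGroup F'] [Finite F'] {m : ℕ} (hm : m ≠ 0) (hF : IsOver m F) (hF' : IsOver m F')
    (h : ∀ d, d ≠ 0 → m ∣ d → mulCard d F = mulCard d F') : Nonempty (F ≃+ F') := by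
  classical
  obtain ⟨ι, _, p, a, hp, ha, ⟨φ⟩⟩ := exists_equiv_pi_zmod F
  obtain ⟨ι', _, p', a', hp', ha', ⟨φ'⟩⟩ := exists_equiv_pi_zmod F'
  -- The multiplier d = m q^(b − v_q(m)) is a multiple of m with q-adic valuation b, so it fails to
  -- kill exactly the q-summands of order above q^b.
  have hcount : ∀ {κ : Type} [Fintype κ] (P A : κ → ℕ) {q : ℕ}, q.Prime → ∀ b,
      m.factorization q ≤ b →
      (Finset.univ.filter fun i => P i = q ∧ ¬ P i ^ A i ∣ m * q ^ (b - m.factorization q)) =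
      Finset.univ.filter fun i => P i = q ∧ b < A i := by
    intro κ _ P A q hq b hb
    refine Finset.filter_congr fun i _ => and_congr_right ?_
    rintro rfl
    have h0 : m * P i ^ (b - m.factorization (P i)) ≠ 0 :=
      mul_ne_zero hm (pow_ne_zero _ hq.ne_zero)
    rw [hq.pow_dvd_iff_le_factorization h0, Nat.factorization_mul hm (pow_ne_zero _ hq.ne_zero),
      Finsupp.add_apply, hq.factorization_pow, Finsupp.single_eq_same, not_le]
    omega
  have hlt : ∀ {q : ℕ}, q.Prime → ∀ b, m.factorization q ≤ b →
      (Finset.univ.filter fun i => p i = q ∧ b < a i).card =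
      (Finset.univ.filter fun i => p' i = q ∧ b < a' i).card := by
    intro q hq b hb
    rw [← hcount p a hq b hb, ← hcount p' a' hq b hb]
    have hd0 : m * q ^ (b - m.factorization q) ≠ 0 := mul_ne_zero hm (pow_ne_zero _ hq.ne_zero)
    have h1 := mulCard_prime_mul hp φ hq (m * q ^ (b - m.factorization q))
    have h2 := mulCard_prime_mul hp' φ' hq (m * q ^ (b - m.factorization q))
    rw [h _ hd0 (Dvd.intro _ rfl), h _ (mul_ne_zero hq.ne_zero hd0)
      ((Dvd.intro _ rfl : m ∣ _).mul_left q), h2] at h1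
    exact (Nat.pow_right_injective hq.two_le (Nat.eq_of_mul_eq_mul_left (mulCard_pos _ _) h1)).symm
  -- Summands of order exactly q^b are counted by a difference of two such numbers when b > v_q(m).
  -- For smaller b there are none, because both groups are over m.
  have heq : ∀ c : ℕ × ℕ, Nonempty ({i // (p i, a i) = c} ≃ {i // (p' i, a' i) = c}) := by
    rintro ⟨q, b⟩
    refine ⟨Fintype.equivOfCardEq ?_⟩
    rw [Fintype.card_subtype, Fintype.card_subtype]
    simp only [Prod.mk.injEq]
    by_cases hq : q.Prime
    · by_cases hb : m.factorization q < b
      · have hsplit : ∀ {κ : Type} [Fintype κ] (P A : κ → ℕ),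
            (Finset.univ.filter fun i => P i = q ∧ b - 1 < A i).card =
            (Finset.univ.filter fun i => P i = q ∧ A i = b).card +
            (Finset.univ.filter fun i => P i = q ∧ b < A i).card := by
          intro κ _ P A
          rw [← Finset.card_union_of_disjoint]
          · congr 1
            ext i
            simp only [Finset.mem_filter, Finset.mem_univ, true_and, Finset.mem_union]
            omega
          · rw [Finset.disjoint_filter]
            intro i _ h1 h2
            omega
        have h1 := hsplit p a
        have h2 := hsplit p' a'
        rw [hlt hq _ (by omega), hlt hq _ (by omega)] at h1
        omega
      · rw [Finset.filter_eq_empty_iff.mpr, Finset.filter_eq_empty_iff.mpr]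
        · simp
        · rintro i - ⟨rfl, rfl⟩
          exact not_dvd_of_isOver hp' φ' hF' (ha' i)
            ((hq.pow_dvd_iff_le_factorization hm).mpr (not_lt.mp hb))
        · rintro i - ⟨rfl, rfl⟩
          exact not_dvd_of_isOver hp φ hF (ha i)
            ((hq.pow_dvd_iff_le_factorization hm).mpr (not_lt.mp hb))
    · rw [Finset.filter_eq_empty_iff.mpr, Finset.filter_eq_empty_iff.mpr]
      · simp
      · rintro i - ⟨rfl, -⟩
        exact hq (hp' i)
      · rintro i - ⟨rfl, -⟩
        exact hq (hp i)
  let σ : ι ≃ ι' := Equiv.ofFiberEquiv fun c => (heq c).some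
  have hσ : ∀ i, (p' (σ i), a' (σ i)) = (p i, a i) := fun i =>
    Equiv.ofFiberEquiv_map (fun c => (heq c).some) i
  have hσ' : ∀ i, p i ^ a i = p' (σ i) ^ a' (σ i) := fun i => by
    have := hσ i
    rw [Prod.mk.injEq] at this
    rw [this.1, this.2]
  let χ₁ : (∀ i, ZMod (p i ^ a i)) ≃+ ∀ i, ZMod (p' (σ i) ^ a' (σ i)) :=
    AddEquiv.piCongrRight fun i => (ZMod.ringEquivCongr (hσ' i)).toAddEquiv
  let χ₂ : (∀ i, ZMod (p' (σ i) ^ a' (σ i))) ≃+ ∀ i, ZMod (p' i ^ a' i) :=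
    (RingEquiv.piCongrLeft (fun i => ZMod (p' i ^ a' i)) σ).toAddEquiv
  exact ⟨((φ.trans χ₁).trans χ₂).trans φ'.symm⟩

end

noncomputable section

/-! ### The finite group attached to an independent random subgroup -/

variable {n : ℕ} {μ : Measure (ClosedAddSubgroup (Ahat n))}

/-- The exponent `r` with `P(p d e_0 ∈ H) = p ^ r P(d e_0 ∈ H)` for `d = m p ^ j`. -/
def jump (μ : Measure (ClosedAddSubgroup (Ahat n))) (m p j : ℕ) : ℕ :=
  sInf {r | annProb μ (p * (m * p ^ j)) = (p : ℝ) ^ r * annProb μ (m * p ^ j)}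

namespace Independent

variable {m D : ℕ}

lemma annProb_eq_gcd (hμ : Independent μ) (hD : annProb μ D = 1) {d : ℕ} (hd : 0 < d) :
    annProb μ d = annProb μ (d.gcd D) := by
  have h1 := hμ.annProb_mul_eq_gcd_mul_lcm (b := D) hd
  have h2 : annProb μ (d.lcm D) = 1 :=
    le_antisymm (hμ.annProb_le_one _) (hD ▸ hμ.annProb_mono (Nat.dvd_lcm_right d D))
  rwa [hD, h2, mul_one, mul_one] at h1

lemma annProb_jump (hμ : Independent μ) (hm : 0 < annProb μ m) {p : ℕ} (hp : p.Prime) (j : ℕ) :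
    annProb μ (p * (m * p ^ j)) = (p : ℝ) ^ jump μ m p j * annProb μ (m * p ^ j) := by
  obtain ⟨r, hr, -⟩ := hμ.exists_annProb_prime_mul hp
    (hm.trans_le (hμ.annProb_mono (Dvd.intro (p ^ j) rfl)))
  exact Nat.sInf_mem
    (s := {r | annProb μ (p * (m * p ^ j)) = (p : ℝ) ^ r * annProb μ (m * p ^ j)}) ⟨r, hr⟩

lemma jump_antitone (hμ : Independent μ) (hm : 0 < annProb μ m) {p : ℕ} (hp : p.Prime) :
    Antitone (jump μ m p) := by
  refine antitone_nat_of_succ_le fun j => ?_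
  have h1 : p * (m * p ^ j) = m * p ^ (j + 1) := by ring
  refine hμ.exponent_antitone hp (hm.trans_le (hμ.annProb_mono (Dvd.intro (p ^ j) rfl)))
    (hμ.annProb_jump hm hp j) ?_
  rw [h1]
  exact hμ.annProb_jump hm hp (j + 1)

/-- The jump at `d` only depends on the `p`-part of `d`. -/
lemma annProb_prime_mul (hμ : Independent μ) (hm : 0 < annProb μ m) (hm0 : 0 < m) {p : ℕ}
    (hp : p.Prime) (j : ℕ) {t : ℕ} (ht : ¬ p ∣ t) :
    annProb μ (p * (m * p ^ j * t)) = (p : ℝ) ^ jump μ m p j * annProb μ (m * p ^ j * t) := by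
  set c := m * p ^ j with hc
  have hc0 : 0 < c := Nat.mul_pos hm0 (pow_pos hp.pos j)
  have hcpos : 0 < annProb μ c := hm.trans_le (hμ.annProb_mono (Dvd.intro (p ^ j) rfl))
  -- For p ∤ t the numbers pc and ct have gcd c and lcm pct, so the jump at ct equals the jump at c.
  have h1 := hμ.annProb_mul_eq_gcd_mul_lcm (a := p * c) (b := c * t) (Nat.mul_pos hp.pos hc0)
  have hco : p.Coprime t := hp.coprime_iff_not_dvd.mpr ht
  have hgcd : (p * c).gcd (c * t) = c := by
    rw [mul_comm p c, Nat.gcd_mul_left, hco, mul_one]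
  have hlcm : (p * c).lcm (c * t) = p * (c * t) := by
    rw [mul_comm p c, Nat.lcm_mul_left, hco.lcm_eq_mul]
    ring
  rw [hgcd, hlcm, hc, hμ.annProb_jump hm hp j, ← hc] at h1
  refine mul_left_cancel₀ hcpos.ne' ?_
  rw [← h1]
  ring

/-- P(d) depends only on gcd(d, D), which multiplication by p leaves unchanged once d contains the
whole p-part of D. The exponent of p in D is less than D, so j ≥ D is enough. -/
lemma jump_eq_zero (hμ : Independent μ) (hm : 0 < annProb μ m) (hm0 : 0 < m) (hD0 : 0 < D)
    (hD : annProb μ D = 1) {p : ℕ} (hp : p.Prime) {j : ℕ} (h : ¬ p ∣ D ∨ D ≤ j) :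
    jump μ m p j = 0 := by
  set c := m * p ^ j with hc
  have hc0 : 0 < c := Nat.mul_pos hm0 (pow_pos hp.pos j)
  have hcpos : 0 < annProb μ c := hm.trans_le (hμ.annProb_mono (Dvd.intro (p ^ j) rfl))
  have hgcd : (p * c).gcd D = c.gcd D := by
    obtain ⟨a, u, hu, hDau⟩ := Nat.exists_eq_pow_mul_and_not_dvd hD0.ne' p hp.ne_one
    have hcop : p.Coprime u := hp.coprime_iff_not_dvd.mpr hu
    have hac : p ^ a ∣ c := by
      rcases h with h | h
      · rcases Nat.eq_zero_or_pos a with rfl | ha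
        · simp
        · exact absurd (hDau ▸ (dvd_pow_self p ha.ne').mul_right u) h
      · have h1 : a < D := by
          calc a < p ^ a := Nat.lt_pow_self hp.one_lt
            _ ≤ D := Nat.le_of_dvd hD0 (hDau ▸ Dvd.intro u rfl)
        exact (pow_dvd_pow p (h1.le.trans h)).mul_left m
    rw [hDau, Nat.Coprime.gcd_mul _ (hcop.pow_left a), Nat.Coprime.gcd_mul _ (hcop.pow_left a),
      Nat.gcd_eq_right hac, Nat.gcd_eq_right (hac.mul_left p),
      Nat.Coprime.gcd_mul_left_cancel c hcop]
  have h1 := hμ.annProb_jump hm hp j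
  rw [← hc, hμ.annProb_eq_gcd hD (Nat.mul_pos hp.pos hc0), hgcd, ← hμ.annProb_eq_gcd hD hc0] at h1
  have h2 : (p : ℝ) ^ jump μ m p j = 1 := by
    refine mul_right_cancel₀ hcpos.ne' ?_
    rw [one_mul]
    exact h1.symm
  by_contra hne
  have h3 : (1 : ℝ) < p := by exact_mod_cast hp.one_lt
  exact (one_lt_pow₀ h3 hne).ne' h2

end Independent

/-- An antitone sequence that vanishes from `D` on is recovered from its conjugate. -/
lemma lt_card_filter_iff {R : ℕ → ℕ} (hR : Antitone R) {D : ℕ} (hD : ∀ j, D ≤ j → R j = 0)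
    (i j : ℕ) : j < ((Finset.range D).filter fun l => i < R l).card ↔ i < R j := by
  constructor
  · intro h
    by_contra hi
    have h1 : (Finset.range D).filter (fun l => i < R l) ⊆ Finset.range j := by
      intro l hl
      rw [Finset.mem_filter] at hl
      rw [Finset.mem_range]
      by_contra hlj
      have := hR (not_lt.mp hlj)
      omega
    have := Finset.card_le_card h1
    rw [Finset.card_range] at this
    omega
  · intro h
    have h1 : Finset.range (j + 1) ⊆ (Finset.range D).filter (fun l => i < R l) := by
      intro l hl
      rw [Finset.mem_range] at hl
      have h2 := hR (Nat.lt_succ_iff.mp hl)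
      rw [Finset.mem_filter, Finset.mem_range]
      refine ⟨?_, by omega⟩
      by_contra hlD
      have := hD l (not_lt.mp hlD)
      omega
    have := Finset.card_le_card h1
    rw [Finset.card_range] at this
    omega

/-- There is a finite abelian group `F` over `m` with `P(d e_0 ∈ H) = 1 / |d F|` for all positive
multiples `d` of `m`. -/
lemma Independent.exists_group (hμ : Independent μ) {m D : ℕ} (hm : 0 < annProb μ m)
    (hm0 : 0 < m) (hD0 : 0 < D) (hD : annProb μ D = 1) :
    ∃ (F : Type) (_ : AddCommGroup F) (_ : Finite F), IsOver m F ∧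
      ∀ d, 0 < d → m ∣ d → annProb μ d * mulCard d F = 1 := by
  classical
  let R := jump μ m
  -- The conjugate of the partition R p. Giving the i-th p-summand the exponent v_p(m) + b p i makes
  -- the number of p-summands of exponent above v_p(m) + j equal to R p j.
  let b : ℕ → ℕ → ℕ := fun p i => ((Finset.range D).filter fun l => i < R p l).card
  let ι : Type := Σ p : D.primeFactors, Fin (R p 0)
  let P : ι → ℕ := fun x => x.1
  let A : ι → ℕ := fun x => m.factorization x.1 + b x.1 x.2
  have hP : ∀ x, (P x).Prime := fun x => Nat.prime_of_mem_primeFactors x.1.2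
  have hb : ∀ {p : ℕ}, p.Prime → ∀ i j, j < b p i ↔ i < R p j := fun hp i j =>
    lt_card_filter_iff (hμ.jump_antitone hm hp)
      (fun j hj => hμ.jump_eq_zero hm hm0 hD0 hD hp (Or.inr hj)) i j
  let F : Type := ∀ x : ι, ZMod (P x ^ A x)
  have hne : ∀ x : ι, NeZero (P x ^ A x) := fun x => ⟨(pow_pos (hP x).pos _).ne'⟩
  have hfin : Finite F := inferInstanceAs (Finite (∀ x : ι, ZMod (P x ^ A x)))
  refine ⟨F, inferInstance, hfin, isOver_of_not_dvd hm0.ne' hP (AddEquiv.refl F) fun x => ?_, ?_⟩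
  · rw [(hP x).pow_dvd_iff_le_factorization hm0.ne', not_le]
    have := (hb (hP x) x.2 0).mpr x.2.2
    exact Nat.lt_add_of_pos_right this
  have hcard : ∀ {p : ℕ}, p.Prime → ∀ (j : ℕ) {t : ℕ}, 0 < t → ¬ p ∣ t →
      (Finset.univ.filter fun x => P x = p ∧ ¬ P x ^ A x ∣ m * p ^ j * t).card = R p j := by
    intro p hp j t ht0 ht
    have h1 : ∀ x : ι, P x = p → (¬ P x ^ A x ∣ m * p ^ j * t ↔ (x.2 : ℕ) < R p j) := by
      intro x hx
      have h2 : (m * p ^ j * t).factorization p = m.factorization p + j := by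
        rw [Nat.factorization_mul (mul_ne_zero hm0.ne' (pow_ne_zero _ hp.ne_zero)) ht0.ne',
          Nat.factorization_mul hm0.ne' (pow_ne_zero _ hp.ne_zero)]
        simp [hp.factorization_pow, Nat.factorization_eq_zero_of_not_dvd ht]
      have h3 : A x = m.factorization p + b p x.2 := by
        rw [← hx]
      rw [hx, hp.pow_dvd_iff_le_factorization (mul_ne_zero (mul_ne_zero hm0.ne'
        (pow_ne_zero _ hp.ne_zero)) ht0.ne'), h2, h3, not_le, ← hb hp, Nat.add_lt_add_iff_left]
    rw [Finset.filter_congr (q := fun x => P x = p ∧ (x.2 : ℕ) < R p j) fun x _ =>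
      and_congr_right (h1 x)]
    by_cases hpD : p ∣ D
    · have hmem : p ∈ D.primeFactors := Nat.mem_primeFactors.mpr ⟨hp, hpD, hD0.ne'⟩
      have hle : R p j ≤ R p 0 := hμ.jump_antitone hm hp (Nat.zero_le j)
      have hmap : (Finset.univ.filter fun x : ι => P x = p ∧ (x.2 : ℕ) < R p j) =
          (Finset.univ : Finset (Fin (R p j))).map ⟨fun i => (⟨⟨p, hmem⟩, Fin.castLE hle i⟩ : ι),
            fun i i' h => by
              have h5 := eq_of_heq (Sigma.mk.inj h).2
              exact Fin.castLE_injective hle h5⟩ := by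
        ext x
        simp only [Finset.mem_filter, Finset.mem_univ, true_and, Finset.mem_map]
        constructor
        · obtain ⟨⟨q, hq⟩, i⟩ := x
          rintro ⟨rfl, hi⟩
          exact ⟨⟨i, hi⟩, rfl⟩
        · rintro ⟨i, rfl⟩
          exact ⟨rfl, i.2⟩
      rw [hmap, Finset.card_map, Finset.card_univ, Fintype.card_fin]
    · rw [show R p j = 0 from hμ.jump_eq_zero hm hm0 hD0 hD hp (Or.inl hpD)]
      simp
  have hstep : ∀ {p : ℕ}, p.Prime → ∀ d, 0 < d → m ∣ d →
      annProb μ (p * d) * mulCard (p * d) F = annProb μ d * mulCard d F := by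
    rintro p hp _ hd0 ⟨s, rfl⟩
    obtain ⟨j, t, ht, rfl⟩ := Nat.exists_eq_pow_mul_and_not_dvd
      (Nat.pos_of_mul_pos_left hd0).ne' p hp.ne_one
    have ht0 : 0 < t := Nat.pos_of_ne_zero fun h => ht (h ▸ dvd_zero p)
    rw [← mul_assoc m, hμ.annProb_prime_mul hm hm0 hp j ht,
      mulCard_prime_mul hP (AddEquiv.refl F) hp (m * p ^ j * t), hcard hp j ht0 ht]
    push_cast
    ring
  have hmul : ∀ t, 0 < t → ∀ d, 0 < d → m ∣ d →
      annProb μ (t * d) * mulCard (t * d) F = annProb μ d * mulCard d F := by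
    intro t
    induction t using induction_on_primes with
    | zero => exact fun h => absurd h (lt_irrefl 0)
    | one => simp
    | prime_mul p a hp ih =>
      intro hpa d hd hmd
      have ha := Nat.pos_of_mul_pos_left hpa
      rw [mul_assoc, hstep hp _ (Nat.mul_pos ha hd) (hmd.mul_left a), ih ha d hd hmd]
  intro d hd hmd
  have hcardF : 0 < Nat.card F := Nat.card_pos
  -- The product P(d)|dF| is unchanged when d is multiplied by positive integers; at a multiple of
  -- D|F| both factors are 1.
  rw [← hmul (D * Nat.card F) (Nat.mul_pos hD0 hcardF) d hd hmd]
  have h1 : annProb μ (D * Nat.card F * d) = 1 :=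
    le_antisymm (hμ.annProb_le_one _)
      (hD ▸ hμ.annProb_mono ((Dvd.intro _ rfl : D ∣ D * Nat.card F).mul_right d))
  have h2 : mulCard (D * Nat.card F * d) F = 1 := by
    rw [mulCard_eq_one_iff]
    intro x
    rw [show D * Nat.card F * d = D * d * Nat.card F by ring, mul_nsmul', card_nsmul_eq_zero',
      smul_zero]
  rw [h1, h2, Nat.cast_one, mul_one]

end

noncomputable section

/-! ### The law of `Ann(m𝒜_n) + h(F)` -/

lemma card_addMonoidHom_unitAddCircle (F : Type*) [AddCommGroup F] [Finite F] :
    Nat.card (F →+ UnitAddCircle) = Nat.card F := by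
  have := Fintype.ofFinite F
  have hadd : ∀ s t : Circle, (AddCircle.homeomorphCircle one_ne_zero).symm (s * t) =
      (AddCircle.homeomorphCircle one_ne_zero).symm s +
        ((AddCircle.homeomorphCircle one_ne_zero).symm t : UnitAddCircle) := by
    intro s t
    rw [Homeomorph.symm_apply_eq, AddCircle.homeomorphCircle_apply, AddCircle.toCircle_add,
      ← AddCircle.homeomorphCircle_apply one_ne_zero,
      ← AddCircle.homeomorphCircle_apply one_ne_zero,
      Homeomorph.apply_symm_apply, Homeomorph.apply_symm_apply]
  let E : (F →+ UnitAddCircle) ≃ AddChar F Circle :=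
    { toFun := fun χ =>
        { toFun := fun x => AddCircle.homeomorphCircle one_ne_zero (χ x)
          map_zero_eq_one' := by simp [AddCircle.homeomorphCircle_apply]
          map_add_eq_mul' := fun x y => by
            simp [AddCircle.homeomorphCircle_apply, AddCircle.toCircle_add] }
      invFun := fun ψ => AddMonoidHom.mk'
        (fun x => (AddCircle.homeomorphCircle one_ne_zero).symm (ψ x))
        fun x y => by rw [AddChar.map_add_eq_mul, hadd]
      left_inv := fun χ => by
        ext x
        exact (AddCircle.homeomorphCircle one_ne_zero).symm_apply_apply (χ x)
      right_inv := fun ψ => by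
        refine DFunLike.ext _ _ fun x => ?_
        exact (AddCircle.homeomorphCircle one_ne_zero).apply_symm_apply (ψ x) }
  rw [Nat.card_congr E, Nat.card_congr (AddChar.circleEquivComplex (α := F)).toEquiv,
    Nat.card_eq_fintype_card, Nat.card_eq_fintype_card, AddChar.card_eq]

/-- The characters killed by d are those trivial on dF, that is, the dual of F/dF. Comparing orders
gives the size of the image. -/
lemma mulCard_addMonoidHom (F : Type*) [AddCommGroup F] [Finite F] (d : ℕ) :
    mulCard d (F →+ UnitAddCircle) = mulCard d F := by
  have hfin : Finite (F →+ UnitAddCircle) :=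
    Nat.finite_of_card_ne_zero (by
      rw [card_addMonoidHom_unitAddCircle]
      exact Nat.card_pos.ne')
  set R := (nsmulAddMonoidHom d : F →+ F).range with hR
  set g := (nsmulAddMonoidHom d : (F →+ UnitAddCircle) →+ (F →+ UnitAddCircle)) with hg
  have hmem : ∀ χ : F →+ UnitAddCircle, χ ∈ g.ker ↔ R ≤ χ.ker := by
    intro χ
    rw [AddMonoidHom.mem_ker]
    constructor
    · rintro h _ ⟨x, rfl⟩
      have := DFunLike.congr_fun h x
      rw [AddMonoidHom.mem_ker]
      simpa [hg] using this
    · intro h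
      ext x
      have : χ (d • x) = 0 := h ⟨x, rfl⟩
      simpa [hg] using this
  let E : g.ker ≃ (F ⧸ R →+ UnitAddCircle) :=
    { toFun := fun χ => QuotientAddGroup.lift R χ.1 ((hmem χ.1).mp χ.2)
      invFun := fun ψ => ⟨ψ.comp (QuotientAddGroup.mk' R), (hmem _).mpr fun x hx => by
        rw [AddMonoidHom.mem_ker, AddMonoidHom.comp_apply, QuotientAddGroup.mk'_apply,
          (QuotientAddGroup.eq_zero_iff x).mpr hx, map_zero]⟩
      left_inv := fun χ => Subtype.ext (AddMonoidHom.ext fun x => rfl)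
      right_inv := fun ψ => QuotientAddGroup.addMonoidHom_ext R (AddMonoidHom.ext fun x => rfl) }
  have h1 : Nat.card g.ker = Nat.card (F ⧸ R) := by
    rw [Nat.card_congr E, card_addMonoidHom_unitAddCircle]
  have h2 : Nat.card g.range * Nat.card g.ker = Nat.card F := by
    rw [← AddSubgroup.index_ker, AddSubgroup.index_mul_card, card_addMonoidHom_unitAddCircle]
  have h3 : Nat.card F = Nat.card (F ⧸ R) * Nat.card R :=
    AddSubgroup.card_eq_card_quotient_mul_card_addSubgroup R
  rw [h1, h3, mul_comm] at h2
  exact Nat.eq_of_mul_eq_mul_left Nat.card_pos h2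

variable {n m : ℕ} {F : Type*} [AddCommGroup F] [Finite F] [TopologicalSpace F]

lemma mem_sumSub {h : F →ₜ+ Ahat n} {y : Ahat n} :
    y ∈ sumSub n m h ↔ ∃ a ∈ annMul n m, ∃ f, a + h f = y := by
  change y ∈ (annMul n m ⊔ (h : F →+ Ahat n).range) ↔ _
  rw [AddSubgroup.mem_sup]
  constructor
  · rintro ⟨a, ha, _, ⟨f, rfl⟩, rfl⟩
    exact ⟨a, ha, f, rfl⟩
  · rintro ⟨a, ha, f, rfl⟩
    exact ⟨a, ha, _, ⟨f, rfl⟩, rfl⟩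

lemma smul_e_mem_perp_sumSub (hmn : m ∣ n) (h : F →ₜ+ Ahat n) (d i : ℕ) :
    d • e i ∈ perp (sumSub n m h) ↔ m ∣ d ∧ ∀ f, d • (h f : Torus) i = 0 := by
  have hpair : ∀ y : Torus, pairing (d • e i) y = d • y i := fun y => by
    rw [← pairingHom_apply, map_nsmul, pairingHom_apply, pairing_e]
  rw [mem_perp]
  simp only [hpair, mem_sumSub]
  constructor
  · intro hy
    constructor
    · obtain ⟨w, hw⟩ := dvd_of_forall_pairing_eq_zero (n := m) (x := d • e i) fun y => by
        rw [hpair]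
        -- As m ∣ n, the subgroup Ann(m𝒜_n) is all of `𝒜̂_m`, so annihilating it forces divisibility
        -- by m.
        have hyn : (y : Torus) ∈ Ahat n := by
          rw [mem_Ahat]
          intro j
          obtain ⟨c, rfl⟩ := hmn
          rw [mul_comm, mul_nsmul', mem_Ahat.mp y.2 j, smul_zero]
        exact hy ⟨y, hyn⟩ ⟨⟨y, hyn⟩, mem_annMul.mpr (mem_Ahat.mp y.2), 0, by simp⟩
      have := DFunLike.congr_fun hw i
      simp only [Finsupp.smul_apply, Finsupp.single_eq_same, nsmul_eq_mul, mul_one] at this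
      exact Int.natCast_dvd_natCast.mp (Dvd.intro _ this.symm)
    · intro f
      exact hy (h f) ⟨0, zero_mem _, f, by simp⟩
  · rintro ⟨⟨c, rfl⟩, hf⟩ _ ⟨a, ha, f, rfl⟩
    rw [AddSubgroup.coe_add, Pi.add_apply, smul_add, hf f, add_zero, mul_comm, mul_nsmul',
      mem_annMul.mp ha i, smul_zero]

/-- The homomorphism `h ↦ (d_i h(·)_i)_i`. -/
def coordHom (n : ℕ) (F : Type*) [AddCommGroup F] [TopologicalSpace F] (s : Finset ℕ)
    (d : ℕ → ℕ) : (F →ₜ+ Ahat n) →+ (∀ _ : s, F →+ UnitAddCircle) where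
  toFun h i := d i • ((Pi.evalAddMonoidHom _ (i : ℕ)).comp
    ((AddSubgroup.subtype (Ahat n)).comp (h : F →+ Ahat n)))
  map_zero' := by
    funext i
    ext f
    simp
  map_add' h h' := by
    funext i
    ext f
    simp

lemma coordHom_apply {F : Type*} [AddCommGroup F] [TopologicalSpace F] (s : Finset ℕ)
    (d : ℕ → ℕ) (h : F →ₜ+ Ahat n) (i : s) (f : F) :
    coordHom n F s d h i f = d i • (h f : Torus) i := rfl

variable [DiscreteTopology F]

/-- Since nF = 0, any finite family of characters of F occurs as coordinates of a homomorphism into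
`𝒜̂_n`, so the image is the full product of the groups d_i·Hom(F, 𝕋). -/
lemma card_range_coordHom (hF : ∀ x : F, n • x = 0) (s : Finset ℕ) (d : ℕ → ℕ) :
    Nat.card (coordHom n F s d).range = ∏ i ∈ s, mulCard (d i) F := by
  classical
  have h : (coordHom n F s d).range = AddSubgroup.pi Set.univ fun i : s =>
      (nsmulAddMonoidHom (d i) : (F →+ UnitAddCircle) →+ (F →+ UnitAddCircle)).range := by
    ext y
    simp only [AddMonoidHom.mem_range, nsmulAddMonoidHom_apply, AddSubgroup.mem_pi, Set.mem_univ,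
      forall_true_left]
    constructor
    · rintro ⟨h, rfl⟩ i
      exact ⟨_, rfl⟩
    · intro hy
      choose χ hχ using hy
      let h₀ : F →+ Torus :=
        { toFun := fun f j => if hj : j ∈ s then χ ⟨j, hj⟩ f else 0
          map_zero' := by
            funext j
            simp
          map_add' := fun f f' => by
            funext j
            by_cases hj : j ∈ s <;> simp [hj] }
      have hmem : ∀ f, h₀ f ∈ Ahat n := fun f => by
        rw [mem_Ahat]
        intro j
        have : n • h₀ f = 0 := by rw [← map_nsmul, hF, map_zero]
        exact congrFun this j
      refine ⟨{ toAddMonoidHom := h₀.codRestrict (Ahat n) hmem,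
                continuous_toFun := continuous_of_discreteTopology }, ?_⟩
      funext i
      rw [← hχ i]
      ext f
      rw [coordHom_apply]
      change d i • (if hj : (i : ℕ) ∈ s then χ ⟨i, hj⟩ f else 0) = _
      rw [dif_pos i.2]
      rfl
  rw [h, ← Finset.prod_coe_sort]
  simp only [← mulCard_addMonoidHom F]
  unfold mulCard
  rw [← Nat.card_pi]
  exact Nat.card_congr
    { toFun := fun y i => ⟨y.1 i, y.2 i trivial⟩
      invFun := fun y => ⟨fun i => (y i).1, fun i _ => (y i).2⟩
      left_inv := fun _ => rfl
      right_inv := fun _ => rfl }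

lemma isClosed_ker_coordHom {F : Type*} [AddCommGroup F] [TopologicalSpace F]
    (s : Finset ℕ) (d : ℕ → ℕ) :
    IsClosed ((coordHom n F s d).ker : Set (F →ₜ+ Ahat n)) := by
  have h : ((coordHom n F s d).ker : Set (F →ₜ+ Ahat n)) =
      ⋂ (i : s) (f : F), {h | d i • (h f : Torus) i = 0} := by
    ext h
    simp only [SetLike.mem_coe, AddMonoidHom.mem_ker, Set.mem_iInter, Set.mem_ofPred_eq]
    constructor
    · intro h0 i f
      rw [← coordHom_apply, h0]
      rfl
    · intro h0
      funext i
      ext f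
      exact h0 i f
  rw [h]
  refine isClosed_iInter fun i => isClosed_iInter fun f => isClosed_eq ?_ continuous_const
  have h1 : Continuous fun h : F →ₜ+ Ahat n => h f := continuous_eval_const f
  exact ((continuous_apply (i : ℕ)).comp (continuous_subtype_val.comp h1)).const_smul (d i)

/-- The normalized Haar measure of a closed subgroup of finite index is the inverse of its index. -/
lemma haarHom_real_ker_coordHom (hF : ∀ x : F, n • x = 0) (s : Finset ℕ) (d : ℕ → ℕ) :
    (haarHom n F).real ((coordHom n F s d).ker : Set (F →ₜ+ Ahat n)) =
      ∏ i ∈ s, (mulCard (d i) F : ℝ)⁻¹ := by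
  have hidx : (coordHom n F s d).ker.index = ∏ i ∈ s, mulCard (d i) F := by
    rw [AddSubgroup.index_ker, card_range_coordHom hF]
  have hpos : 0 < ∏ i ∈ s, mulCard (d i) F := Finset.prod_pos fun i _ => mulCard_pos _ _
  have : (coordHom n F s d).ker.FiniteIndex := ⟨by rw [hidx]; exact hpos.ne'⟩
  have : (haarHom n F).IsAddLeftInvariant := by
    unfold haarHom
    infer_instance
  have h1 := AddSubgroup.index_mul_measure (coordHom n F s d).ker
    (isClosed_ker_coordHom s d).measurableSet (haarHom n F)
  rw [hidx, measure_univ] at h1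
  have h2 := congrArg ENNReal.toReal h1
  rw [ENNReal.toReal_mul, ENNReal.toReal_natCast, ENNReal.toReal_one] at h2
  rw [Finset.prod_inv_distrib, ← Nat.cast_prod]
  exact eq_inv_of_mul_eq_one_right h2

/-- The probability that multiples of distinct basis vectors annihilate `Ann(m𝒜_n) + h(F)`. -/
lemma measureReal_annEvents_sumSub (hmn : m ∣ n) (hF : ∀ x : F, n • x = 0) (s : Finset ℕ)
    (d : ℕ → ℕ) : ((haarHom n F).map (sumSub n m)).real
      (annEvents n ((fun i => d i • e i) '' s)) =
      ∏ i ∈ s, if m ∣ d i then (mulCard (d i) F : ℝ)⁻¹ else 0 := by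
  rw [map_measureReal_apply (continuous_sumSub n m).borel_measurable (measurableSet_annEvents n _)]
  by_cases hall : ∀ i ∈ s, m ∣ d i
  · have hset : sumSub n m ⁻¹' annEvents n ((fun i => d i • e i) '' s) =
        ((coordHom n F s d).ker : Set (F →ₜ+ Ahat n)) := by
      ext h
      simp only [Set.mem_preimage, mem_annEvents, Set.forall_mem_image, SetLike.mem_coe,
        AddMonoidHom.mem_ker, smul_e_mem_perp_sumSub hmn]
      constructor
      · intro h0
        funext i
        ext f
        exact (h0 i.2).2 f
      · intro h0 i hi
        refine ⟨hall i hi, fun f => ?_⟩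
        have := coordHom_apply s d h ⟨i, hi⟩ f
        rw [h0] at this
        exact this.symm
    rw [hset, haarHom_real_ker_coordHom hF]
    exact Finset.prod_congr rfl fun i hi => (if_pos (hall i hi)).symm
  · push Not at hall
    obtain ⟨i, hi, hmi⟩ := hall
    have hset : sumSub n m ⁻¹' annEvents n ((fun i => d i • e i) '' s) =
        (∅ : Set (F →ₜ+ Ahat n)) := by
      rw [Set.eq_empty_iff_forall_notMem]
      intro h hh
      exact hmi ((smul_e_mem_perp_sumSub hmn h (d i) i).mp (hh _ ⟨i, hi, rfl⟩)).1
    rw [hset, measureReal_empty, Finset.prod_eq_zero hi (if_neg hmi)]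

lemma annProb_sumSub (hmn : m ∣ n) (hF : ∀ x : F, n • x = 0) (d : ℕ) :
    annProb ((haarHom n F).map (sumSub n m)) d =
      if m ∣ d then (mulCard d F : ℝ)⁻¹ else 0 := by
  have h := measureReal_annEvents_sumSub hmn hF {0} fun _ => d
  rw [Finset.prod_singleton] at h
  rw [← h, annProb]
  congr 1
  ext K
  simp [mem_annEvents, mem_annEvent]

lemma mem_annMul_iff_nsmul {a : Ahat n} : a ∈ annMul n m ↔ m • a = 0 := by
  rw [mem_annMul, Subtype.ext_iff, funext_iff]
  rfl

/-- Composition with an automorphism of `𝒜̂_n` is a continuous surjective endomorphism of Hom(F,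
`𝒜̂_n`), so it preserves Haar measure. The subgroup Ann(m𝒜_n) is the m-torsion, hence
characteristic. -/
lemma finInv_sumSub : FinInv ((haarHom n F).map (sumSub n m)) := by
  intro γ _
  let φ := dualAut n γ
  let Φ : (F →ₜ+ Ahat n) →+ (F →ₜ+ Ahat n) :=
    { toFun := fun h => (φ : Ahat n →ₜ+ Ahat n).comp h
      map_zero' := by
        ext f
        simp
      map_add' := fun h h' => by
        ext f
        simp }
  have hΦ : ∀ h f, Φ h f = φ (h f) := fun _ _ => rfl
  have hcont : Continuous Φ := ContinuousAddMonoidHom.continuous_comp_right _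
  have hsurj : Function.Surjective Φ := fun h =>
    ⟨(φ.symm : Ahat n →ₜ+ Ahat n).comp h, ContinuousAddMonoidHom.ext fun f =>
      φ.apply_symm_apply (h f)⟩
  have : (haarHom n F).IsAddHaarMeasure := by
    unfold haarHom
    infer_instance
  have hpres : (haarHom n F).map Φ = haarHom n F :=
    (AddMonoidHom.measurePreserving hcont hsurj rfl).map_eq
  have hcomm : mapAut φ ∘ sumSub n m = sumSub n m ∘ Φ := by
    funext h
    refine SetLike.ext fun y => ?_
    simp only [Function.comp_apply, mem_mapAut, mem_sumSub, hΦ]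
    constructor
    · rintro ⟨_, ⟨a, ha, f, rfl⟩, rfl⟩
      refine ⟨φ a, ?_, f, (map_add φ a (h f)).symm⟩
      rw [mem_annMul_iff_nsmul] at ha ⊢
      rw [← map_nsmul, ha, map_zero]
    · rintro ⟨a, ha, f, rfl⟩
      refine ⟨φ.symm a + h f, ⟨φ.symm a, ?_, f, rfl⟩, ?_⟩
      · rw [mem_annMul_iff_nsmul] at ha ⊢
        rw [← map_nsmul, ha, map_zero]
      · rw [map_add, ContinuousAddEquiv.apply_symm_apply]
  have hms : Measurable (sumSub n m : (F →ₜ+ Ahat n) → _) :=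
    (continuous_sumSub n m).borel_measurable
  rw [Measure.map_map (measurable_mapAut _) hms, hcomm,
    ← Measure.map_map hms hcont.borel_measurable, hpres]

/-! ### Classification -/

lemma Independent.eq_map_sumSub {μ : Measure (ClosedAddSubgroup (Ahat n))} (hμ : Independent μ)
    (hmn : m ∣ n) (hF : ∀ x : F, n • x = 0)
    (h : ∀ d, annProb μ d = if m ∣ d then (mulCard d F : ℝ)⁻¹ else 0) :
    (haarHom n F).map (sumSub n m) = μ := by
  have := hμ.prob
  have : IsProbabilityMeasure ((haarHom n F).map (sumSub n m)) :=
    Measure.isProbabilityMeasure_map (continuous_sumSub n m).borel_measurable.aemeasurable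
  refine FinInv.ext finInv_sumSub hμ.inv fun s d => ?_
  rw [← measureReal_eq_measureReal_iff, measureReal_annEvents_sumSub hmn hF,
    hμ.measureReal_annEvents]
  exact Finset.prod_congr rfl fun i _ => (h (d i)).symm

lemma mulCard_zero (F : Type*) [AddCommGroup F] [Finite F] : mulCard 0 F = 1 :=
  mulCard_eq_one_iff.mpr fun x => zero_smul ℕ x

lemma Independent.exists_describes {μ : Measure (ClosedAddSubgroup (Ahat n))}
    (hμ : Independent μ) : ∃ (m : ℕ) (F : Type) (_ : AddCommGroup F) (_ : Finite F)
      (_ : TopologicalSpace F) (_ : DiscreteTopology F), Describes n m F μ := by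
  obtain ⟨m, hm⟩ := hμ.exists_support
  have hmn : m ∣ n := (hm n).mp (by rw [hμ.annProb_self]; exact one_pos)
  have hzero : ∀ d, ¬ m ∣ d → annProb μ d = 0 := fun d hd =>
    le_antisymm (not_lt.mp fun h => hd ((hm d).mp h)) (annProb_nonneg d)
  -- If m = 0, then P vanishes on the positive integers, and the trivial group matches it.
  rcases Nat.eq_zero_or_pos m with rfl | hm0
  · refine ⟨0, PUnit, inferInstance, inferInstance, inferInstance, inferInstance,
      isOver_zero_of_subsingleton _ _, hmn, fun _ => rfl,
      hμ.eq_map_sumSub hmn (fun _ => rfl) fun d => ?_⟩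
    split_ifs with hd
    · rw [Nat.zero_dvd.mp hd, hμ.annProb_zero, mulCard_zero, Nat.cast_one, inv_one]
    · exact hzero d hd
  · have hmpos := (hm m).mpr dvd_rfl
    obtain ⟨D, hD0, hD⟩ := hμ.exists_annProb_eq_one hm0 hmpos
    obtain ⟨F, _, _, hF, hcard⟩ := hμ.exists_group hmpos hm0 hD0 hD
    -- For n > 0, P(n) = 1 gives |nF| = 1.
    have hnF : ∀ x : F, n • x = 0 := by
      rcases Nat.eq_zero_or_pos n with rfl | hn
      · exact fun x => zero_smul ℕ x
      · have h1 := hcard n hn hmn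
        rw [hμ.annProb_self, one_mul] at h1
        exact mulCard_eq_one_iff.mp (by exact_mod_cast h1)
    let _ : TopologicalSpace F := ⊥
    have : DiscreteTopology F := ⟨rfl⟩
    refine ⟨m, F, inferInstance, inferInstance, inferInstance, inferInstance, hF, hmn, hnF,
      hμ.eq_map_sumSub hmn hnF fun d => ?_⟩
    split_ifs with hd
    · rcases Nat.eq_zero_or_pos d with rfl | hd0
      · rw [hμ.annProb_zero, mulCard_zero, Nat.cast_one, inv_one]
      · exact eq_inv_of_mul_eq_one_left (hcard d hd0 hd)
    · exact hzero d hd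

lemma Describes.annProb_eq {μ : Measure (ClosedAddSubgroup (Ahat n))} (h : Describes n m F μ)
    (d : ℕ) : annProb μ d = if m ∣ d then (mulCard d F : ℝ)⁻¹ else 0 := by
  obtain ⟨-, hmn, hF, rfl⟩ := h
  exact annProb_sumSub hmn hF d

lemma Describes.annProb_pos_iff {μ : Measure (ClosedAddSubgroup (Ahat n))}
    (h : Describes n m F μ) (d : ℕ) : 0 < annProb μ d ↔ m ∣ d := by
  rw [h.annProb_eq]
  have : (0 : ℝ) < (mulCard d F : ℝ)⁻¹ := inv_pos.mpr (by exact_mod_cast mulCard_pos d F)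
  split_ifs with hd <;> simp [this, hd]

/-- The integer m generates the support of `annProb`, and its values on the support are the inverses
of the orders |dF|. -/
lemma Describes.unique {μ : Measure (ClosedAddSubgroup (Ahat n))} {m' : ℕ} {F' : Type*}
    [AddCommGroup F'] [Finite F'] [TopologicalSpace F'] [DiscreteTopology F']
    (h : Describes n m F μ) (h' : Describes n m' F' μ) : m' = m ∧ Nonempty (F' ≃+ F) := by
  obtain rfl : m' = m := Nat.dvd_antisymm
    ((h'.annProb_pos_iff m).mp ((h.annProb_pos_iff m).mpr dvd_rfl))
    ((h.annProb_pos_iff m').mp ((h'.annProb_pos_iff m').mpr dvd_rfl))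
  refine ⟨rfl, ?_⟩
  rcases Nat.eq_zero_or_pos m' with rfl | hm
  · have := subsingleton_of_isOver_zero h.1
    have := subsingleton_of_isOver_zero h'.1
    exact ⟨⟨⟨fun _ => 0, fun _ => 0, fun _ => Subsingleton.elim _ _,
      fun _ => Subsingleton.elim _ _⟩, fun _ _ => Subsingleton.elim _ _⟩⟩
  · refine nonempty_addEquiv_of_mulCard_eq hm.ne' h'.1 h.1 fun d _ hd => ?_
    have h1 := (h'.annProb_eq d).symm.trans (h.annProb_eq d)
    rw [if_pos hd, if_pos hd, inv_inj] at h1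
    exact_mod_cast h1

end

end CharRandSub

theorem theorem3 (n : ℕ)
    (μ : MeasureTheory.Measure (ClosedAddSubgroup (CharRandSub.Ahat n)))
    (hμ : μ ∈ CharRandSub.CRSe (CharRandSub.Ahat n)) :
    ∃ (m : ℕ) (F : Type) (_ : AddCommGroup F) (_ : Finite F) (_ : TopologicalSpace F)
      (_ : DiscreteTopology F),
      CharRandSub.Describes n m F μ ∧
      ∀ (m' : ℕ) (F' : Type) [AddCommGroup F'] [Finite F'] [TopologicalSpace F']
        [DiscreteTopology F'],
        CharRandSub.Describes n m' F' μ → m' = m ∧ Nonempty (F' ≃+ F) := by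
  obtain ⟨m, F, i₁, i₂, i₃, i₄, h⟩ :=
    (CharRandSub.independent_of_mem_CRSe hμ).exists_describes
  exact ⟨m, F, i₁, i₂, i₃, i₄, h, fun _ _ _ _ _ _ h' => h.unique h'⟩
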